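/- **Notation.** Let $\alpha=\sqrt2$, $\beta=\sqrt2-1$, $\omega=\sqrt2+1$ and $\mathbf u_m=(\cos\frac{m\pi}4,\sin\frac{m\pi}4)$. Let $\mathtt T_{\mathbf d}$ be the translation by $\mathbf d$, $\mathtt R_m$ the rotation about the origin by $m\pi/4$, and $\mathtt U_c$ ($c\in\frac12\mathbb Z$) the reflection in the line through the origin spanned by $\mathbf u_c$. Let $\mathfrak G$ be the group of isometries $\mathtt T_{\mathbf d}\mathtt R_m\mathtt U_0^n$; the parity of an element is its Jacobian determinant. A *tile* is a nonempty bounded open convex polygon $[(m_1,\dots,m_n),(b_1,\dots,b_n)]=\{\mathbf x:\mathbf u_{m_i}\cdot\mathbf x<b_i,\ 1\le i\le n\}$. A *dressed domain* consists of finitely many pairwise disjoint tiles (its *atoms*; degenerate, empty ones are tolerated as stated below), of its domain, which is the interior of the closure of the union of the atoms, and of a map $\rho$ which acts on each atom as an orientation-preserving element of $\mathfrak G$ that maps the atom into the domain. An isometry $\mathtt G\in\mathfrak G$ acts on dressed domains by moving domain and atoms, and by conjugating $\rho$. A *dressed subdomain* of $\mathcal X$ is a dressed domain $\mathcal Y$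 whose domain is contained in that of $\mathcal X$ and whose map is, on each atom of $\mathcal Y$, the first-return map to the domain of $\mathcal Y$ induced by $\rho_{\mathcal X}$, with a return time that is constant on the atom, the points of the atom staying in the atoms of $\mathcal X$ until they return. **Shapes.** $Q_1(a)=[(6,1,3),(a,0,0)]$, $Q_2(a)=[(4,6,0,2),(a,a,a,a)]$, $Q_3(a)=[(6,7,2,3),(a,a,a,a)]$, $Q_4(a,b)=[(6,1,2,3),(a,0,-b,0)]$, $Q_6(a,b)=[(5,6,0,2,3),(0,b,a,b,0)]$, $Q_7(a)=[(5,7,0,2),(0,a,a,0)]$, $Q_8(a,b)=[(4,5,7,0,1,2),(0,0,a,b,b,a)]$, $Q_9(a,b)=[(1,2,3,5,6,7),(a,b,a,a,b,a)]$. To $Q_1,Q_3,Q_4,Q_7,Q_8$ we assign, as axis of symmetry, the line through the origin spanned by $\mathbf u_2,\mathbf u_{5/2},\mathbf u_2,\mathbf u_{7/2},\mathbf u_{1/2}$ respectively. **The strip.** $\widehat{\mathbf S}_J(l,h)$, $J\ge2$, has the $2J$ tiles $S_{2j-1}=\mathtt T_{(-\beta^{j-1}l,\,(-1)^{j-1}(\beta^jl-\alpha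 h))}\mathtt R_{m}X_j$ for $1\le j\le J$, where $m=4$ for $j$ even and $m=0$ for $j$ odd, $X_j=Q_4(\beta^jl-\beta h,\beta^jl-\omega h)$ for $j\le J-2$ and $X_j=Q_1(\beta^jl-\beta h)$ for $j\ge J-1$; $S_{2j}=\mathtt T_{(-\alpha\beta^jl,0)}\mathtt R_mQ_3(h)$ for $1\le j\le J-2$, where $m=0$ for $j$ even and $m=7$ for $j$ odd; $S_{2J-2}=\mathtt T_{(-\alpha\beta^{J-1}l-\beta h,\,(-1)^{J-1}h)}\mathtt R_mQ_8(\alpha\beta^{J-1}l-\alpha\beta h,2h)$, where $m=1$ for $J$ even and $m=6$ for $J$ odd; $S_{2J}=\mathtt T_{(-h,\,(-1)^{J-1}(\alpha\beta^{J-1}l-\omega h))}\mathtt R_mQ_7(\alpha\beta^{J-1}l-\alpha h)$, where $m=3$ for $J$ even and $m=6$ for $J$ odd. **The pencil.** Let $L\ge4$, $l>0$, $\beta^{L-1}l\le h\le\beta^{L-2}l$ and $\nu\in\{1,-1\}$. The prototype pencil $\widehat{\mathcal P}_\nu(l,h)$ with $2L+1$ atoms has the atoms $P_0=Q_2(h)$,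 $P_1=\mathtt T_{(-l,0)}Q_9(\beta l/\alpha-h,h)$, $P_2=\mathtt T_{(-\alpha\beta l-\omega h,-h)}\mathtt R_1Q_7(\alpha h)$, $P_3=\mathtt T_{(-\alpha\beta l-h,-h)}\mathtt R_3Q_1(\beta h)$, $P_4=\mathtt T_{(-\alpha\beta l,0)}\mathtt R_7Q_3(h)$, and $P_{k+4}=\mathtt U_0S_k$, $1\le k\le 2L-4$, where $S_k$ is the $k$-th tile of $\widehat{\mathbf S}_{L-2}(\beta l,h)$. Its map is $\rho=\mathtt U_0\circ\mathtt H$, where $\mathtt H$ reflects each atom about its assigned axis: the image of the axis of its shape under its placement, except that $P_0$ has the axis spanned by $\mathbf u_7$ if $\nu=1$ and by $\mathbf u_1$ if $\nu=-1$, and that $P_1$ has the axis through its centre parallel to $\mathbf u_2$. Put $\mathrm P(l,h)=\mathtt T_{(-\alpha l+\alpha h,0)}Q_6(\alpha l-\beta h,h)$. (The inequalities fix $L$ unless $h/l$ is a power of $\beta$. In the limiting case $h=\beta^{L-2}l$ the last two atoms $P_{2L-1},P_{2L}$ degenerate to the empty set.) **Pencil Shortening Lemma.** Let $L,l,h,\nu$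 be as above, let $\mathtt G\in\mathfrak G$ and $\mathcal P=\mathtt G\widehat{\mathcal P}_\nu(l,h)$. Then $\mathcal P$ is a dressed domain with domain $\mathtt G\,\mathrm P(l,h)$, and the following holds. 1. For $0\le k\le L-4$ the return map induced by $\rho_{\mathcal P}$ on the pentagon $\mathtt G\mathtt U_0^k\,\mathrm P(\beta^kl,h)\subseteq\mathtt G\,\mathrm P(l,h)$ makes it a dressed subdomain of $\mathcal P$, namely the pencil $\mathcal P^{(k)}=\mathtt G\mathtt U_0^k\,\widehat{\mathcal P}_{(-1)^k\nu}(\beta^kl,h)$ with $2(L-k)+1$ atoms, of parity $(-1)^k\det\mathtt G$. These atoms are all nonempty, except that precisely the last two are empty if $h=\beta^{L-2}l$. 2. The minimal pencil $\mathcal P^*=\mathcal P^{(L-4)}$ has the nine atoms $P^*_0,\dots,P^*_8$ and parity $(-1)^L\det\mathtt G$. If $L\ge5$, its incidence matrix with respect to $\mathcal P$ (whose entry $\mathrm M_{P_i,P^*_j}$ is the number of visits to $P_i$ of the return orbit of any point of $P^*_j$, when $P^*_j$ is nonempty) is given for $0\le i\le 2L$ by $$\mathrm M_{P_i,P^*_0}=\delta_{i,0},\quad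 \mathrm M_{P_i,P^*_1}=\delta_{i,2L-5},\quad \mathrm M_{P_i,P^*_2}=\delta_{i,2}+2\sum_{j=4}^{2L-5}\delta_{i,j},$$ $$\mathrm M_{P_i,P^*_3}=2(\delta_{i,2L-6}+\delta_{i,2L-5}),\qquad \mathrm M_{P_i,P^*_j}=\delta_{i,j+2L-8}\quad(4\le j\le8).$$ 3. There are finitely many periodic tiles (tiles which move through the atoms of $\mathcal P$ under $\rho_{\mathcal P}$ and return to themselves as sets) such that the tiles of the return orbits of $P^*_0,\dots,P^*_8$ and of the orbits of these periodic tiles are pairwise disjoint, contained in $\mathtt G\,\mathrm P(l,h)$, and cover it up to a set of measure zero. -/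

import Mathlib

open MeasureTheory
open scoped Real

noncomputable section

namespace Pencil

/-! ### Constants, the plane, and the isometry group

The plane is `ℂ`, with `(x, y)` written `⟨x, y⟩`. -/

def α : ℝ := √2
def β : ℝ := √2 - 1
def ω : ℝ := √2 + 1

/-- Isometries of the plane (a group under composition). -/
abbrev Isom := ℂ ≃ᵃⁱ[ℝ] ℂ

/-- The unit vector `u_m = (cos (m π / 4), sin (m π / 4))`. -/
def u (m : ℤ) : Circle := Circle.exp (m * (π / 4))

/-- Translation by `d`. -/
def T (d : ℂ) : Isom := AffineIsometryEquiv.constVAdd ℝ ℂ d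

/-- Rotation about the origin by the angle `m π / 4`. -/
def R (m : ℤ) : Isom := (rotation (u m)).toAffineIsometryEquiv

/-- `U2 a` is the reflection in the line through the origin that makes the angle
`(a / 2) (π / 4)` with the real axis, that is, in the line generated by `u_{a/2}`
(half-integer indices are allowed): `z ↦ u_a * conj z`. -/
def U2 (a : ℤ) : Isom := (Complex.conjLIE.trans (rotation (u a))).toAffineIsometryEquiv

/-- The reflection `U_0` in the real axis. -/
def U0 : Isom := U2 0

/-- Membership in the group generated by the translations and the symmetries of the regular
octagon, via the canonical form `T_d R_m U_0 ^ n`. -/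
def InGroup (g : Isom) : Prop := ∃ (d : ℂ) (m : ℤ) (n : ℕ), g = T d * R m * U0 ^ n

/-- The Jacobian determinant of an isometry. -/
def parity (g : Isom) : ℝ :=
  LinearMap.det (g.linearIsometryEquiv.toLinearEquiv : ℂ →ₗ[ℝ] ℂ)

/-! ### Tiles -/

/-- The open convex set `[(m_1, …, m_n), (b_1, …, b_n)]`: all `z` with `u_{m_i} · z < b_i`. -/
def octPolygon (es : List (ℤ × ℝ)) : Set ℂ :=
  {z | ∀ e ∈ es, inner ℝ (u e.1 : ℂ) z < e.2}

/-- A tile: an open (nonempty, bounded) convex polygon all of whose edges have their outward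
normals among the `u_m`. -/
def IsTile (X : Set ℂ) : Prop :=
  X.Nonempty ∧ Bornology.IsBounded X ∧ ∃ es : List (ℤ × ℝ), X = octPolygon es

/-- Isosceles right triangle; symmetric about the line generated by `u_2`. -/
def Q1 (l : ℝ) : Set ℂ := octPolygon [(6, l), (1, 0), (3, 0)]
/-- Square. -/
def Q2 (l : ℝ) : Set ℂ := octPolygon [(4, l), (6, l), (0, l), (2, l)]
/-- Rhombus; its short diagonal is along `u_{5/2}`. -/
def Q3 (l : ℝ) : Set ℂ := octPolygon [(6, l), (7, l), (2, l), (3, l)]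
/-- Trapezium; symmetric about the line generated by `u_2`. -/
def Q4 (l₁ l₂ : ℝ) : Set ℂ := octPolygon [(6, l₁), (1, 0), (2, -l₂), (3, 0)]
/-- Pentagon. -/
def Q6 (l₁ l₂ : ℝ) : Set ℂ := octPolygon [(5, 0), (6, l₂), (0, l₁), (2, l₂), (3, 0)]
/-- Kite; symmetric about the line generated by `u_{7/2}`. -/
def Q7 (l : ℝ) : Set ℂ := octPolygon [(5, 0), (7, l), (0, l), (2, 0)]
/-- Hexagon; symmetric about the line generated by `u_{1/2}`. -/
def Q8 (l₁ l₂ : ℝ) : Set ℂ :=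
  octPolygon [(4, 0), (5, 0), (7, l₁), (0, l₂), (1, l₂), (2, l₁)]
/-- Hexagon with two axes of symmetry. -/
def Q9 (l₁ l₂ : ℝ) : Set ℂ :=
  octPolygon [(1, l₁), (2, l₂), (3, l₁), (5, l₁), (6, l₂), (7, l₁)]

/-! ### Dressed domains -/

/-- The data of a dressed domain: its atoms and the isometries by which the domain map acts
on them. -/
structure DressedDomain (n : ℕ) where
  atom : Fin n → Set ℂ
  iso : Fin n → Isom

namespace DressedDomain

variable {n m : ℕ}

/-- The domain, i.e. the span of the tiling by atoms. -/
def domain (X : DressedDomain n) : Set ℂ := interior (closure (⋃ i, X.atom i))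

/-- The data describe a dressed domain: atoms are pairwise disjoint tiles (a tile may have
degenerated to the empty set), each mapped into the domain by an orientation-preserving element
of the group. -/
structure IsDressed (X : DressedDomain n) : Prop where
  tile : ∀ i, X.atom i = ∅ ∨ IsTile (X.atom i)
  disjoint : Pairwise fun i j => Disjoint (X.atom i) (X.atom j)
  inGroup : ∀ i, InGroup (X.iso i)
  orientation : ∀ i, parity (X.iso i) = 1
  maps : ∀ i, X.iso i '' X.atom i ⊆ X.domain

open Classical in
/-- The domain map `ρ`: on the atom `i` it is the isometry `iso i`. It is used only on the union
of the atoms; elsewhere it is given the irrelevant value `z`. -/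
def map (X : DressedDomain n) (z : ℂ) : ℂ :=
  if hz : ∃ i, z ∈ X.atom i then X.iso hz.choose z else z

/-- The image of a dressed domain under an isometry, `(g X, {g X_i}, g ∘ ρ ∘ g⁻¹)`. -/
def transform (g : Isom) (X : DressedDomain n) : DressedDomain n where
  atom i := g '' X.atom i
  iso i := g * X.iso i * g⁻¹

/-- The orbit of `x` under the domain map of `X` stays in the atoms of `X` up to its first return
to `D`, which takes place at time `τ` and at the point `y`. -/
def FirstReturn (X : DressedDomain n) (D : Set ℂ) (τ : ℕ) (x y : ℂ) : Prop :=
  0 < τ ∧ (∀ t < τ, ∃ i, X.map^[t] x ∈ X.atom i) ∧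
    (∀ t, 0 < t → t < τ → X.map^[t] x ∉ D) ∧ X.map^[τ] x = y ∧ y ∈ D

/-- `Y` is a dressed subdomain of `X`: on every atom `j` of `Y` the domain map of `Y` is the
first-return map to the domain of `Y` induced by the domain map of `X`, with return time
`τ j`. -/
structure IsSubdomain (X : DressedDomain n) (Y : DressedDomain m) (τ : Fin m → ℕ) : Prop where
  dressed : Y.IsDressed
  subset : Y.domain ⊆ X.domain
  induced : ∀ j, ∀ x ∈ Y.atom j, X.FirstReturn Y.domain (τ j) x (Y.iso j x)

/-- `M i j` is the number of times that the return orbit of the atom `j` of `Y`, of length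
`τ j`, visits the atom `i` of `X`. -/
def HasIncidence (X : DressedDomain n) (Y : DressedDomain m) (τ : Fin m → ℕ)
    (M : Fin n → Fin m → ℕ) : Prop :=
  ∀ i j, ∀ x ∈ Y.atom j, {t : ℕ | t < τ j ∧ X.map^[t] x ∈ X.atom i}.ncard = M i j

/-- `P` is a periodic tile of `X`: under `p ≥ 1` iterations of the domain map it moves through
atoms, and returns to itself. -/
def IsPeriodicTile (X : DressedDomain n) (P : Set ℂ) (p : ℕ) : Prop :=
  IsTile P ∧ 0 < p ∧ (∀ t < p, ∃ i, X.map^[t] '' P ⊆ X.atom i) ∧ X.map^[p] '' P = P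

/-- All tiles of the return orbits of the atoms of `Y` (with return times `τ`) and of the orbits
of the periodic tiles `P r` (with periods `p r`). -/
def orbitTile (X : DressedDomain n) (Y : DressedDomain m) (τ : Fin m → ℕ) {N : ℕ}
    (P : Fin N → Set ℂ) (p : Fin N → ℕ) : (Σ j, Fin (τ j)) ⊕ (Σ r, Fin (p r)) → Set ℂ
  | .inl a => X.map^[a.2] '' Y.atom a.1
  | .inr a => X.map^[a.2] '' P a.1

/-- The domain of `X` is tiled, up to a set of zero measure, by the return orbits of the atoms
of `Y` and the orbits of finitely many periodic tiles. -/
def RecursivelyTiled (X : DressedDomain n) (Y : DressedDomain m) (τ : Fin m → ℕ) : Prop :=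
  ∃ (N : ℕ) (P : Fin N → Set ℂ) (p : Fin N → ℕ), (∀ r, X.IsPeriodicTile (P r) (p r)) ∧
    (Pairwise fun a b => Disjoint (X.orbitTile Y τ P p a) (X.orbitTile Y τ P p b)) ∧
    (∀ a, X.orbitTile Y τ P p a ⊆ X.domain) ∧
    volume (X.domain \ ⋃ a, X.orbitTile Y τ P p a) = 0

end DressedDomain

/-! ### The strip and the pencil -/

/-- A tile given by a shape, by an assigned axis of the shape (the line generated by
`u_{axis/2}`, through the origin), and by a placement. -/
structure Piece where
  shape : Set ℂ
  axis : ℤ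
  place : Isom

/-- The placed tile. -/
def Piece.tile (p : Piece) : Set ℂ := p.place '' p.shape

/-- The reflection of the placed tile about its assigned axis. -/
def Piece.refl (p : Piece) : Isom := p.place * U2 p.axis * p.place⁻¹

/-- The tile `S_{2j-1}` (`1 ≤ j ≤ J`) of the prototype strip with `2J` tiles: a trapezium for
`j ≤ J - 2`, a triangle for `j = J - 1` and `j = J`. -/
def stripOdd (J : ℕ) (l h : ℝ) (j : ℕ) : Piece where
  shape := if j + 2 ≤ J then Q4 (β ^ j * l - β * h) (β ^ j * l - ω * h)
    else Q1 (β ^ j * l - β * h)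
  axis := 4
  place := T ⟨-(β ^ (j - 1) * l), (-1) ^ (j - 1) * (β ^ j * l - α * h)⟩ *
    R (if Even j then 4 else 0)

/-- The tile `S_{2j}` (`1 ≤ j ≤ J`) of the prototype strip with `2J` tiles: a rhombus for
`j ≤ J - 2`, a hexagon for `j = J - 1`, a kite for `j = J`. -/
def stripEven (J : ℕ) (l h : ℝ) (j : ℕ) : Piece :=
  if j + 2 ≤ J then
    { shape := Q3 h
      axis := 5
      place := T ⟨-(α * β ^ j * l), 0⟩ * R (if Even j then 0 else 7) }
  else if j + 1 = J then
    { shape := Q8 (α * β ^ (J - 1) * l - α * β * h) (2 * h)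
      axis := 1
      place := T ⟨-(α * β ^ (J - 1) * l) - β * h, (-1) ^ (J - 1) * h⟩ *
        R (if Even J then 1 else 6) }
  else
    { shape := Q7 (α * β ^ (J - 1) * l - α * h)
      axis := 7
      place := T ⟨-h, (-1) ^ (J - 1) * (α * β ^ (J - 1) * l - ω * h)⟩ *
        R (if Even J then 3 else 6) }

/-- The tile `S_k` (`1 ≤ k ≤ 2J`) of the prototype strip with `2J` tiles. -/
def strip (J : ℕ) (l h : ℝ) (k : ℕ) : Piece :=
  if Odd k then stripOdd J l h ((k + 1) / 2) else stripEven J l h (k / 2)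

/-- The tile `P_i` (`0 ≤ i ≤ 2L`) of the prototype pencil, with its assigned axis. The axis of
the square `P_0` is along `u_7` for `ν = 1` and along `u_1` for `ν = -1`. -/
def piece (ν : ℤˣ) (L : ℕ) (l h : ℝ) : ℕ → Piece
  | 0 => ⟨Q2 h, -2 * (ν : ℤ), 1⟩
  | 1 => ⟨Q9 (β * l / α - h) h, 4, T ⟨-l, 0⟩⟩
  | 2 => ⟨Q7 (α * h), 7, T ⟨-(α * β * l) - ω * h, -h⟩ * R 1⟩
  | 3 => ⟨Q1 (β * h), 4, T ⟨-(α * β * l) - h, -h⟩ * R 3⟩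
  | 4 => ⟨Q3 h, 5, T ⟨-(α * β * l), 0⟩ * R 7⟩
  | k + 5 =>
    let s := strip (L - 2) (β * l) h (k + 1)
    ⟨s.shape, s.axis, U0 * s.place⟩

/-- The prototype pencil with `2L + 1` atoms: the domain map is the simultaneous reflection of
the atoms about their assigned axes, followed by `U_0`. -/
def pencil (ν : ℤˣ) (L : ℕ) (l h : ℝ) : DressedDomain (2 * L + 1) where
  atom i := (piece ν L l h i).tile
  iso i := U0 * (piece ν L l h i).refl

/-- The pentagon spanned by the prototype pencil. -/
def pentagon (l h : ℝ) : Set ℂ :=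
  T ⟨-(α * l) + α * h, 0⟩ '' Q6 (α * l - β * h) h

/-- The image under `G` of the prototype pencil. -/
def pencilAt (G : Isom) (ν : ℤˣ) (L : ℕ) (l h : ℝ) : DressedDomain (2 * L + 1) :=
  (pencil ν L l h).transform G

/-- The image under `G` of the pentagon spanned by the prototype pencil. -/
def pentagonAt (G : Isom) (l h : ℝ) : Set ℂ := G '' pentagon l h

/-- The incidence matrix of the minimal pencil with respect to the pencil with `2L + 1` atoms. -/
def shorteningMatrix (L i : ℕ) : ℕ → ℕ
  | 0 => if i = 0 then 1 else 0
  | 1 => if i = 2 * L - 5 then 1 else 0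
  | 2 => (if i = 2 then 1 else 0) +
      2 * ∑ k ∈ Finset.Icc 4 (2 * L - 5), if i = k then 1 else 0
  | 3 => 2 * ((if i = 2 * L - 6 then 1 else 0) + if i = 2 * L - 5 then 1 else 0)
  | j => if i = j + 2 * L - 8 then 1 else 0

end Pencil

end

open MeasureTheory
open scoped Real

noncomputable section

namespace Pencil

/-! ### The constants -/

/-! The pentagon of a pencil is a strip of half-width `h` with a pointed left end, and shortening
cuts that end off. The tiling is almost self-similar. Replace `l` by `β * l` and reflect in the real
axis: every atom `P_j`, `j ≥ 4`, of the shorter pencil becomes the atom `P_{j+2}` of the longer one,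
axis included (`piece_shift`). The square `P_0` is common to both, and the change of sign of `ν`
makes its maps agree (`shortening_iso_zero`). So a single shortening only concerns `P_1, …, P_5` of
the longer pencil and the new atoms `Y_1, Y_2, Y_3`, a configuration that does not depend on `L`.

In that configuration `Y_1` lies in the trapezium `P_5` and returns at once, the kite `Y_2` travels
through `5, 4, 2, 4, 5`, and the triangle `Y_3` through `5, 4, 4, 5`. What these orbits leave
uncovered is filled by three periodic orbits: the hexagon `P_1`, the regular octagon inscribed in
the rhombus `P_4`, and the triangle `P_3` with itinerary `3, 4, 4` (`pencil_induces_shortening`,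
`pencil_towers_shortening`).

The geometry is verified exactly. The admissible pairs `(l, h)` form a cone with parameters `s, t ≥
0`. Edge bounds become linear forms in `s, t` over `ℤ[√2]`, translations become forms over `ℤ[ζ]`
with `ζ = u_1`, and an inequality on the whole cone is tested coefficientwise on integers.
Inclusions use combinations of at most two bounds (`Poly.sub_sound`). Tilings are certified by trees
of straight cuts (`CutTree.check_sound`), as almost-everywhere identities between sums of indicator
functions. Adding and subtracting such identities gives, by induction on `L` from the nine-atom
pencil, that the atoms tile the pentagon (`pencil_tiling`). Since tiles are open and convex,
statements up to null sets become true disjointness and inclusion.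

Iteration is then formal. Return words compose by substitution and towers over towers are towers
(`Renormalizes.trans`); the incidence matrix counts letters in the iterated words
(`count_returnWord`). -/

theorem α_sq : α * α = 2 := Real.mul_self_sqrt (by norm_num)

theorem α_pos : 0 < α := Real.sqrt_pos.2 (by norm_num)

theorem one_lt_α : 1 < α := by
  have := α_sq; have := α_pos; nlinarith

theorem β_eq : β = α - 1 := rfl

theorem ω_eq : ω = α + 1 := rfl

theorem β_mul_ω : β * ω = 1 := by rw [β_eq, ω_eq]; linear_combination α_sq

theorem β_pos : 0 < β := by have := one_lt_α; rw [β_eq]; linarith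

/-! ### The unit vectors -/

theorem u_add (a b : ℤ) : u (a + b) = u a * u b := by
  rw [u, u, u, ← Circle.exp_add]; congr 1; push_cast; ring

theorem u_zero : u 0 = 1 := by simp [u]

theorem u_eight_mul (k : ℤ) : u (8 * k) = 1 := by
  have : ((8 * k : ℤ) : ℝ) * (π / 4) = k * (2 * π) := by push_cast; ring
  rw [u, this]
  exact_mod_cast Circle.exp_int_mul_two_pi k

theorem u_emod (m : ℤ) : u (m % 8) = u m := by
  conv_rhs => rw [← Int.emod_add_mul_ediv m 8, u_add, u_eight_mul, mul_one]

theorem u_congr {a b : ℤ} (h : a % 8 = b % 8) : u a = u b := by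
  rw [← u_emod a, h, u_emod]

theorem u_neg (m : ℤ) : u (-m) = (u m)⁻¹ := by
  rw [eq_inv_iff_mul_eq_one, ← u_add]; simp [u_zero]

theorem u_neg_conj (m : ℤ) : (u (-m) : ℂ) = (starRingEnd ℂ) (u m : ℂ) := by
  rw [u_neg, Circle.coe_inv_eq_conj]

theorem u_two : (u 2 : ℂ) = Complex.I := by
  rw [u, Circle.coe_exp]
  have : (((2 : ℤ) : ℝ) * (π / 4) : ℝ) = π / 2 := by push_cast; ring
  rw [this]; push_cast; exact Complex.exp_pi_div_two_mul_I

theorem u_four : (u 4 : ℂ) = -1 := by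
  rw [show (4 : ℤ) = 2 + 2 by norm_num, u_add, Circle.coe_mul, u_two, Complex.I_mul_I]

theorem u_one : (u 1 : ℂ) = ⟨α / 2, α / 2⟩ := by
  rw [u, Circle.coe_exp]
  have : (((1 : ℤ) : ℝ) * (π / 4) : ℝ) = π / 4 := by push_cast; ring
  rw [this]
  apply Complex.ext
  · rw [Complex.exp_ofReal_mul_I_re, Real.cos_pi_div_four]; rfl
  · rw [Complex.exp_ofReal_mul_I_im, Real.sin_pi_div_four]; rfl

theorem u_neg_one_add_u_one : (u (-1) : ℂ) + u 1 = α := by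
  rw [u_neg_conj, u_one]
  apply Complex.ext <;> simp

/-- The basic linear relation among the eight directions; together with `u_{m+4} = -u_m` it
underlies every comparison of edge bounds. -/
theorem u_add_two (m : ℤ) : (u (m - 1) : ℂ) + u (m + 1) = α * u m := by
  rw [sub_eq_add_neg, u_add, u_add, Circle.coe_mul, Circle.coe_mul, ← mul_add,
    u_neg_one_add_u_one, mul_comm]

theorem u_add_four (m : ℤ) : (u (m + 4) : ℂ) = -u m := by
  rw [u_add, Circle.coe_mul, u_four, mul_neg_one]

/-! ### Isometries -/

theorem T_apply (d z : ℂ) : T d z = d + z := rfl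

theorem R_apply (m : ℤ) (z : ℂ) : R m z = u m * z := rfl

theorem U2_apply (a : ℤ) (z : ℂ) : U2 a z = u a * (starRingEnd ℂ) z := rfl

theorem U0_apply (z : ℂ) : U0 z = (starRingEnd ℂ) z := by
  rw [U0, U2_apply, u_zero, Circle.coe_one, one_mul]

theorem U0_mul_U0 : U0 * U0 = 1 := by
  ext z; simp [U0_apply]

theorem U0_inv : U0⁻¹ = U0 := inv_eq_of_mul_eq_one_left U0_mul_U0

/-! ### Coordinates of points in the eight directions -/

/-- The coordinate of `z` in the direction `u_k`. -/
def coord (k : ℤ) (z : ℂ) : ℝ := inner ℝ (u k : ℂ) z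

theorem coord_eq (k : ℤ) (z : ℂ) : coord k z = ((u (-k) : ℂ) * z).re := by
  rw [coord, Complex.inner, u_neg_conj, mul_comm]

theorem coord_congr {a b : ℤ} (h : a % 8 = b % 8) : coord a = coord b := by
  ext z; rw [coord, coord, u_congr h]

theorem coord_add (k : ℤ) (z w : ℂ) : coord k (z + w) = coord k z + coord k w :=
  inner_add_right _ _ _

theorem coord_u_mul (k m : ℤ) (z : ℂ) : coord k (u m * z) = coord (k - m) z := by
  rw [coord_eq, coord_eq, ← mul_assoc, ← Circle.coe_mul, ← u_add]; congr 4; ring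

theorem coord_conj (k : ℤ) (z : ℂ) : coord k ((starRingEnd ℂ) z) = coord (-k) z := by
  rw [coord_eq, coord_eq, neg_neg, u_neg_conj, ← map_mul, Complex.conj_re]

theorem coord_add_four (k : ℤ) (z : ℂ) : coord (k + 4) z = -coord k z := by
  rw [coord, coord, u_add_four, inner_neg_left]

theorem coord_rec (k : ℤ) (z : ℂ) : coord (k - 1) z + coord (k + 1) z = α * coord k z := by
  rw [coord, coord, coord, ← inner_add_left, u_add_two, ← real_inner_smul_left]; rfl

theorem coord_zero (z : ℂ) : coord 0 z = z.re := by
  rw [coord_eq]; simp [u_zero]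

theorem coord_two (z : ℂ) : coord 2 z = z.im := by
  rw [coord_eq, u_neg_conj, u_two]; simp

theorem coord_one (z : ℂ) : α * coord 1 z = z.re + z.im := by
  rw [← coord_rec, ← coord_zero, ← coord_two]; norm_num

theorem coord_lt_of_adjacent {k : ℤ} {z : ℂ} {a b v : ℝ} (ha : coord (k - 1) z < a)
    (hb : coord (k + 1) z < b) (h : a + b ≤ α * v) : coord k z < v := by
  have := coord_rec k z
  have := α_pos
  by_contra! hv
  nlinarith

/-- Rests on `u_k = u_{k-2} + √2 u_{k+1}`, with both coefficients positive, so that upper bounds in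
the two flanking directions add up to one for `u_k`. -/
theorem coord_lt_of_left {k : ℤ} {z : ℂ} {a b v : ℝ} (ha : coord (k - 2) z < a)
    (hb : coord (k + 1) z < b) (h : a + α * b ≤ v) : coord k z < v := by
  have h1 := coord_rec k z
  have h2 := coord_rec (k - 1) z
  rw [show k - 1 - 1 = k - 2 by ring, show k - 1 + 1 = k by ring] at h2
  have := α_sq
  have : coord k z = coord (k - 2) z + α * coord (k + 1) z := by
    linear_combination (-1 : ℝ) * h2 - α * h1 - coord k z * this
  have := mul_lt_mul_of_pos_left hb α_pos
  linarith

theorem coord_lt_of_right {k : ℤ} {z : ℂ} {a b v : ℝ} (ha : coord (k - 1) z < a)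
    (hb : coord (k + 2) z < b) (h : α * a + b ≤ v) : coord k z < v := by
  have h1 := coord_rec k z
  have h2 := coord_rec (k + 1) z
  rw [show k + 1 + 1 = k + 2 by ring, show k + 1 - 1 = k by ring] at h2
  have := α_sq
  have : coord k z = coord (k + 2) z + α * coord (k - 1) z := by
    linear_combination (-1 : ℝ) * h2 - α * h1 - coord k z * this
  have := mul_lt_mul_of_pos_left ha α_pos
  linarith

theorem mem_octPolygon {es : List (ℤ × ℝ)} {z : ℂ} :
    z ∈ octPolygon es ↔ ∀ e ∈ es, coord e.1 z < e.2 := Iff.rfl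

/-! ### Linear forms in two nonnegative parameters -/

/-- The linear form `(p + q √2) s + (p' + q' √2) t`. -/
structure RealForm where
  (p q p' q' : ℤ)
  deriving DecidableEq

namespace RealForm

def eval (s t : ℝ) (x : RealForm) : ℝ := (x.p + x.q * α) * s + (x.p' + x.q' * α) * t

def add (x y : RealForm) : RealForm := ⟨x.p + y.p, x.q + y.q, x.p' + y.p', x.q' + y.q'⟩

def neg (x : RealForm) : RealForm := ⟨-x.p, -x.q, -x.p', -x.q'⟩

instance : Add RealForm := ⟨add⟩

instance : Neg RealForm := ⟨neg⟩

instance : Sub RealForm := ⟨fun x y => x + -y⟩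

instance : Zero RealForm := ⟨⟨0, 0, 0, 0⟩⟩

/-- Multiplication by `√2`. -/
def mulα (x : RealForm) : RealForm := ⟨2 * x.q, x.p, 2 * x.q', x.p'⟩

variable (s t : ℝ) (x y : RealForm)

@[simp] theorem eval_add : (x + y).eval s t = x.eval s t + y.eval s t := by
  change eval s t ⟨_, _, _, _⟩ = _
  simp only [eval]; push_cast; ring

@[simp] theorem eval_neg : (-x).eval s t = -x.eval s t := by
  change eval s t ⟨_, _, _, _⟩ = _
  simp only [eval]; push_cast; ring

@[simp] theorem eval_sub : (x - y).eval s t = x.eval s t - y.eval s t := by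
  change (x + -y).eval s t = _
  rw [eval_add, eval_neg, sub_eq_add_neg]

@[simp] theorem eval_zero : (0 : RealForm).eval s t = 0 := by
  change eval s t ⟨0, 0, 0, 0⟩ = _
  simp [eval]

@[simp] theorem eval_mulα : x.mulα.eval s t = α * x.eval s t := by
  simp only [eval, mulα]; push_cast
  linear_combination (-((x.q : ℝ) * s + x.q' * t)) * α_sq

/-- Whether `p + q √2` is nonnegative. -/
def coeffNonneg (p q : ℤ) : Bool :=
  (0 ≤ p && 0 ≤ q) || (0 ≤ p && 2 * q * q ≤ p * p) || (0 ≤ q && p * p ≤ 2 * q * q)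

theorem coeffNonneg_sound {p q : ℤ} (h : coeffNonneg p q) : 0 ≤ (p + q * α : ℝ) := by
  simp only [coeffNonneg, Bool.or_eq_true, Bool.and_eq_true, decide_eq_true_eq] at h
  have h2 := α_sq
  have h0 := α_pos
  rcases h with (⟨hp, hq⟩ | ⟨hp, hq⟩) | ⟨hp, hq⟩
  · have hp : (0 : ℝ) ≤ p := mod_cast hp
    have hq : (0 : ℝ) ≤ q := mod_cast hq
    positivity
  · have hp : (0 : ℝ) ≤ p := mod_cast hp
    have hq : (2 * q * q : ℝ) ≤ p * p := mod_cast hq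
    -- Squaring removes `√2`: the integer test `2q² ≤ p²` says `|q √2| ≤ p`.
    have := abs_le_of_sq_le_sq (a := (q * α : ℝ)) (b := p) (by nlinarith) hp
    linarith [neg_le_of_abs_le this]
  · have hp : (0 : ℝ) ≤ q := mod_cast hp
    have hq : (p * p : ℝ) ≤ 2 * q * q := mod_cast hq
    have := abs_le_of_sq_le_sq (a := (p : ℝ)) (b := q * α) (by nlinarith) (by positivity)
    linarith [neg_le_of_abs_le this]

/-- A sufficient condition for `x ≤ y` at all nonnegative values of the parameters. -/
def le (x y : RealForm) : Bool :=
  coeffNonneg (y - x).p (y - x).q && coeffNonneg (y - x).p' (y - x).q'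

variable {s t x y}

theorem le_sound (hs : 0 ≤ s) (ht : 0 ≤ t) (h : x.le y) : x.eval s t ≤ y.eval s t := by
  rw [le, Bool.and_eq_true] at h
  have h1 := coeffNonneg_sound h.1
  have h2 := coeffNonneg_sound h.2
  have : 0 ≤ (y - x).eval s t := by rw [eval]; positivity
  rw [eval_sub] at this
  linarith

end RealForm

/-! ### Translations with coefficients in `ℤ[ζ]`, where `ζ = u_1` -/

/-- The linear form `(a + b ζ + c ζ² + d ζ³) s + (a' + b' ζ + c' ζ² + d' ζ³) t`. -/
structure ComplexForm where
  (a b c d a' b' c' d' : ℤ)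
  deriving DecidableEq

theorem u_one_pow_four : (u 1 : ℂ) ^ 4 = -1 := by
  rw [← u_four, show (4 : ℤ) = 1 + (1 + (1 + 1)) by norm_num, u_add, u_add, u_add]
  push_cast; ring

namespace ComplexForm

def eval (s t : ℝ) (x : ComplexForm) : ℂ :=
  (x.a + x.b * u 1 + x.c * u 1 ^ 2 + x.d * u 1 ^ 3) * s +
    (x.a' + x.b' * u 1 + x.c' * u 1 ^ 2 + x.d' * u 1 ^ 3) * t

def add (x y : ComplexForm) : ComplexForm :=
  ⟨x.a + y.a, x.b + y.b, x.c + y.c, x.d + y.d, x.a' + y.a', x.b' + y.b', x.c' + y.c', x.d' + y.d'⟩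

instance : Add ComplexForm := ⟨add⟩

def neg (x : ComplexForm) : ComplexForm :=
  ⟨-x.a, -x.b, -x.c, -x.d, -x.a', -x.b', -x.c', -x.d'⟩

/-- Multiplication by `ζ`. -/
def mulζ (x : ComplexForm) : ComplexForm := ⟨-x.d, x.a, x.b, x.c, -x.d', x.a', x.b', x.c'⟩

/-- Multiplication by `ζ ^ n`. -/
def rot : ℕ → ComplexForm → ComplexForm
  | 0, x => x
  | n + 1, x => (rot n x).mulζ

def conj (x : ComplexForm) : ComplexForm := ⟨x.a, -x.d, -x.c, -x.b, x.a', -x.d', -x.c', -x.b'⟩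

/-- The point with coordinates `x` and `y`. -/
def ofCoords (x y : RealForm) : ComplexForm :=
  ⟨x.p, x.q + y.q, y.p, y.q - x.q, x.p', x.q' + y.q', y.p', y.q' - x.q'⟩

/-- Twice the real part. -/
def twiceRe (x : ComplexForm) : RealForm := ⟨2 * x.a, x.b - x.d, 2 * x.a', x.b' - x.d'⟩

variable (s t : ℝ) (x y : ComplexForm)

theorem eval_add : (x + y).eval s t = x.eval s t + y.eval s t := by
  change eval s t ⟨_, _, _, _, _, _, _, _⟩ = _
  simp only [eval]; push_cast; ring

theorem eval_neg : x.neg.eval s t = -x.eval s t := by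
  simp only [eval, neg]; push_cast; ring

theorem eval_mulζ : x.mulζ.eval s t = u 1 * x.eval s t := by
  simp only [eval, mulζ]; push_cast
  linear_combination (-(x.d * s + x.d' * t : ℂ)) * u_one_pow_four

theorem eval_rot (n : ℕ) : (rot n x).eval s t = u n * x.eval s t := by
  induction n with
  | zero => simp [rot, u_zero]
  | succ n ih =>
    rw [rot, eval_mulζ, ih, ← mul_assoc, ← Circle.coe_mul, ← u_add]
    congr 3; push_cast; ring

theorem conj_u_one : (starRingEnd ℂ) (u 1 : ℂ) = -u 1 ^ 3 := by
  rw [← u_neg_conj, u_congr (b := 1 + 1 + 1 + 4) (by norm_num), u_add_four, u_add, u_add]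
  push_cast; ring

theorem eval_conj : x.conj.eval s t = (starRingEnd ℂ) (x.eval s t) := by
  simp only [eval, conj, map_add, map_mul, map_pow, conj_u_one, Complex.conj_ofReal, map_intCast]
  push_cast
  have h : (u 1 : ℂ) ^ 8 = 1 := by
    rw [show 8 = 4 * 2 by norm_num, pow_mul, u_one_pow_four]; norm_num
  have h6 : (u 1 : ℂ) ^ 6 = -u 1 ^ 2 := by linear_combination (u 1 : ℂ) ^ 2 * u_one_pow_four
  have h9 : (u 1 : ℂ) ^ 9 = u 1 := by linear_combination (u 1 : ℂ) * h
  ring_nf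
  rw [h6, h9]
  ring

/-- This is `√2 = ζ + ζ⁻¹` with `ζ⁻¹ = -ζ³`. Multiplied by `i = ζ²` it gives `i √2 = ζ + ζ³`; these
two identities explain the coefficients in `ofCoords`. -/
theorem α_eq_u : (α : ℂ) = u 1 - u 1 ^ 3 := by
  rw [← u_neg_one_add_u_one, u_neg_conj, conj_u_one]; ring

theorem I_eq_u : Complex.I = u 1 ^ 2 := by
  rw [← u_two, show (2 : ℤ) = 1 + 1 by norm_num, u_add]; push_cast; ring

theorem eval_ofCoords (x y : RealForm) : (ofCoords x y).eval s t = ⟨x.eval s t, y.eval s t⟩ := by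
  rw [Complex.mk_eq_add_mul_I, I_eq_u]
  simp only [eval, ofCoords, RealForm.eval]; push_cast
  rw [α_eq_u]
  linear_combination ((y.q : ℂ) * s + y.q' * t) * (u 1 : ℂ) * u_one_pow_four

theorem eval_twiceRe : x.twiceRe.eval s t = 2 * (x.eval s t).re := by
  have h : (((x.twiceRe.eval s t : ℝ)) : ℂ) = x.eval s t + (starRingEnd ℂ) (x.eval s t) := by
    rw [← eval_conj]
    simp only [eval, twiceRe, conj, RealForm.eval]; push_cast
    rw [α_eq_u]
    ring
  have := congrArg Complex.re h
  rw [Complex.ofReal_re] at this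
  rw [this, Complex.add_re, Complex.conj_re]; ring

/-- Twice the coordinate in the direction `u_k`. -/
def twiceCoord (k : ℕ) (x : ComplexForm) : RealForm := (x.rot (8 - k % 8)).twiceRe

theorem eval_twiceCoord (k : ℕ) : (x.twiceCoord k).eval s t = 2 * coord k (x.eval s t) := by
  rw [twiceCoord, eval_twiceRe, eval_rot, coord_eq, u_congr (b := -k)]
  omega

end ComplexForm

/-! ### Polygons whose edges depend linearly on two parameters -/

/-- Twice the bounds in the eight directions. -/
abbrev Poly := Fin 8 → RealForm

/-- The sub-polygon cut out by an additional bound. -/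
def Poly.restrict (P : Poly) (k : Fin 8) (c : RealForm) : Poly := fun j => if j = k then c else P j

def Poly.set (s t : ℝ) (P : Poly) : Set ℂ := {z | ∀ k : Fin 8, 2 * coord (k : ℕ) z < (P k).eval s t}

/-- Whether the `j`-th bound `v` follows from the bounds `P`. -/
def Poly.implies (P : Poly) (j : Fin 8) (v : RealForm) : Bool :=
  (P j).le v || (P (j - 1) + P (j + 1)).le v.mulα || (P (j - 2) + (P (j + 1)).mulα).le v ||
    ((P (j - 1)).mulα + P (j + 2)).le v

/-- A sufficient condition for the inclusion of polygons. -/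
def Poly.sub (P Q : Poly) : Bool := decide (∀ j : Fin 8, P.implies j (Q j) = true)

theorem coord_fin_sub (k m : Fin 8) : coord ((k - m : Fin 8) : ℕ) = coord ((k : ℕ) - (m : ℕ)) :=
  coord_congr (by revert k m; decide)

theorem coord_fin_add (k m : Fin 8) : coord ((k + m : Fin 8) : ℕ) = coord ((k : ℕ) + (m : ℕ)) :=
  coord_congr (by revert k m; decide)

theorem u_fin_add (k m : Fin 8) : u ((k + m : Fin 8) : ℕ) = u ((k : ℕ) + (m : ℕ)) :=
  u_congr (by revert k m; decide)

theorem u_fin_neg (m : Fin 8) : u ((-m : Fin 8) : ℕ) = u (-(m : ℕ)) :=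
  u_congr (by revert m; decide)

variable {s t : ℝ}

/-- The four alternatives of the test are the bound itself and three ways of writing `u_j` as a
nonnegative combination of two directions, one on either side of it. The test is only sufficient; it
works well because the polygons carry redundant bounds. -/
theorem Poly.implies_sound (hs : 0 ≤ s) (ht : 0 ≤ t) {P : Poly} {j : Fin 8} {v : RealForm}
    (h : P.implies j v) {z : ℂ} (hz : z ∈ P.set s t) : 2 * coord (j : ℕ) z < v.eval s t := by
  simp only [Poly.implies, Bool.or_eq_true] at h
  have key (k : Fin 8) : coord (k : ℕ) z < (P k).eval s t / 2 := by linarith [hz k]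
  suffices coord (j : ℕ) z < v.eval s t / 2 by linarith
  have hα := α_pos
  rcases h with ((h | h) | h) | h <;> have h := RealForm.le_sound hs ht h
  · linarith [hz j]
  · have h1 := key (j - 1)
    have h2 := key (j + 1)
    rw [coord_fin_sub] at h1
    rw [coord_fin_add] at h2
    refine coord_lt_of_adjacent h1 h2 ?_
    simp only [RealForm.eval_add, RealForm.eval_mulα] at h
    linarith
  · have h1 := key (j - 2)
    have h2 := key (j + 1)
    rw [coord_fin_sub] at h1
    rw [coord_fin_add] at h2
    refine coord_lt_of_left h1 h2 ?_
    simp only [RealForm.eval_add, RealForm.eval_mulα] at h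
    linarith
  · have h1 := key (j - 1)
    have h2 := key (j + 2)
    rw [coord_fin_sub] at h1
    rw [coord_fin_add] at h2
    refine coord_lt_of_right h1 h2 ?_
    simp only [RealForm.eval_add, RealForm.eval_mulα] at h
    linarith

theorem Poly.sub_sound (hs : 0 ≤ s) (ht : 0 ≤ t) {P Q : Poly} (h : P.sub Q) :
    P.set s t ⊆ Q.set s t := by
  rw [Poly.sub, decide_eq_true_eq] at h
  exact fun z hz j => Poly.implies_sound hs ht (h j) hz

theorem Poly.set_eq_octPolygon (P : Poly) :
    P.set s t = octPolygon (List.ofFn fun k : Fin 8 => ((k : ℤ), (P k).eval s t / 2)) := by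
  ext z
  simp only [mem_octPolygon, List.forall_mem_ofFn_iff]
  exact forall_congr' fun k => (lt_div_iff₀' two_pos).symm

theorem isOpen_octPolygon (es : List (ℤ × ℝ)) : IsOpen (octPolygon es) := by
  have : octPolygon es = ⋂ e ∈ {e | e ∈ es}, {z | coord e.1 z < e.2} := by
    ext z; simp [mem_octPolygon]
  rw [this]
  refine (List.finite_toSet es).isOpen_biInter fun e _ => isOpen_lt ?_ continuous_const
  exact continuous_const.inner continuous_id

theorem convex_octPolygon (es : List (ℤ × ℝ)) : Convex ℝ (octPolygon es) := by
  have : octPolygon es = ⋂ e ∈ {e | e ∈ es}, {z | coord e.1 z < e.2} := by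
    ext z; simp [mem_octPolygon]
  rw [this]
  refine convex_iInter₂ fun e _ => ?_
  exact convex_halfSpace_lt (f := fun z => coord e.1 z)
    ⟨fun x y => inner_add_right _ _ _, fun c x => inner_smul_right_eq_smul _ _ _⟩ _

theorem Poly.isOpen (P : Poly) : IsOpen (P.set s t) := by
  rw [P.set_eq_octPolygon]; exact isOpen_octPolygon _

/-! ### Tilings up to null sets -/

/-- The indicator function. -/
def ind (A : Set ℂ) (z : ℂ) : ℕ := A.indicator 1 z

theorem ind_of_mem {A : Set ℂ} {z : ℂ} (h : z ∈ A) : ind A z = 1 := Set.indicator_of_mem h _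

theorem ind_of_notMem {A : Set ℂ} {z : ℂ} (h : z ∉ A) : ind A z = 0 := Set.indicator_of_notMem h _

theorem ind_pos {A : Set ℂ} {z : ℂ} : 0 < ind A z ↔ z ∈ A := by
  by_cases h : z ∈ A
  · simp [ind_of_mem h, h]
  · simp [ind_of_notMem h, h]

theorem ind_le_one (A : Set ℂ) (z : ℂ) : ind A z ≤ 1 := by
  by_cases h : z ∈ A
  · simp [ind_of_mem h]
  · simp [ind_of_notMem h]

theorem ind_image (g : Isom) (A : Set ℂ) (z : ℂ) : ind (g '' A) z = ind A (g⁻¹ z) := by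
  by_cases h : g⁻¹ z ∈ A
  · rw [ind_of_mem h, ind_of_mem]
    exact ⟨_, h, g.apply_symm_apply z⟩
  · rw [ind_of_notMem h, ind_of_notMem]
    rintro ⟨w, hw, rfl⟩
    exact h (by rwa [show g⁻¹ (g w) = w from g.symm_apply_apply w])

theorem volume_coord_eq (k : ℤ) (c : ℝ) : volume {z : ℂ | coord k z = c} = 0 := by
  let A : AffineSubspace ℝ ℂ :=
    { carrier := {z | coord k z = c}
      smul_vsub_vadd_mem' := by
        intro r p₁ p₂ p₃ h₁ h₂ h₃
        simp only [Set.mem_ofPred_eq, coord, vsub_eq_sub, vadd_eq_add, inner_add_right,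
          inner_sub_right, real_inner_smul_right] at *
        rw [h₁, h₂, h₃]; ring }
  refine Measure.addHaar_affineSubspace volume A fun hA => ?_
  -- The hyperplane is proper: the point `(c + 1) u_k` has the wrong coordinate.
  have key (r : ℝ) : coord k (r * u k) = r := by
    rw [mul_comm, coord_u_mul, sub_self, coord_zero, Complex.ofReal_re]
  have h1 : ((c + 1 : ℝ) * u k : ℂ) ∈ A := by rw [hA]; trivial
  have h2 : coord k ((c + 1 : ℝ) * u k : ℂ) = c := h1
  rw [key] at h2
  linarith

/-- A certificate for a tiling: inner nodes cut the current polygon by the line on which twice the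
`k`-th coordinate equals `c`, and the leaves are the tiles. -/
inductive CutTree
  | leaf (P : Poly)
  | cut (k : Fin 8) (c : RealForm) (left right : CutTree)

namespace CutTree

def leaves : CutTree → List Poly
  | leaf P => [P]
  | cut _ _ left right => left.leaves ++ right.leaves

/-- Whether the leaves of the tree tile the polygon `P`, the cuts being those of the tree. -/
def check : Poly → CutTree → Bool
  | P, leaf Q => P.sub Q && Q.sub P
  | P, cut k c left right => c.le (P k) && (-c).le (P (k + 4)) &&
      check (P.restrict k c) left && check (P.restrict (k + 4) (-c)) right

theorem mem_restrict {P : Poly} {k : Fin 8} {c : RealForm}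
    (h : c.eval s t ≤ (P k).eval s t) {z : ℂ} :
    z ∈ (P.restrict k c).set s t ↔ z ∈ P.set s t ∧ 2 * coord (k : ℕ) z < c.eval s t := by
  constructor
  · intro hz
    have hk := hz k
    simp only [Poly.restrict, if_true] at hk
    refine ⟨fun j => ?_, hk⟩
    have hj := hz j
    by_cases hjk : j = k
    · subst hjk; linarith
    · simpa only [Poly.restrict, if_neg hjk] using hj
  · rintro ⟨hz, hk⟩ j
    by_cases hjk : j = k
    · subst hjk; simpa only [Poly.restrict, if_true] using hk
    · simpa only [Poly.restrict, if_neg hjk] using hz j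

/-- Off the cutting line, which is a null set, a point of the polygon lies on exactly one side, so
the indicator functions of the two halves add up to that of the whole. Leaves may be empty for
boundary values of the parameters, which costs nothing in this formulation. -/
theorem check_sound (hs : 0 ≤ s) (ht : 0 ≤ t) {P : Poly} {τ : CutTree} (h : τ.check P) :
    ∀ᵐ z, ind (P.set s t) z = (τ.leaves.map fun Q => ind (Q.set s t) z).sum := by
  induction τ generalizing P with
  | leaf Q =>
    rw [check, Bool.and_eq_true] at h
    have : P.set s t = Q.set s t :=
      (Poly.sub_sound hs ht h.1).antisymm (Poly.sub_sound hs ht h.2)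
    simp [leaves, this]
  | cut k c left right ihl ihr =>
    simp only [check, Bool.and_eq_true] at h
    obtain ⟨⟨⟨h1, h2⟩, hl⟩, hr⟩ := h
    have h1 := RealForm.le_sound hs ht h1
    have h2 := RealForm.le_sound hs ht h2
    have hN : ∀ᵐ z : ℂ, coord (k : ℕ) z ≠ c.eval s t / 2 := by
      simpa [ae_iff] using volume_coord_eq (k : ℕ) (c.eval s t / 2)
    filter_upwards [ihl hl, ihr hr, hN] with z hzl hzr hz
    rw [leaves, List.map_append, List.sum_append, ← hzl, ← hzr]
    have m1 := mem_restrict h1 (z := z)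
    have m2 := mem_restrict h2 (z := z)
    have h4 : coord ((k + 4 : Fin 8) : ℕ) z = -coord (k : ℕ) z := by
      rw [coord_fin_add]; exact coord_add_four _ _
    rw [h4, RealForm.eval_neg] at m2
    by_cases hP : z ∈ P.set s t
    · rcases lt_or_gt_of_ne hz with hz | hz
      · rw [ind_of_mem hP, ind_of_mem (m1.2 ⟨hP, by linarith⟩),
          ind_of_notMem (fun h => by linarith [(m2.1 h).2])]
      · rw [ind_of_mem hP, ind_of_mem (m2.2 ⟨hP, by linarith⟩),
          ind_of_notMem (fun h => by linarith [(m1.1 h).2])]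
    · rw [ind_of_notMem hP, ind_of_notMem (fun h => hP (m1.1 h).1),
        ind_of_notMem (fun h => hP (m2.1 h).1)]

end CutTree

/-! ### Isometries depending linearly on two parameters -/

/-- The isometry `T_d R_m`, or `T_d R_m U_0` if `flip` is true. -/
structure Motion where
  d : ComplexForm
  m : Fin 8
  flip : Bool
  deriving DecidableEq

namespace Motion

def toIsom (s t : ℝ) (g : Motion) : Isom :=
  T (g.d.eval s t) * R (g.m : ℕ) * (if g.flip then U0 else 1)

def mul (g k : Motion) : Motion :=
  ⟨g.d + (if g.flip then k.d.conj else k.d).rot g.m, if g.flip then g.m - k.m else g.m + k.m,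
    xor g.flip k.flip⟩

/-- The image under `g` of the reflection `U_{a/2}`, that is, `g U_{a/2} g⁻¹`. -/
def axisRefl (g : Motion) (a : Fin 8) : Motion :=
  let a' := g.m + g.m + if g.flip then -a else a
  ⟨g.d + (g.d.conj.rot a').neg, a', true⟩

def image (g : Motion) (P : Poly) : Poly := fun k =>
  P (if g.flip then g.m - k else k - g.m) + g.d.twiceCoord k

theorem toIsom_apply (g : Motion) (z : ℂ) : g.toIsom s t z =
    g.d.eval s t + u (g.m : ℕ) * (if g.flip then (starRingEnd ℂ) z else z) := by
  obtain ⟨d, m, f⟩ := g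
  cases f
  · rfl
  · simp only [toIsom, if_true]
    rw [← U0_apply]; rfl

theorem toIsom_mul (g k : Motion) : (g.mul k).toIsom s t = g.toIsom s t * k.toIsom s t := by
  ext z
  rw [AffineIsometryEquiv.coe_mul, Function.comp_apply, toIsom_apply, toIsom_apply, toIsom_apply]
  obtain ⟨d, m, f⟩ := g
  obtain ⟨d', m', f'⟩ := k
  cases f <;> cases f' <;>
    simp only [mul, ComplexForm.eval_add, ComplexForm.eval_rot, ComplexForm.eval_conj, u_fin_add,
      u_fin_neg, Bool.false_xor, Bool.true_xor, Bool.not_true, Bool.not_false, if_true, u_add,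
      sub_eq_add_neg, Circle.coe_mul, Bool.false_eq_true, if_false, map_add, map_mul, u_neg_conj,
      Complex.conj_conj] <;> ring

/-- Conjugating a reflection by a rotation through `m` adds `2m` to its index, and a flip negates
the index. The translation part is fixed by the requirement that the point `d` stays in place. -/
theorem toIsom_axisRefl (g : Motion) (a : Fin 8) :
    (g.axisRefl a).toIsom s t = g.toIsom s t * U2 (a : ℕ) * (g.toIsom s t)⁻¹ := by
  rw [eq_mul_inv_iff_mul_eq]
  ext z
  simp only [AffineIsometryEquiv.coe_mul, Function.comp_apply, toIsom_apply, U2_apply]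
  obtain ⟨d, m, f⟩ := g
  have hm : (u (m : ℕ) : ℂ) * (starRingEnd ℂ) (u (m : ℕ) : ℂ) = 1 := by
    rw [← u_neg_conj, ← Circle.coe_mul, ← u_add]; simp [u_zero]
  cases f <;>
    simp only [axisRefl, ComplexForm.eval_add, ComplexForm.eval_neg, ComplexForm.eval_rot,
      ComplexForm.eval_conj, u_fin_add, u_add, Circle.coe_mul, if_true, Bool.false_eq_true,
      if_false, map_add, map_mul, Complex.conj_conj, u_fin_neg, u_neg_conj]
  · linear_combination ((u (m : ℕ) : ℂ) * u (a : ℕ) * (starRingEnd ℂ) z) * hm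
  · linear_combination ((u (m : ℕ) : ℂ) * (starRingEnd ℂ) (u (a : ℕ) : ℂ) * z) * hm

theorem image_eq_of_mem_iff (g : Isom) {A B : Set ℂ} (h : ∀ z, g z ∈ B ↔ z ∈ A) : g '' A = B := by
  ext z
  constructor
  · rintro ⟨w, hw, rfl⟩; exact (h w).2 hw
  · intro hz
    exact ⟨g.symm z, (h _).1 (by rwa [g.apply_symm_apply]), g.apply_symm_apply z⟩

/-- An isometry of the group permutes the eight normals, by `k ↦ k + m` or `k ↦ m - k`, and shifts
each bound by the coordinate of the translation vector. -/
theorem image_set (g : Motion) (P : Poly) :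
    g.toIsom s t '' P.set s t = (g.image P).set s t := by
  refine image_eq_of_mem_iff _ fun z => ?_
  rw [toIsom_apply]
  obtain ⟨d, m, f⟩ := g
  cases f
  · rw [Poly.set, Set.mem_ofPred_eq, Poly.set, Set.mem_ofPred_eq,
      (Equiv.subRight m).surjective.forall (p := fun k : Fin 8 => 2 * coord (k : ℕ) z < _)]
    refine forall_congr' fun k => ?_
    simp only [image, RealForm.eval_add, ComplexForm.eval_twiceCoord, coord_add, coord_u_mul,
      Equiv.subRight_apply, coord_fin_sub, Bool.false_eq_true, if_false]
    constructor <;> intro h <;> linarith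
  · rw [Poly.set, Set.mem_ofPred_eq, Poly.set, Set.mem_ofPred_eq,
      (Equiv.subLeft m).surjective.forall (p := fun k : Fin 8 => 2 * coord (k : ℕ) z < _)]
    refine forall_congr' fun k => ?_
    simp only [image, RealForm.eval_add, ComplexForm.eval_twiceCoord, coord_add, coord_u_mul,
      Equiv.subLeft_apply, coord_fin_sub, if_true, coord_conj, neg_sub]
    constructor <;> intro h <;> linarith

end Motion

/-! ### The shapes and the placed tiles in terms of linear forms -/

namespace RealForm

def mulβ (x : RealForm) : RealForm := x.mulα - x

def mulω (x : RealForm) : RealForm := x.mulα + x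

def dbl (x : RealForm) : RealForm := x + x

end RealForm

namespace Poly

/-- Bounds in this namespace are doubled, so that `1/√2` never occurs. Bounds not listed in the
original shape are implied ones; they are stored because the inclusion test combines only two at a
time. For `Q1` to `Q4` the parameter is itself the doubled one. -/
def Q1 (a : RealForm) : Poly := ![a, 0, 0, 0, a, a.mulα, a, a.mulα]

def Q2 (a : RealForm) : Poly := ![a, a.mulα, a, a.mulα, a, a.mulα, a, a.mulα]

def Q3 (a : RealForm) : Poly := ![a.mulω, a.mulω, a, a, a.mulω, a.mulω, a, a]

def Q4 (a b : RealForm) : Poly := ![a, 0, -b, 0, a, a.mulα, a, a.mulα]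

/-- The parameters are those of the shape, without doubling. -/
def Q6 (a b : RealForm) : Poly :=
  ![a.dbl, (a + b).mulα, b.dbl, 0, 0, 0, b.dbl, (a + b).mulα]

/-- The parameter is that of the shape, without doubling. -/
def Q7 (a : RealForm) : Poly := ![a.dbl, a.mulα, 0, 0, 0, 0, a.mulα, a.dbl]

/-- The parameters are those of the shape, without doubling. -/
def Q8 (a b : RealForm) : Poly :=
  ![b.dbl, b.dbl, a.dbl, a.mulα, 0, 0, a.mulα, a.dbl]

/-- The first parameter is that of the shape, the second one is doubled. -/
def Q9 (a b : RealForm) : Poly := ![a.mulα, a, b, a, a.mulα, a, b, a]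

end Poly

/-- A shape with an assigned axis and a placement, depending linearly on two parameters. -/
structure FormalPiece where
  shape : Poly
  axis : Fin 8
  place : Motion

/-- The reflection `U_0`. -/
def Motion.conj : Motion := ⟨⟨0, 0, 0, 0, 0, 0, 0, 0⟩, 0, true⟩

/-- The isometry `T_(x, y) R_m`. -/
def Motion.ofCoords (x y : RealForm) (m : Fin 8) : Motion := ⟨ComplexForm.ofCoords x y, m, false⟩

namespace FormalPiece

def tile (p : FormalPiece) : Poly := p.place.image p.shape

/-- The reflection of the placed tile about its axis, followed by `U_0`. -/
def iso (p : FormalPiece) : Motion := Motion.conj.mul (p.place.axisRefl p.axis)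

/-- The image of the placed tile under `U_0`. -/
def conj (p : FormalPiece) : FormalPiece := ⟨p.shape, p.axis, Motion.conj.mul p.place⟩

open RealForm

variable (l h : RealForm)

/-- The axis here is a placeholder: the true one depends on `ν`. Only the tile of this piece is ever
used. -/
def piece0 : FormalPiece := ⟨Poly.Q2 h.dbl, 0, Motion.ofCoords 0 0 0⟩

def piece1 : FormalPiece :=
  ⟨Poly.Q9 (l.mulβ.mulα - h.dbl) h.dbl, 4, Motion.ofCoords (-l) 0 0⟩

def piece2 : FormalPiece :=
  ⟨Poly.Q7 h.mulα, 7, Motion.ofCoords (-l.mulβ.mulα - h.mulω) (-h) 1⟩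

def piece3 : FormalPiece :=
  ⟨Poly.Q1 h.mulβ.dbl, 4, Motion.ofCoords (-l.mulβ.mulα - h) (-h) 3⟩

def piece4 : FormalPiece := ⟨Poly.Q3 h.dbl, 5, Motion.ofCoords (-l.mulβ.mulα) 0 7⟩

/-- The trapezium `P_5` of a pencil with at least eleven atoms. -/
def trapezium : FormalPiece :=
  ⟨Poly.Q4 (l.mulβ.mulβ - h.mulβ).dbl (l.mulβ.mulβ - h.mulω).dbl, 4,
    Motion.conj.mul (Motion.ofCoords (-l.mulβ) (l.mulβ.mulβ - h.mulα) 0)⟩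

/-- The atom `P_5` of a pencil with nine atoms. -/
def minimal5 : FormalPiece :=
  ⟨Poly.Q1 (l.mulβ.mulβ - h.mulβ).dbl, 4,
    Motion.conj.mul (Motion.ofCoords (-l.mulβ) (l.mulβ.mulβ - h.mulα) 0)⟩

/-- The atom `P_6` of a pencil with nine atoms. -/
def minimal6 : FormalPiece :=
  ⟨Poly.Q8 (l.mulβ.mulβ.mulα - h.mulβ.mulα) h.dbl, 1,
    Motion.conj.mul (Motion.ofCoords (-l.mulβ.mulβ.mulα - h.mulβ) (-h) 1)⟩

/-- The atom `P_7` of a pencil with nine atoms. -/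
def minimal7 : FormalPiece :=
  ⟨Poly.Q1 (l.mulβ.mulβ.mulβ - h.mulβ).dbl, 4,
    Motion.conj.mul (Motion.ofCoords (-l.mulβ.mulβ) (-(l.mulβ.mulβ.mulβ - h.mulα)) 4)⟩

/-- The atom `P_8` of a pencil with nine atoms. -/
def minimal8 : FormalPiece :=
  ⟨Poly.Q7 (l.mulβ.mulβ.mulα - h.mulα), 7,
    Motion.conj.mul (Motion.ofCoords (-h) (-(l.mulβ.mulβ.mulα - h.mulω)) 3)⟩

end FormalPiece

/-- The pentagon. -/
def formalPentagon (l h : RealForm) : Poly :=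
  (Motion.ofCoords (-l.mulα + h.mulα) 0 0).image (Poly.Q6 (l.mulα - h.mulβ) h)

/-! ### Finite verifications -/

/-- The cut of the direction `k` along an edge of the polygon `P`. -/
def CutTree.along (k : Fin 8) (P : Poly) (left right : CutTree) : CutTree := cut k (P k) left right

open FormalPiece CutTree

namespace Minimal

/-! The pencil with nine atoms, `l = ω² s + ω³ t`, `h = s + t`. -/

def l : RealForm := ⟨3, 2, 7, 5⟩

def h : RealForm := ⟨1, 0, 1, 0⟩

def tree : CutTree :=
  let P0 := (piece0 h).tile
  let P1 := (piece1 l h).tile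
  let P2 := (piece2 l h).tile
  let P3 := (piece3 l h).tile
  let P4 := (piece4 l h).tile
  let P5 := (minimal5 l h).tile
  let P6 := (minimal6 l h).tile
  let P7 := (minimal7 l h).tile
  let P8 := (minimal8 l h).tile
  along 4 P0 (leaf P0) (along 1 P1 (along 7 P1 (leaf P1) (along 0 P2 (leaf P2) (leaf P3)))
    (along 1 P4 (leaf P4) (along 7 P5 (leaf P5) (along 7 P6 (leaf P6) (along 1 P7 (leaf P7)
      (leaf P8))))))

theorem tree_check : tree.check (formalPentagon l h) = true := by decide +kernel

end Minimal

namespace Step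

/-! The first atoms of a pencil and of its shortening, `l = ω³ (s + t)`, `h = s`. -/

def l : RealForm := ⟨7, 5, 7, 5⟩

def h : RealForm := ⟨1, 0, 0, 0⟩

/-- The atoms of the pencil. -/
def P1 : FormalPiece := piece1 l h
def P2 : FormalPiece := piece2 l h
def P3 : FormalPiece := piece3 l h
def P4 : FormalPiece := piece4 l h
def P5 : FormalPiece := trapezium l h

/-- The atoms of the shortened pencil. -/
def Y1 : FormalPiece := (piece1 l.mulβ h).conj
def Y2 : FormalPiece := (piece2 l.mulβ h).conj
def Y3 : FormalPiece := (piece3 l.mulβ h).conj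

/-- The orbit of the atom `P_2` of the shortened pencil. -/
def kite0 : Poly := Y2.tile
def kite1 : Poly := P5.iso.image kite0
def kite2 : Poly := P4.iso.image kite1
def kite3 : Poly := P2.iso.image kite2
def kite4 : Poly := P4.iso.image kite3

/-- The orbit of the atom `P_3` of the shortened pencil. -/
def triangle0 : Poly := Y3.tile
def triangle1 : Poly := P5.iso.image triangle0
def triangle2 : Poly := P4.iso.image triangle1
def triangle3 : Poly := P4.iso.image triangle2

/-- The orbit of the periodic tile `P_3`. -/
def periodic0 : Poly := P3.tile
def periodic1 : Poly := P3.iso.image periodic0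
def periodic2 : Poly := P4.iso.image periodic1

/-- The regular octagon inscribed into the rhombus `P_4`. -/
def octagon : Poly := (Motion.ofCoords (-l.mulβ.mulα) 0 0).image fun _ => h.dbl

/-- The pentagon of the shortened pencil. -/
def shorter : Poly := formalPentagon l.mulβ h

def tree : CutTree :=
  along 5 shorter
    (along 3 shorter (leaf shorter) (along 4 kite4 (leaf kite4) (leaf triangle3)))
    (along 1 P1.tile
      (along 7 P1.tile (leaf P1.tile) (along 0 P2.tile (leaf P2.tile) (leaf P3.tile)))
      (leaf P4.tile))

theorem tree_check : tree.check (formalPentagon l h) = true := by decide +kernel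

/-- All the traffic through the rhombus: two visits of the kite, two of the triangle, two of the
periodic triangle, and the octagon in the middle. -/
def rhombusTree : CutTree :=
  along 0 octagon
    (along 3 octagon
      (along 4 octagon (along 7 octagon (leaf octagon) (leaf triangle1)) (leaf triangle2))
      (along 0 kite3 (leaf kite3) (leaf periodic1)))
    (along 3 kite1 (leaf kite1) (leaf periodic2))

theorem rhombusTree_check : rhombusTree.check P4.tile = true := by decide +kernel

/-- The trapezium contains `Y_1` and the first and last positions of the travelling kite and
triangle. The last positions lie outside the shortened pentagon, which is why they also occur in
`tree`. -/
def trapeziumTree : CutTree :=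
  along 1 Y1.tile
    (along 3 Y1.tile (leaf Y1.tile) (along 4 kite4 (leaf kite4) (leaf triangle3)))
    (along 0 kite0 (leaf kite0) (leaf triangle0))

theorem trapeziumTree_check : trapeziumTree.check P5.tile = true := by decide +kernel

theorem kite2_eq : kite2 = P2.tile := by decide +kernel

theorem image_periodic2 : P4.iso.image periodic2 = periodic0 := by decide +kernel

/-- On the rhombus the domain map is a rotation by a multiple of `π / 4` about its centre, a point
of the real axis; the octagon has the same centre. -/
theorem image_octagon : P4.iso.image octagon = octagon := by decide +kernel

theorem image_P1 : P1.iso.image P1.tile = P1.tile := by decide +kernel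

end Step

/-! ### The shapes as polygons with eight bounds -/

namespace RealForm

variable (s t : ℝ) (x : RealForm)

@[simp] theorem eval_mulβ : x.mulβ.eval s t = β * x.eval s t := by
  rw [mulβ, eval_sub, eval_mulα, β_eq]; ring

@[simp] theorem eval_mulω : x.mulω.eval s t = ω * x.eval s t := by
  rw [mulω, eval_add, eval_mulα, ω_eq]; ring

@[simp] theorem eval_dbl : x.dbl.eval s t = 2 * x.eval s t := by
  rw [dbl, eval_add]; ring

end RealForm

variable {s t : ℝ}

theorem coord_relations (z : ℂ) : coord 4 z = -coord 0 z ∧ coord 5 z = -coord 1 z ∧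
    coord 6 z = -coord 2 z ∧ coord 7 z = -coord 3 z ∧ coord 0 z + coord 2 z = α * coord 1 z ∧
    coord 1 z + coord 3 z = α * coord 2 z ∧ coord 2 z - coord 0 z = α * coord 3 z ∧
    coord 1 z - coord 3 z = α * coord 0 z := by
  refine ⟨coord_add_four 0 z, coord_add_four 1 z, coord_add_four 2 z, coord_add_four 3 z,
    coord_rec 1 z, coord_rec 2 z, ?_, ?_⟩
  · have := coord_rec 3 z
    norm_num at this
    have h4 : coord 4 z = -coord 0 z := coord_add_four 0 z
    linarith
  · have := coord_rec 0 z
    norm_num at this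
    have h3 : coord 3 z = -coord (-1) z := by
      rw [← coord_add_four]; norm_num
    linarith

theorem mem_set_iff {P : Poly} {z : ℂ} : z ∈ P.set s t ↔
    2 * coord 0 z < (P 0).eval s t ∧ 2 * coord 1 z < (P 1).eval s t ∧
    2 * coord 2 z < (P 2).eval s t ∧ 2 * coord 3 z < (P 3).eval s t ∧
    2 * coord 4 z < (P 4).eval s t ∧ 2 * coord 5 z < (P 5).eval s t ∧
    2 * coord 6 z < (P 6).eval s t ∧ 2 * coord 7 z < (P 7).eval s t := by
  constructor
  · intro h
    exact ⟨h 0, h 1, h 2, h 3, h 4, h 5, h 6, h 7⟩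
  · rintro ⟨h0, h1, h2, h3, h4, h5, h6, h7⟩ k
    fin_cases k
    exacts [h0, h1, h2, h3, h4, h5, h6, h7]

theorem Q1_eq {x : ℝ} (a : RealForm) (ha : 2 * x = a.eval s t) :
    Q1 x = (Poly.Q1 a).set s t := by
  ext z
  obtain ⟨e4, e5, e6, e7, r1, r2, r3, r0⟩ := coord_relations z
  simp only [Q1, mem_octPolygon, mem_set_iff, List.forall_mem_cons, List.not_mem_nil,
    Poly.Q1, Matrix.cons_val, RealForm.eval_zero, RealForm.eval_mulα, ← ha, e4, e5, e6, e7]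
  constructor
  · rintro ⟨h6, h1, h3, -⟩
    -- Products with `α` are supplied because the relations between coordinates involve `α * coord`,
    -- which linear arithmetic treats as an atom.
    have h1' := mul_lt_mul_of_pos_left h1 α_pos
    have h3' := mul_lt_mul_of_pos_left h3 α_pos
    have h6' := mul_lt_mul_of_pos_left h6 α_pos
    refine ⟨?_, ?_, ?_, ?_, ?_, ?_, ?_, ?_⟩ <;> linarith
  · rintro ⟨h0, h1, h2, h3, h4, h5, h6, h7⟩
    refine ⟨?_, ?_, ?_, fun _ h => h.elim⟩ <;> linarith

theorem Q2_eq {x : ℝ} (a : RealForm) (ha : 2 * x = a.eval s t) :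
    Q2 x = (Poly.Q2 a).set s t := by
  ext z
  obtain ⟨e4, e5, e6, e7, r1, r2, r3, r0⟩ := coord_relations z
  simp only [Q2, mem_octPolygon, mem_set_iff, List.forall_mem_cons, List.not_mem_nil,
    Poly.Q2, Matrix.cons_val, RealForm.eval_mulα, ← ha, e4, e5, e6, e7]
  constructor
  · rintro ⟨h4, h6, h0, h2, -⟩
    have hα := α_sq
    have h1 : coord 1 z < α * x := by
      refine coord_lt_of_adjacent (a := x) (b := x) (by norm_num; exact h0) (by norm_num; exact h2) ?_
      nlinarith
    have h3 : coord 3 z < α * x := by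
      refine coord_lt_of_adjacent (a := x) (b := x) (by norm_num; exact h2) (by norm_num; linarith) ?_
      nlinarith
    have h5 : coord 5 z < α * x := by
      refine coord_lt_of_adjacent (a := x) (b := x) (by norm_num; linarith)
        (by norm_num; linarith) ?_
      nlinarith
    have h7 : coord 7 z < α * x := by
      refine coord_lt_of_adjacent (a := x) (b := x) (by norm_num; linarith)
        (by rw [coord_congr (b := 0) (by norm_num)]; linarith) ?_
      nlinarith
    refine ⟨?_, ?_, ?_, ?_, ?_, ?_, ?_, ?_⟩ <;> linarith
  · rintro ⟨h0, h1, h2, h3, h4, h5, h6, h7⟩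
    refine ⟨?_, ?_, ?_, ?_, fun _ h => h.elim⟩ <;> linarith

theorem Q3_eq {x : ℝ} (a : RealForm) (ha : 2 * x = a.eval s t) :
    Q3 x = (Poly.Q3 a).set s t := by
  ext z
  obtain ⟨e4, e5, e6, e7, r1, r2, r3, r0⟩ := coord_relations z
  simp only [Q3, mem_octPolygon, mem_set_iff, List.forall_mem_cons, List.not_mem_nil,
    Poly.Q3, Matrix.cons_val, RealForm.eval_mulω, ω_eq, ← ha, e4, e5, e6, e7]
  constructor
  · rintro ⟨h6, h7, h2, h3, -⟩
    have h2' := mul_lt_mul_of_pos_left h2 α_pos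
    have h3' := mul_lt_mul_of_pos_left h3 α_pos
    have h6' := mul_lt_mul_of_pos_left h6 α_pos
    have h7' := mul_lt_mul_of_pos_left h7 α_pos
    refine ⟨?_, ?_, ?_, ?_, ?_, ?_, ?_, ?_⟩ <;> linarith
  · rintro ⟨h0, h1, h2, h3, h4, h5, h6, h7⟩
    refine ⟨?_, ?_, ?_, ?_, fun _ h => h.elim⟩ <;> linarith

theorem Q4_eq {x y : ℝ} (a b : RealForm) (ha : 2 * x = a.eval s t) (hb : 2 * y = b.eval s t) :
    Q4 x y = (Poly.Q4 a b).set s t := by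
  ext z
  obtain ⟨e4, e5, e6, e7, r1, r2, r3, r0⟩ := coord_relations z
  simp only [Q4, mem_octPolygon, mem_set_iff, List.forall_mem_cons, List.not_mem_nil,
    Poly.Q4, Matrix.cons_val, RealForm.eval_zero, RealForm.eval_mulα, RealForm.eval_neg, ← ha,
    ← hb, e4, e5, e6, e7]
  constructor
  · rintro ⟨h6, h1, h2, h3, -⟩
    have h1' := mul_lt_mul_of_pos_left h1 α_pos
    have h3' := mul_lt_mul_of_pos_left h3 α_pos
    have h6' := mul_lt_mul_of_pos_left h6 α_pos
    refine ⟨?_, ?_, ?_, ?_, ?_, ?_, ?_, ?_⟩ <;> linarith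
  · rintro ⟨h0, h1, h2, h3, h4, h5, h6, h7⟩
    refine ⟨?_, ?_, ?_, ?_, fun _ h => h.elim⟩ <;> linarith

theorem lt_of_α_mul_lt {x y : ℝ} (h : α * x < α * y) : x < y := lt_of_mul_lt_mul_left h α_pos.le

theorem Q6_eq {x y : ℝ} (a b : RealForm) (ha : x = a.eval s t) (hb : y = b.eval s t) :
    Q6 x y = (Poly.Q6 a b).set s t := by
  have hα (c : ℝ) : α * (α * c) = 2 * c := by rw [← mul_assoc, α_sq]
  ext z
  obtain ⟨e4, e5, e6, e7, r1, r2, r3, r0⟩ := coord_relations z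
  simp only [Q6, mem_octPolygon, mem_set_iff, List.forall_mem_cons, List.not_mem_nil,
    Poly.Q6, Matrix.cons_val, RealForm.eval_zero, RealForm.eval_mulα, RealForm.eval_add,
    RealForm.eval_dbl, ← ha, ← hb, e4, e5, e6, e7]
  constructor
  · rintro ⟨h5, h6, h0, h2, h3, -⟩
    have := hα (x + y)
    refine ⟨?_, lt_of_α_mul_lt ?_, ?_, ?_, lt_of_α_mul_lt ?_, ?_, ?_, lt_of_α_mul_lt ?_⟩ <;> linarith
  · rintro ⟨h0, h1, h2, h3, h4, h5, h6, h7⟩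
    refine ⟨?_, ?_, ?_, ?_, ?_, fun _ h => h.elim⟩ <;> linarith

theorem Q7_eq {x : ℝ} (a : RealForm) (ha : x = a.eval s t) :
    Q7 x = (Poly.Q7 a).set s t := by
  have hα (c : ℝ) : α * (α * c) = 2 * c := by rw [← mul_assoc, α_sq]
  ext z
  obtain ⟨e4, e5, e6, e7, r1, r2, r3, r0⟩ := coord_relations z
  simp only [Q7, mem_octPolygon, mem_set_iff, List.forall_mem_cons, List.not_mem_nil,
    Poly.Q7, Matrix.cons_val, RealForm.eval_zero, RealForm.eval_mulα,
    RealForm.eval_dbl, ← ha, e4, e5, e6, e7]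
  constructor
  · rintro ⟨h5, h7, h0, h2, -⟩
    have h2' := mul_lt_mul_of_pos_left h2 α_pos
    have h5' := mul_lt_mul_of_pos_left h5 α_pos
    have := hα x
    refine ⟨?_, lt_of_α_mul_lt ?_, ?_, ?_, ?_, ?_, lt_of_α_mul_lt ?_, ?_⟩ <;> linarith
  · rintro ⟨h0, h1, h2, h3, h4, h5, h6, h7⟩
    refine ⟨?_, ?_, ?_, ?_, fun _ h => h.elim⟩ <;> linarith

theorem Q8_eq {x y : ℝ} (a b : RealForm) (ha : x = a.eval s t) (hb : y = b.eval s t) :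
    Q8 x y = (Poly.Q8 a b).set s t := by
  have hα (c : ℝ) : α * (α * c) = 2 * c := by rw [← mul_assoc, α_sq]
  ext z
  obtain ⟨e4, e5, e6, e7, r1, r2, r3, r0⟩ := coord_relations z
  simp only [Q8, mem_octPolygon, mem_set_iff, List.forall_mem_cons, List.not_mem_nil,
    Poly.Q8, Matrix.cons_val, RealForm.eval_zero, RealForm.eval_mulα,
    RealForm.eval_dbl, ← ha, ← hb, e4, e5, e6, e7]
  constructor
  · rintro ⟨h4, h5, h7, h0, h1, h2, -⟩
    have := hα x
    refine ⟨?_, ?_, ?_, lt_of_α_mul_lt ?_, ?_, ?_, lt_of_α_mul_lt ?_, ?_⟩ <;> linarith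
  · rintro ⟨h0, h1, h2, h3, h4, h5, h6, h7⟩
    refine ⟨?_, ?_, ?_, ?_, ?_, ?_, fun _ h => h.elim⟩ <;> linarith

theorem Q9_eq {x y : ℝ} (a b : RealForm) (ha : 2 * x = a.eval s t) (hb : 2 * y = b.eval s t) :
    Q9 x y = (Poly.Q9 a b).set s t := by
  have hα (c : ℝ) : α * (α * c) = 2 * c := by rw [← mul_assoc, α_sq]
  ext z
  obtain ⟨e4, e5, e6, e7, r1, r2, r3, r0⟩ := coord_relations z
  simp only [Q9, mem_octPolygon, mem_set_iff, List.forall_mem_cons, List.not_mem_nil,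
    Poly.Q9, Matrix.cons_val, RealForm.eval_mulα, ← ha, ← hb, e4, e5, e6, e7]
  constructor
  · rintro ⟨h1, h2, h3, h5, h6, h7, -⟩
    have := hα x
    refine ⟨lt_of_α_mul_lt ?_, ?_, ?_, ?_, lt_of_α_mul_lt ?_, ?_, ?_, ?_⟩ <;> linarith
  · rintro ⟨h0, h1, h2, h3, h4, h5, h6, h7⟩
    refine ⟨?_, ?_, ?_, ?_, ?_, ?_, fun _ h => h.elim⟩ <;> linarith

/-! ### The placed tiles -/

/-- The formal piece has the value `p`. -/
structure FormalPiece.Realizes (s t : ℝ) (q : FormalPiece) (p : Piece) : Prop where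
  shape : p.shape = q.shape.set s t
  axis : U2 p.axis = U2 (q.axis : ℕ)
  place : p.place = q.place.toIsom s t

theorem conj_toIsom : Motion.conj.toIsom s t = U0 := by
  ext z
  rw [Motion.toIsom_apply, U0_apply]
  simp [Motion.conj, ComplexForm.eval, u_zero]

theorem ofCoords_toIsom {x y : RealForm} {m : Fin 8} : (Motion.ofCoords x y m).toIsom s t =
    T ⟨x.eval s t, y.eval s t⟩ * R (m : ℕ) := by
  rw [← ComplexForm.eval_ofCoords, Motion.toIsom]
  simp [Motion.ofCoords]

namespace FormalPiece.Realizes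

variable {q : FormalPiece} {p : Piece}

theorem tile (h : q.Realizes s t p) : p.tile = q.tile.set s t := by
  rw [Piece.tile, FormalPiece.tile, ← Motion.image_set, h.shape, h.place]

theorem refl (h : q.Realizes s t p) : p.refl = (q.place.axisRefl q.axis).toIsom s t := by
  rw [Piece.refl, h.axis, h.place, Motion.toIsom_axisRefl]

theorem iso (h : q.Realizes s t p) : U0 * p.refl = q.iso.toIsom s t := by
  rw [h.refl, FormalPiece.iso, Motion.toIsom_mul, conj_toIsom]

theorem conj (h : q.Realizes s t p) : q.conj.Realizes s t ⟨p.shape, p.axis, U0 * p.place⟩ where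
  shape := h.shape
  axis := h.axis
  place := by rw [FormalPiece.conj, Motion.toIsom_mul, conj_toIsom, h.place]

end FormalPiece.Realizes

theorem U2_congr {a b : ℤ} (h : a % 8 = b % 8) : U2 a = U2 b := by
  rw [U2, U2, u_congr h]

open FormalPiece

section pieces

variable {l h : ℝ} {x y : RealForm} (hl : l = x.eval s t) (hh : h = y.eval s t)
include hl hh

theorem realizes_piece1 (ν : ℤˣ) (L : ℕ) : (piece1 x y).Realizes s t (piece ν L l h 1) where
  shape := by
    refine Q9_eq _ _ ?_ ?_
    · simp only [RealForm.eval_sub, RealForm.eval_mulα, RealForm.eval_mulβ, RealForm.eval_dbl,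
        ← hl, ← hh]
      field_simp [α_pos.ne']
      -- The doubled bound turns `2 β l / √2` into `√2 β l`, which has coefficients in `ℤ[√2]`.
      linear_combination (-β * l) * α_sq
    · rw [RealForm.eval_dbl, ← hh]
  axis := rfl
  place := by
    simp only [piece1, ofCoords_toIsom, RealForm.eval_neg, RealForm.eval_zero, ← hl]
    ext z
    simp [piece, R_apply, T_apply, u_zero]

theorem realizes_piece2 (ν : ℤˣ) (L : ℕ) : (piece2 x y).Realizes s t (piece ν L l h 2) where
  shape := Q7_eq _ (by rw [RealForm.eval_mulα, hh])
  axis := rfl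
  place := by
    simp only [piece2, ofCoords_toIsom, RealForm.eval_neg, RealForm.eval_sub, RealForm.eval_mulα,
      RealForm.eval_mulβ, RealForm.eval_mulω, ← hl, ← hh, ← mul_assoc]
    rfl

theorem realizes_piece3 (ν : ℤˣ) (L : ℕ) : (piece3 x y).Realizes s t (piece ν L l h 3) where
  shape := Q1_eq _ (by simp [hh])
  axis := rfl
  place := by
    simp only [piece3, ofCoords_toIsom, RealForm.eval_neg, RealForm.eval_sub, RealForm.eval_mulα,
      RealForm.eval_mulβ, ← hl, ← hh, ← mul_assoc]
    rfl

theorem realizes_piece4 (ν : ℤˣ) (L : ℕ) : (piece4 x y).Realizes s t (piece ν L l h 4) where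
  shape := Q3_eq _ (by simp [hh])
  axis := rfl
  place := by
    simp only [piece4, ofCoords_toIsom, RealForm.eval_neg, RealForm.eval_mulα,
      RealForm.eval_mulβ, RealForm.eval_zero, ← hl, ← mul_assoc]
    rfl

theorem realizes_trapezium (ν : ℤˣ) (M : ℕ) :
    (trapezium x y).Realizes s t (piece ν (M + 5) l h 5) where
  shape := by
    have : (piece ν (M + 5) l h 5).shape =
        Q4 (β ^ 1 * (β * l) - β * h) (β ^ 1 * (β * l) - ω * h) := by
      simp [piece, strip, stripOdd]
    rw [this]
    exact Q4_eq _ _ (by simp [hl, hh]) (by simp [hl, hh])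
  axis := rfl
  place := by
    have : (piece ν (M + 5) l h 5).place = U0 * (T ⟨-(β ^ 0 * (β * l)),
        (-1) ^ 0 * (β ^ 1 * (β * l) - α * h)⟩ * R 0) := rfl
    rw [this]
    simp only [trapezium, Motion.toIsom_mul, conj_toIsom, ofCoords_toIsom, RealForm.eval_neg,
      RealForm.eval_sub, RealForm.eval_mulα, RealForm.eval_mulβ, ← hl, ← hh, pow_zero, pow_one,
      one_mul]
    rfl

theorem realizes_minimal5 (ν : ℤˣ) : (minimal5 x y).Realizes s t (piece ν 4 l h 5) where
  shape := by
    have : (piece ν 4 l h 5).shape = Q1 (β ^ 1 * (β * l) - β * h) := by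
      simp [piece, strip, stripOdd]
    rw [this]
    exact Q1_eq _ (by simp [hl, hh])
  axis := rfl
  place := by
    have : (piece ν 4 l h 5).place = U0 * (T ⟨-(β ^ 0 * (β * l)),
        (-1) ^ 0 * (β ^ 1 * (β * l) - α * h)⟩ * R 0) := rfl
    rw [this]
    simp only [minimal5, Motion.toIsom_mul, conj_toIsom, ofCoords_toIsom, RealForm.eval_neg,
      RealForm.eval_sub, RealForm.eval_mulα, RealForm.eval_mulβ, ← hl, ← hh, pow_zero, pow_one,
      one_mul]
    rfl

theorem realizes_minimal6 (ν : ℤˣ) : (minimal6 x y).Realizes s t (piece ν 4 l h 6) := by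
  have : piece ν 4 l h 6 = ⟨Q8 (α * β ^ 1 * (β * l) - α * β * h) (2 * h), 1,
      U0 * (T ⟨-(α * β ^ 1 * (β * l)) - β * h, (-1) ^ 1 * h⟩ * R 1)⟩ := by
    have h3 : ¬ Odd 2 := by decide
    simp [piece, strip, stripEven, h3]
  rw [this]
  refine ⟨?_, rfl, ?_⟩
  · exact Q8_eq _ _ (by simp [hl, hh]; ring) (by simp [hh])
  · simp only [minimal6, Motion.toIsom_mul, conj_toIsom, ofCoords_toIsom, RealForm.eval_neg,
      RealForm.eval_sub, RealForm.eval_mulα, RealForm.eval_mulβ, ← hl, ← hh, pow_one,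
      neg_one_mul, ← mul_assoc]
    rfl

theorem realizes_minimal7 (ν : ℤˣ) : (minimal7 x y).Realizes s t (piece ν 4 l h 7) := by
  have : piece ν 4 l h 7 = ⟨Q1 (β ^ 2 * (β * l) - β * h), 4,
      U0 * (T ⟨-(β ^ 1 * (β * l)), (-1) ^ 1 * (β ^ 2 * (β * l) - α * h)⟩ * R 4)⟩ := by
    have h3 : Odd 3 := by decide
    simp [piece, strip, stripOdd, h3]
  rw [this]
  refine ⟨?_, rfl, ?_⟩
  · exact Q1_eq _ (by simp [hl, hh]; ring)
  · simp only [minimal7, Motion.toIsom_mul, conj_toIsom, ofCoords_toIsom, RealForm.eval_neg,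
      RealForm.eval_sub, RealForm.eval_mulα, RealForm.eval_mulβ, ← hl, ← hh, pow_one, pow_two,
      neg_one_mul, mul_assoc]
    rfl

theorem realizes_minimal8 (ν : ℤˣ) : (minimal8 x y).Realizes s t (piece ν 4 l h 8) := by
  have : piece ν 4 l h 8 = ⟨Q7 (α * β ^ 1 * (β * l) - α * h), 7,
      U0 * (T ⟨-h, (-1) ^ 1 * (α * β ^ 1 * (β * l) - ω * h)⟩ * R 3)⟩ := by
    have h3 : ¬ Odd 4 := by decide
    simp [piece, strip, stripEven, h3]
  rw [this]
  refine ⟨?_, rfl, ?_⟩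
  · exact Q7_eq _ (by simp [hl, hh]; ring)
  · simp only [minimal8, Motion.toIsom_mul, conj_toIsom, ofCoords_toIsom, RealForm.eval_neg,
      RealForm.eval_sub, RealForm.eval_mulα, RealForm.eval_mulβ, RealForm.eval_mulω, ← hl, ← hh,
      pow_one, neg_one_mul, ← mul_assoc]
    rfl

theorem pentagon_eq : pentagon l h = (formalPentagon x y).set s t := by
  rw [formalPentagon, ← Motion.image_set, pentagon, ofCoords_toIsom]
  rw [Q6_eq (x.mulα - y.mulβ) y (by simp [hl, hh]) hh]
  congr 1
  ext z
  simp [T_apply, R_apply, u_zero, hl, hh]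

end pieces

theorem piece0_tile_eq {h : ℝ} {y : RealForm} (hh : h = y.eval s t) (ν : ℤˣ) (L : ℕ) (l : ℝ) :
    (piece ν L l h 0).tile = (piece0 y).tile.set s t := by
  rw [FormalPiece.tile, ← Motion.image_set, Piece.tile]
  simp only [piece0, ofCoords_toIsom]
  rw [← Q2_eq y.dbl (by simp [hh]) (x := h)]
  congr 1
  ext z
  simp [piece, T_apply, R_apply, u_zero, Complex.ext_iff]

/-! ### The group -/

theorem U0_mul_T_mul_R (d : ℂ) (m : ℤ) :
    U0 * (T d * R m) = T ((starRingEnd ℂ) d) * R (-m) * U0 := by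
  ext z
  simp only [AffineIsometryEquiv.coe_mul, Function.comp_apply, U0_apply, T_apply, R_apply,
    map_add, map_mul, u_neg_conj]

theorem T_mul_R_mul (d e : ℂ) (m n : ℤ) :
    T d * R m * (T e * R n) = T (d + u m * e) * R (m + n) := by
  ext z
  simp only [AffineIsometryEquiv.coe_mul, Function.comp_apply, T_apply, R_apply, u_add,
    Circle.coe_mul]
  ring

theorem T_zero_mul_R_zero : T 0 * R 0 = 1 := by
  ext z
  simp [T_apply, R_apply, u_zero]

theorem inGroup_iff {g : Isom} :
    InGroup g ↔ ∃ d m, g = T d * R m ∨ g = T d * R m * U0 := by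
  constructor
  · rintro ⟨d, m, n, rfl⟩
    refine ⟨d, m, ?_⟩
    rcases Nat.even_or_odd' n with ⟨k, rfl | rfl⟩
    · left; rw [pow_mul, pow_two, U0_mul_U0, one_pow, mul_one]
    · right; rw [pow_succ, pow_mul, pow_two, U0_mul_U0, one_pow, one_mul]
  · rintro ⟨d, m, rfl | rfl⟩
    · exact ⟨d, m, 0, by rw [pow_zero, mul_one]⟩
    · exact ⟨d, m, 1, by rw [pow_one]⟩

theorem inGroup_T_mul_R (d : ℂ) (m : ℤ) : InGroup (T d * R m) :=
  inGroup_iff.2 ⟨d, m, .inl rfl⟩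

theorem inGroup_one : InGroup 1 := T_zero_mul_R_zero ▸ inGroup_T_mul_R 0 0

theorem inGroup_T (d : ℂ) : InGroup (T d) := by
  have := inGroup_T_mul_R d 0
  rwa [show R 0 = 1 by ext z; simp [R_apply, u_zero], mul_one] at this

theorem inGroup_U2 (a : ℤ) : InGroup (U2 a) := by
  refine inGroup_iff.2 ⟨0, a, .inr ?_⟩
  ext z
  simp [T_apply, R_apply, U0_apply, U2_apply]

theorem InGroup.mul {g k : Isom} (hg : InGroup g) (hk : InGroup k) : InGroup (g * k) := by
  obtain ⟨d, m, rfl | rfl⟩ := inGroup_iff.1 hg <;> obtain ⟨e, n, rfl | rfl⟩ := inGroup_iff.1 hk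
  · rw [T_mul_R_mul]; exact inGroup_T_mul_R _ _
  · rw [← mul_assoc, T_mul_R_mul]; exact inGroup_iff.2 ⟨_, _, .inr rfl⟩
  · rw [mul_assoc, U0_mul_T_mul_R, ← mul_assoc, T_mul_R_mul]; exact inGroup_iff.2 ⟨_, _, .inr rfl⟩
  · rw [mul_assoc (T d * R m), ← mul_assoc U0, U0_mul_T_mul_R, mul_assoc _ U0, U0_mul_U0, mul_one,
      T_mul_R_mul]
    exact inGroup_T_mul_R _ _

theorem InGroup.inv {g : Isom} (hg : InGroup g) : InGroup g⁻¹ := by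
  have key (d : ℂ) (m : ℤ) : (T d * R m)⁻¹ = T (-(u (-m) * d)) * R (-m) := by
    rw [inv_eq_iff_mul_eq_one, T_mul_R_mul, ← T_zero_mul_R_zero]
    congr 2
    · rw [mul_neg, ← mul_assoc, ← Circle.coe_mul, ← u_add]; simp [u_zero]
    · simp
  obtain ⟨d, m, rfl | rfl⟩ := inGroup_iff.1 hg
  · rw [key]; exact inGroup_T_mul_R _ _
  · rw [mul_inv_rev, key, U0_inv]; exact (inGroup_U2 0).mul (inGroup_T_mul_R _ _)

theorem InGroup.pow {g : Isom} (hg : InGroup g) (n : ℕ) : InGroup (g ^ n) := by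
  induction n with
  | zero => exact inGroup_one
  | succ n ih => rw [pow_succ]; exact ih.mul hg

theorem parity_mul (g k : Isom) : parity (g * k) = parity g * parity k := by
  rw [parity, parity, parity, ← LinearMap.det_comp]; rfl

theorem parity_one : parity 1 = 1 := LinearMap.det_id

theorem parity_U2 (a : ℤ) : parity (U2 a) = -1 := by
  have : ((U2 a).linearIsometryEquiv.toLinearEquiv : ℂ →ₗ[ℝ] ℂ) =
      ((rotation (u a)).toLinearEquiv : ℂ →ₗ[ℝ] ℂ) ∘ₗ (Complex.conjAe.toLinearMap) := rfl
  rw [parity, this, LinearMap.det_comp, det_rotation, Complex.det_conjAe, one_mul]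

theorem parity_U0 : parity U0 = -1 := parity_U2 0

theorem parity_mul_inv (g : Isom) : parity g * parity g⁻¹ = 1 := by
  rw [← parity_mul, mul_inv_cancel, parity_one]

theorem parity_conj (g k : Isom) : parity (g * k * g⁻¹) = parity k := by
  rw [parity_mul, parity_mul, mul_right_comm, parity_mul_inv, one_mul]

theorem parity_pow_U0 (n : ℕ) : parity (U0 ^ n) = (-1) ^ n := by
  induction n with
  | zero => rw [pow_zero, parity_one, pow_zero]
  | succ n ih => rw [pow_succ, parity_mul, ih, parity_U0, pow_succ]

/-! ### Images of polygons -/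

theorem image_octPolygon {g : Isom} (hg : InGroup g) (es : List (ℤ × ℝ)) :
    ∃ es', g '' octPolygon es = octPolygon es' := by
  have hT (d : ℂ) (m : ℤ) (es : List (ℤ × ℝ)) :
      ∃ es', (T d * R m) '' octPolygon es = octPolygon es' := by
    refine ⟨es.map fun e => (e.1 + m, coord (e.1 + m) d + e.2),
      Motion.image_eq_of_mem_iff _ fun z => ?_⟩
    simp only [mem_octPolygon, List.forall_mem_map, AffineIsometryEquiv.coe_mul,
      Function.comp_apply, T_apply, R_apply, coord_add, coord_u_mul, add_sub_cancel_right,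
      add_lt_add_iff_left]
  obtain ⟨d, m, rfl | rfl⟩ := inGroup_iff.1 hg
  · exact hT d m es
  · have : U0 '' octPolygon es = octPolygon (es.map fun e => (-e.1, e.2)) :=
      Motion.image_eq_of_mem_iff _ fun z => by
        simp only [mem_octPolygon, List.forall_mem_map, U0_apply, coord_conj, neg_neg]
    rw [AffineIsometryEquiv.coe_mul, Set.image_comp, this]
    exact hT d m _

theorem U2_mul_U2 (a : ℤ) : U2 a * U2 a = 1 := by
  ext z
  simp only [AffineIsometryEquiv.coe_mul, Function.comp_apply, U2_apply, map_mul, Complex.conj_conj,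
    ← u_neg_conj, ← mul_assoc, ← Circle.coe_mul, ← u_add]
  simp [u_zero]

theorem U2_inv (a : ℤ) : (U2 a)⁻¹ = U2 a := inv_eq_of_mul_eq_one_left (U2_mul_U2 a)

/-- The reflection `U_{a/2}` sends the normal `u_m` to `u_{a-m}`, so a symmetric list of bounds
suffices; the reverse inclusion follows because a reflection is an involution. -/
theorem U2_image_octPolygon {a : ℤ} {es : List (ℤ × ℝ)}
    (h : ∀ e ∈ es, ∃ e' ∈ es, e'.1 % 8 = (a - e.1) % 8 ∧ e'.2 = e.2) :
    U2 a '' octPolygon es = octPolygon es := by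
  have key : ∀ z ∈ octPolygon es, U2 a z ∈ octPolygon es := by
    intro z hz e he
    obtain ⟨e', he', h1, h2⟩ := h e he
    have := hz e' he'
    change coord e.1 _ < _
    rw [U2_apply, coord_u_mul, coord_conj, neg_sub, coord_congr h1.symm, ← h2]
    exact this
  refine Motion.image_eq_of_mem_iff _ fun z => ⟨fun hz => ?_, key z⟩
  have := key _ hz
  rwa [← Function.comp_apply (f := U2 a), ← AffineIsometryEquiv.coe_mul, U2_mul_U2] at this

theorem U2_image_Q1 (x : ℝ) : U2 4 '' Q1 x = Q1 x := U2_image_octPolygon (by simp)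

theorem U2_image_Q2 (x : ℝ) {a : ℤ} (ha : a = 2 ∨ a = -2) : U2 a '' Q2 x = Q2 x :=
  U2_image_octPolygon (by rcases ha with rfl | rfl <;> simp)

theorem U2_image_Q3 (x : ℝ) : U2 5 '' Q3 x = Q3 x := U2_image_octPolygon (by simp)

theorem U2_image_Q3' (x : ℝ) : U2 9 '' Q3 x = Q3 x := U2_image_octPolygon (by simp)

theorem U2_image_Q4 (x y : ℝ) : U2 4 '' Q4 x y = Q4 x y := U2_image_octPolygon (by simp)

theorem U0_image_Q6 (x y : ℝ) : U0 '' Q6 x y = Q6 x y := U2_image_octPolygon (by simp)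

theorem U2_image_Q7 (x : ℝ) : U2 7 '' Q7 x = Q7 x := U2_image_octPolygon (by simp)

theorem U2_image_Q8 (x y : ℝ) : U2 1 '' Q8 x y = Q8 x y := U2_image_octPolygon (by simp)

theorem U2_image_Q9 (x y : ℝ) : U2 4 '' Q9 x y = Q9 x y := U2_image_octPolygon (by simp)

/-! ### General properties of the pieces -/

theorem Piece.refl_image_tile {p : Piece} (h : U2 p.axis '' p.shape = p.shape) :
    p.refl '' p.tile = p.tile := by
  rw [Piece.tile, ← Set.image_comp, ← AffineIsometryEquiv.coe_mul, Piece.refl,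
    inv_mul_cancel_right, AffineIsometryEquiv.coe_mul, Set.image_comp, h]

theorem InGroup.refl {p : Piece} (h : InGroup p.place) : InGroup p.refl :=
  (h.mul (inGroup_U2 _)).mul h.inv

theorem parity_refl (p : Piece) : parity p.refl = -1 := by
  rw [Piece.refl, parity_conj, parity_U2]

/-- A placed tile with the properties that all the tiles of a pencil have. -/
structure Piece.Regular (p : Piece) : Prop where
  symm : U2 p.axis '' p.shape = p.shape
  shape : ∃ es, p.shape = octPolygon es
  place : InGroup p.place

theorem strip_regular (J : ℕ) (l h : ℝ) (k : ℕ) : (strip J l h k).Regular := by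
  rw [strip]
  split_ifs
  · refine ⟨?_, ?_, inGroup_T_mul_R _ _⟩
    · simp only [stripOdd]
      split_ifs
      exacts [U2_image_Q4 _ _, U2_image_Q1 _]
    · simp only [stripOdd]
      split_ifs
      exacts [⟨_, rfl⟩, ⟨_, rfl⟩]
  · rw [stripEven]
    split_ifs
    · exact ⟨U2_image_Q3 _, ⟨_, rfl⟩, inGroup_T_mul_R _ _⟩
    · exact ⟨U2_image_Q3 _, ⟨_, rfl⟩, inGroup_T_mul_R _ _⟩
    · exact ⟨U2_image_Q8 _ _, ⟨_, rfl⟩, inGroup_T_mul_R _ _⟩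
    · exact ⟨U2_image_Q8 _ _, ⟨_, rfl⟩, inGroup_T_mul_R _ _⟩
    · exact ⟨U2_image_Q7 _, ⟨_, rfl⟩, inGroup_T_mul_R _ _⟩
    · exact ⟨U2_image_Q7 _, ⟨_, rfl⟩, inGroup_T_mul_R _ _⟩

theorem piece_regular (ν : ℤˣ) (L : ℕ) (l h : ℝ) : ∀ i, (piece ν L l h i).Regular
  | 0 => by
    refine ⟨U2_image_Q2 _ ?_, ⟨_, rfl⟩, inGroup_one⟩
    rcases Int.units_eq_one_or ν with rfl | rfl <;> simp [piece]
  | 1 => ⟨U2_image_Q9 _ _, ⟨_, rfl⟩, inGroup_T _⟩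
  | 2 => ⟨U2_image_Q7 _, ⟨_, rfl⟩, inGroup_T_mul_R _ _⟩
  | 3 => ⟨U2_image_Q1 _, ⟨_, rfl⟩, inGroup_T_mul_R _ _⟩
  | 4 => ⟨U2_image_Q3 _, ⟨_, rfl⟩, inGroup_T_mul_R _ _⟩
  | k + 5 =>
    have := strip_regular (L - 2) (β * l) h (k + 1)
    ⟨this.symm, this.shape, (inGroup_U2 0).mul this.place⟩

theorem Piece.Regular.tile_eq {p : Piece} (hp : p.Regular) : ∃ es, p.tile = octPolygon es := by
  obtain ⟨es, hes⟩ := hp.shape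
  rw [Piece.tile, hes]
  exact image_octPolygon hp.place es

theorem U0_image_pentagon (l h : ℝ) : U0 '' pentagon l h = pentagon l h := by
  rw [pentagon, ← Set.image_comp, ← AffineIsometryEquiv.coe_mul]
  have : U0 * T ⟨-(α * l) + α * h, 0⟩ = T ⟨-(α * l) + α * h, 0⟩ * U0 := by
    ext z
    simp [U0_apply, T_apply, Complex.ext_iff]
  rw [this, AffineIsometryEquiv.coe_mul, Set.image_comp, U0_image_Q6]

/-! ### The tiles that a pencil shares with its shortening -/

/-- Both prototype placements preserve orientation, whereas conjugate placements differ by `U_0`. A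
second reflection `U_{b/2}`, to be chosen as a symmetry of the shape, restores the orientation. -/
theorem T_mul_R_eq_conj {d e : ℂ} {m n b : ℤ} (hd : d = (starRingEnd ℂ) e)
    (hm : m % 8 = (-n - b) % 8) : T d * R m = U0 * (T e * R n) * U2 b := by
  ext z
  simp only [AffineIsometryEquiv.coe_mul, Function.comp_apply, U0_apply, U2_apply, T_apply, R_apply,
    map_add, map_mul, ← u_neg_conj, Complex.conj_conj, hd, u_congr hm, sub_eq_add_neg, u_add,
    Circle.coe_mul, mul_assoc]

/-- The placed tile `p` is the image of `p'` under `U_0`, with the same axis. -/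
structure Piece.IsConj (p p' : Piece) : Prop where
  tile : p.tile = U0 '' p'.tile
  refl : p.refl = U0 * p'.refl * U0

/-- A symmetry `W` of the shape that commutes with the assigned reflection changes neither the
placed tile nor its reflection. -/
theorem Piece.isConj_of_place {p p' : Piece} {W : Isom} (hs : p.shape = p'.shape)
    (ha : p.axis = p'.axis) (hp : p.place = U0 * p'.place * W) (hW : W '' p'.shape = p'.shape)
    (hWa : W * U2 p'.axis * W⁻¹ = U2 p'.axis) : p.IsConj p' where
  tile := by
    rw [tile, hs, hp, AffineIsometryEquiv.coe_mul, Set.image_comp, hW, AffineIsometryEquiv.coe_mul,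
      Set.image_comp, tile]
  refl := by
    rw [refl, refl, hp, ha, mul_inv_rev, mul_inv_rev, U0_inv]
    nth_rw 2 [← hWa]
    simp only [mul_assoc]

theorem U2_mul_U2_mul_U2 (a b : ℤ) : U2 b * U2 a * U2 b = U2 (2 * b - a) := by
  ext z
  simp only [AffineIsometryEquiv.coe_mul, Function.comp_apply, U2_apply, map_mul, Complex.conj_conj,
    ← u_neg_conj, ← mul_assoc, ← Circle.coe_mul, ← u_add]
  congr 3; ring

theorem U2_mul_U2_mul_inv {a b : ℤ} (h : (2 * b - a) % 8 = a % 8) :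
    U2 b * U2 a * (U2 b)⁻¹ = U2 a := by
  rw [U2_inv, U2_mul_U2_mul_U2, U2_congr h]

theorem ite_even_add_one (J : ℕ) {γ : Type*} (a b : γ) :
    (if Even (J + 1) then a else b) = if Even J then b else a := by
  rcases Nat.even_or_odd J with h | h
  · rw [if_neg (by simpa [Nat.even_add_one] using h), if_pos h]
  · rw [if_pos h.add_one, if_neg (Nat.not_even_iff_odd.2 h)]

/-- The tile `S_{k+2}` of a strip and the tile `S_k` of the next strip. -/
theorem strip_shift (J : ℕ) (l h : ℝ) (k : ℕ) : ∃ b : ℤ,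
    let p := strip (J + 2) l h (k + 3)
    let p' := strip (J + 1) (β * l) h (k + 1)
    p.shape = p'.shape ∧ p.axis = p'.axis ∧ p.place = U0 * p'.place * U2 b ∧
      U2 b '' p'.shape = p'.shape ∧ (2 * b - p'.axis) % 8 = p'.axis % 8 := by
  have hβ (j : ℕ) : β ^ (j + 1) * l = β ^ j * (β * l) := by ring
  rcases Nat.even_or_odd' k with ⟨i, rfl | rfl⟩
  · have o1 : Odd (2 * i + 3) := ⟨i + 1, by ring⟩
    have o2 : Odd (2 * i + 1) := ⟨i, rfl⟩
    refine ⟨4, ?_⟩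
    simp only [strip, if_pos o1, if_pos o2, show (2 * i + 3 + 1) / 2 = i + 2 by omega,
      show (2 * i + 1 + 1) / 2 = i + 1 by omega]
    refine ⟨?_, rfl, ?_, ?_, rfl⟩
    · simp only [stripOdd, ← hβ, show i + 2 + 2 ≤ J + 2 ↔ i + 1 + 2 ≤ J + 1 by omega]
    · refine T_mul_R_eq_conj ?_ ?_
      · simp only [Complex.ext_iff, Complex.conj_re, Complex.conj_im, Nat.add_sub_cancel, ← hβ,
          show i + 2 - 1 = i + 1 by omega, pow_succ, true_and]
        ring
      · rw [ite_even_add_one]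
        split_ifs <;> rfl
    · simp only [stripOdd]
      split_ifs
      exacts [U2_image_Q4 _ _, U2_image_Q1 _]
  · have o1 : ¬ Odd (2 * i + 1 + 3) := by rw [Nat.not_odd_iff_even]; exact ⟨i + 2, by ring⟩
    have o2 : ¬ Odd (2 * i + 1 + 1) := by rw [Nat.not_odd_iff_even]; exact ⟨i + 1, by ring⟩
    simp only [strip, if_neg o1, if_neg o2, show (2 * i + 1 + 3) / 2 = i + 2 by omega,
      show (2 * i + 1 + 1) / 2 = i + 1 by omega, stripEven,
      show i + 2 + 2 ≤ J + 2 ↔ i + 1 + 2 ≤ J + 1 by omega,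
      show i + 2 + 1 = J + 2 ↔ i + 1 + 1 = J + 1 by omega]
    have hα (j : ℕ) : α * β ^ (j + 1) * l = α * β ^ j * (β * l) := by ring
    by_cases h1 : i + 1 + 2 ≤ J + 1
    · simp only [if_pos h1]
      -- For the rhombus the symmetry is not the one in the assigned axis `u_{5/2}` but the one in
      -- the perpendicular diagonal `u_{9/2}`; it commutes with the former.
      refine ⟨9, trivial, trivial, T_mul_R_eq_conj ?_ ?_, U2_image_Q3' _, rfl⟩
      · simp [Complex.ext_iff, hα]
      · rw [ite_even_add_one]
        split_ifs <;> rfl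
    by_cases h2 : i + 1 + 1 = J + 1
    · simp only [if_neg h1, if_pos h2]
      refine ⟨1, ?_, trivial, T_mul_R_eq_conj ?_ ?_, U2_image_Q8 _ _, rfl⟩
      · simp only [show J + 2 - 1 = J + 1 by omega, Nat.add_sub_cancel, hα]
      · refine Complex.ext ?_ ?_ <;>
          simp only [show J + 2 - 1 = J + 1 by omega, Nat.add_sub_cancel, Complex.conj_re,
            Complex.conj_im, pow_succ] <;> ring
      · rw [ite_even_add_one]
        split_ifs <;> rfl
    · simp only [if_neg h1, if_neg h2]
      refine ⟨7, ?_, trivial, T_mul_R_eq_conj ?_ ?_, U2_image_Q7 _, rfl⟩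
      · simp only [show J + 2 - 1 = J + 1 by omega, Nat.add_sub_cancel, hα]
      · refine Complex.ext ?_ ?_ <;>
          simp only [show J + 2 - 1 = J + 1 by omega, Nat.add_sub_cancel, Complex.conj_re,
            Complex.conj_im, pow_succ] <;> ring
      · rw [ite_even_add_one]
        split_ifs <;> rfl

/-- The self-similarity behind the theorem: apart from its first four atoms, the shorter pencil is
the reflected tail of the longer one. The signs are arbitrary, because `ν` only enters through
`P_0`. -/
theorem piece_shift (ν ν' : ℤˣ) (M : ℕ) (l h : ℝ) {j : ℕ} (hj : 4 ≤ j) :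
    (piece ν (M + 5) l h (j + 2)).IsConj (piece ν' (M + 4) (β * l) h j) := by
  obtain ⟨k, rfl⟩ := Nat.exists_eq_add_of_le' hj
  -- For `j = 4` the rhombus of the shorter pencil precedes its strip, whereas in the longer pencil
  -- it is the strip tile `S_2`; all other tiles are matched inside the strips.
  rcases k with _ | k
  · have : piece ν (M + 5) l h 6 =
        ⟨Q3 h, 5, U0 * (T ⟨-(α * β * (β * l)), 0⟩ * R 7)⟩ := by
      have h3 : ¬ Odd 2 := by decide
      simp [piece, strip, stripEven, h3]
    refine Piece.isConj_of_place (W := 1) ?_ ?_ ?_ ?_ ?_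
    · rw [this]; rfl
    · rw [this]; rfl
    · rw [this]; rfl
    · simp
    · simp
  · obtain ⟨b, hs, ha, hp, hb, hba⟩ := strip_shift (M + 1) (β * l) h k
    refine Piece.isConj_of_place (W := U2 b) hs ha ?_ hb (U2_mul_U2_mul_inv hba)
    change U0 * (strip (M + 3) (β * l) h (k + 3)).place = _
    rw [hp]
    simp only [mul_assoc]; rfl

/-! ### Consequences of tilings up to null sets -/

theorem volume_image_eq_zero (g : Isom) {A : Set ℂ} (hA : volume A = 0) : volume (g '' A) = 0 := by
  refine addHaar_image_eq_zero_of_differentiableOn_of_addHaar_eq_zero volume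
    (Differentiable.differentiableOn ?_) hA
  have : (g : ℂ → ℂ) = fun z => g.linearIsometryEquiv z + g 0 := by
    ext z
    simpa using g.map_vadd 0 z
  rw [this]
  exact g.linearIsometryEquiv.differentiable.add_const _

theorem ae_comp_isom (g : Isom) {p : ℂ → Prop} (h : ∀ᵐ z, p z) : ∀ᵐ z, p (g z) := by
  rw [ae_iff] at h ⊢
  refine measure_mono_null ?_ (volume_image_eq_zero g⁻¹ h)
  intro z hz
  exact ⟨g z, hz, g.symm_apply_apply z⟩

/-- Nonempty open sets have positive measure. All passages from almost everywhere to everywhere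
reduce to this. -/
theorem eq_empty_of_ae_notMem {U : Set ℂ} (hU : IsOpen U) (h : ∀ᵐ z, z ∉ U) : U = ∅ := by
  rw [ae_iff] at h
  simp only [not_not] at h
  exact hU.eq_empty_of_measure_zero h

theorem disjoint_of_ae {U V : Set ℂ} (hU : IsOpen U) (hV : IsOpen V)
    (h : ∀ᵐ z, ind U z + ind V z ≤ 1) : Disjoint U V := by
  rw [Set.disjoint_iff_inter_eq_empty]
  refine eq_empty_of_ae_notMem (hU.inter hV) (h.mono ?_)
  rintro z hz ⟨h1, h2⟩
  rw [ind_of_mem h1, ind_of_mem h2] at hz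
  omega

theorem subset_closure_of_ae {U A : Set ℂ} (hU : IsOpen U)
    (h : ∀ᵐ z, z ∈ U → z ∈ A) : U ⊆ closure A := by
  rw [← Set.sdiff_eq_empty]
  refine eq_empty_of_ae_notMem (hU.sdiff isClosed_closure) (h.mono ?_)
  rintro z hz ⟨h1, h2⟩
  exact h2 (subset_closure (hz h1))

theorem interior_closure_octPolygon {es : List (ℤ × ℝ)} (h : (octPolygon es).Nonempty) :
    interior (closure (octPolygon es)) = octPolygon es := by
  have ho := isOpen_octPolygon es
  rw [(convex_octPolygon es).interior_closure_eq_interior_of_nonempty_interior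
    (by rwa [ho.interior_eq]), ho.interior_eq]

/-- An open set contained in the polygon up to a null set lies in its closure, and a nonempty open
convex set is the interior of its closure. -/
theorem subset_octPolygon_of_ae {U : Set ℂ} {es : List (ℤ × ℝ)} (hU : IsOpen U)
    (h : ∀ᵐ z, z ∈ U → z ∈ octPolygon es) : U ⊆ octPolygon es := by
  rcases (octPolygon es).eq_empty_or_nonempty with he | hne
  · have := subset_closure_of_ae hU h
    rw [he, closure_empty] at this
    exact this.trans (Set.empty_subset _)
  · rw [← interior_closure_octPolygon hne]
    exact interior_maximal (subset_closure_of_ae hU h) hU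

/-! ### The pentagon -/

theorem coord_mk (x y : ℝ) : coord 0 ⟨x, y⟩ = x ∧ coord 2 ⟨x, y⟩ = y ∧
    α * coord 1 ⟨x, y⟩ = x + y ∧ α * coord 3 ⟨x, y⟩ = y - x := by
  have := coord_relations ⟨x, y⟩
  refine ⟨coord_zero _, coord_two _, coord_one _, ?_⟩
  rw [← this.2.2.2.2.2.2.1, coord_zero, coord_two]

theorem pentagon_eq_octPolygon (l h : ℝ) : ∃ es, pentagon l h = octPolygon es :=
  image_octPolygon (inGroup_T _) _

theorem nonempty_Q6 {x y : ℝ} (hx : 0 < x) (hy : 0 < y) : (Q6 x y).Nonempty := by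
  refine ⟨⟨x / 2, 0⟩, ?_⟩
  obtain ⟨c0, c2, c1, c3⟩ := coord_mk (x / 2) 0
  obtain ⟨-, e5, e6, -⟩ := coord_relations ⟨x / 2, 0⟩
  simp only [Q6, mem_octPolygon, List.forall_mem_cons, List.not_mem_nil, e5, e6, c0, c2]
  have hα := α_pos
  refine ⟨?_, ?_, ?_, ?_, ?_, fun _ h => h.elim⟩ <;>
    first | linarith | exact lt_of_α_mul_lt (by linarith)

theorem isBounded_Q6 (x y : ℝ) : Bornology.IsBounded (Q6 x y) := by
  refine (Metric.isBounded_closedBall (x := (0 : ℂ)) (r := x + y)).subset fun z hz => ?_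
  obtain ⟨e4, e5, e6, e7, r1, r2, r3, r0⟩ := coord_relations z
  simp only [Q6, mem_octPolygon, List.forall_mem_cons, e5, e6] at hz
  obtain ⟨h5, h6, h0, h2, h3, -⟩ := hz
  rw [mem_closedBall_zero_iff]
  refine (Complex.norm_le_abs_re_add_abs_im z).trans ?_
  rw [← coord_zero, ← coord_two]
  have : 0 < coord 0 z := lt_of_α_mul_lt (by linarith)
  exact add_le_add (abs_le.2 ⟨by linarith, h0.le⟩) (abs_le.2 ⟨by linarith, h2.le⟩)

theorem isBounded_image (g : Isom) {A : Set ℂ} (hA : Bornology.IsBounded A) :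
    Bornology.IsBounded (g '' A) := g.isometry.lipschitz.isBounded_image hA

theorem isBounded_pentagon (l h : ℝ) : Bornology.IsBounded (pentagon l h) :=
  isBounded_image _ (isBounded_Q6 _ _)

theorem β_lt_one : β < 1 := by have := α_sq; have := α_pos; rw [β_eq]; nlinarith

theorem nonempty_pentagon {l h : ℝ} (hh : 0 < h) (hlh : h ≤ l) : (pentagon l h).Nonempty := by
  refine (nonempty_Q6 ?_ hh).image _
  have := β_lt_one
  have := one_lt_α
  nlinarith

/-! ### The tiling of the pentagon by the atoms of the pencil -/

section step

variable {s t l h : ℝ}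

theorem exists_minimal_parameters (hlo : β ^ 3 * l ≤ h) (hhi : h ≤ β ^ 2 * l) : ∃ s t : ℝ,
    0 ≤ s ∧ 0 ≤ t ∧ l = Minimal.l.eval s t ∧ h = Minimal.h.eval s t := by
  have hα := α_sq
  have hp := α_pos
  have hd : (4 + 3 * α) ≠ 0 := by positivity
  have e2 : β ^ 2 = 3 - 2 * α := by rw [β_eq]; linear_combination hα
  have e3 : β ^ 3 = 5 * α - 7 := by rw [β_eq]; linear_combination (α - 3) * hα
  have k3 : (7 + 5 * α) * (5 * α - 7) = 1 := by linear_combination 25 * hα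
  have k2 : (3 + 2 * α) * (3 - 2 * α) = 1 := by linear_combination (-4) * hα
  rw [e3] at hlo
  rw [e2] at hhi
  -- The solution of `l = ω² s + ω³ t`, `h = s + t`, with determinant `ω³ - ω² = 4 + 3√2`. The signs
  -- of `s` and `t` are exactly the two hypotheses; `t = 0` is the degenerate case.
  refine ⟨((7 + 5 * α) * h - l) / (4 + 3 * α), (l - (3 + 2 * α) * h) / (4 + 3 * α), ?_, ?_, ?_, ?_⟩
  · refine div_nonneg ?_ (by positivity)
    have := mul_le_mul_of_nonneg_left hlo (by positivity : 0 ≤ 7 + 5 * α)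
    rw [← mul_assoc, k3] at this
    linarith
  · refine div_nonneg ?_ (by positivity)
    have := mul_le_mul_of_nonneg_left hhi (by positivity : 0 ≤ 3 + 2 * α)
    rw [← mul_assoc, k2] at this
    linarith
  · simp only [Minimal.l, RealForm.eval]
    field_simp
    push_cast
    ring
  · simp only [Minimal.h, RealForm.eval]
    field_simp
    push_cast
    ring

theorem exists_step_parameters (hh : 0 ≤ h) (hhi : h ≤ β ^ 3 * l) : ∃ s t : ℝ,
    0 ≤ s ∧ 0 ≤ t ∧ l = Step.l.eval s t ∧ h = Step.h.eval s t := by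
  have e3 : β ^ 3 = 5 * α - 7 := by rw [β_eq]; linear_combination (α - 3) * α_sq
  -- Only the upper bound on `h` enters, so the same cone serves every pencil with at least eleven
  -- atoms.
  refine ⟨h, β ^ 3 * l - h, hh, by linarith, ?_, ?_⟩
  · simp only [Step.l, RealForm.eval]
    rw [e3]
    push_cast
    linear_combination (-25) * l * α_sq
  · simp [Step.h, RealForm.eval]

variable (hs : 0 ≤ s) (ht : 0 ≤ t)
include hs ht

open FormalPiece in
theorem sum_minimal (hl : l = Minimal.l.eval s t) (hh : h = Minimal.h.eval s t) (ν : ℤˣ) :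
    ∀ᵐ z, ∑ i ∈ Finset.range 9, ind (piece ν 4 l h i).tile z = ind (pentagon l h) z := by
  filter_upwards [CutTree.check_sound hs ht Minimal.tree_check] with z hz
  rw [pentagon_eq hl hh, hz]
  simp only [Finset.sum_range_succ, Finset.sum_range_zero, piece0_tile_eq hh,
    (realizes_piece1 hl hh ν 4).tile, (realizes_piece2 hl hh ν 4).tile,
    (realizes_piece3 hl hh ν 4).tile, (realizes_piece4 hl hh ν 4).tile,
    (realizes_minimal5 hl hh ν).tile, (realizes_minimal6 hl hh ν).tile,
    (realizes_minimal7 hl hh ν).tile, (realizes_minimal8 hl hh ν).tile]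
  simp only [Minimal.tree, CutTree.along, CutTree.leaves, List.map_append, List.map_cons,
    List.map_nil, List.sum_append, List.sum_cons, List.sum_nil]
  ring

variable (hl : l = Step.l.eval s t) (hh : h = Step.h.eval s t)

theorem pentagon_tiling : ∀ᵐ z, ind ((formalPentagon Step.l Step.h).set s t) z =
    ind (Step.shorter.set s t) z + ind (Step.kite4.set s t) z + ind (Step.triangle3.set s t) z +
    ind (Step.P1.tile.set s t) z + ind (Step.P2.tile.set s t) z + ind (Step.P3.tile.set s t) z +
    ind (Step.P4.tile.set s t) z := by
  filter_upwards [CutTree.check_sound hs ht Step.tree_check] with z hz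
  rw [hz]
  simp only [Step.tree, CutTree.along, CutTree.leaves, List.map_append, List.map_cons,
    List.map_nil, List.sum_append, List.sum_cons, List.sum_nil]
  ring

theorem rhombus_tiling : ∀ᵐ z, ind (Step.P4.tile.set s t) z =
    ind (Step.octagon.set s t) z + ind (Step.kite1.set s t) z + ind (Step.kite3.set s t) z +
    ind (Step.triangle1.set s t) z + ind (Step.triangle2.set s t) z +
    ind (Step.periodic1.set s t) z + ind (Step.periodic2.set s t) z := by
  filter_upwards [CutTree.check_sound hs ht Step.rhombusTree_check] with z hz
  rw [hz]
  simp only [Step.rhombusTree, CutTree.along, CutTree.leaves, List.map_append, List.map_cons,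
    List.map_nil, List.sum_append, List.sum_cons, List.sum_nil]
  ring

theorem trapezium_tiling : ∀ᵐ z, ind (Step.P5.tile.set s t) z =
    ind (Step.Y1.tile.set s t) z + ind (Step.kite0.set s t) z + ind (Step.triangle0.set s t) z +
    ind (Step.kite4.set s t) z + ind (Step.triangle3.set s t) z := by
  filter_upwards [CutTree.check_sound hs ht Step.trapeziumTree_check] with z hz
  rw [hz]
  simp only [Step.trapeziumTree, CutTree.along, CutTree.leaves, List.map_append, List.map_cons,
    List.map_nil, List.sum_append, List.sum_cons, List.sum_nil]
  ring

omit hs ht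

theorem FormalPiece.Realizes.conj_tile {q : FormalPiece} {p : Piece} (h : q.Realizes s t p) :
    U0 '' p.tile = q.conj.tile.set s t := by
  rw [← h.conj.tile, Piece.tile, Piece.tile, AffineIsometryEquiv.coe_mul, Set.image_comp]

theorem U0_image_piece0 (ν : ℤˣ) (L : ℕ) (l h : ℝ) :
    U0 '' (piece ν L l h 0).tile = (piece ν L l h 0).tile := by
  have : (piece ν L l h 0).tile = Q2 h := by simp [piece, Piece.tile]
  rw [this]
  exact U2_image_octPolygon (by simp)

theorem shorter_parameter (hl : l = Step.l.eval s t) : β * l = Step.l.mulβ.eval s t := by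
  rw [RealForm.eval_mulβ, hl]

include hs ht hl hh

/-- The tiles of a pencil, in terms of those of the shortened pencil. -/
theorem sum_step (ν ν' : ℤˣ) (M : ℕ)
    (ih : ∀ᵐ z, ∑ i ∈ Finset.range (2 * (M + 4) + 1), ind (piece ν' (M + 4) (β * l) h i).tile z =
      ind (pentagon (β * l) h) z) :
    ∀ᵐ z, ∑ i ∈ Finset.range (2 * (M + 5) + 1), ind (piece ν (M + 5) l h i).tile z =
      ind (pentagon l h) z := by
  have hl' := shorter_parameter hl
  filter_upwards [pentagon_tiling hs ht, trapezium_tiling hs ht, ae_comp_isom U0⁻¹ ih]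
    with z hz1 hz2 hz3
  simp only [← ind_image] at hz3
  rw [U0_image_pentagon, pentagon_eq hl' hh, show 2 * (M + 4) + 1 = 4 + (2 * M + 5) by ring,
    Finset.sum_range_add] at hz3
  have e : 2 * (M + 5) + 1 = 6 + (2 * M + 5) := by ring
  rw [e, Finset.sum_range_add, pentagon_eq hl hh, hz1]
  have shift : ∀ k, (piece ν (M + 5) l h (6 + k)).tile =
      U0 '' (piece ν' (M + 4) (β * l) h (4 + k)).tile := fun k => by
    rw [← (piece_shift ν ν' M l h (by omega : 4 ≤ 4 + k)).tile]; congr 2; omega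
  simp only [shift]
  simp only [Finset.sum_range_succ, Finset.sum_range_zero] at hz3 ⊢
  rw [U0_image_piece0, (realizes_piece1 hl' hh ν' _).conj_tile,
    (realizes_piece2 hl' hh ν' _).conj_tile, (realizes_piece3 hl' hh ν' _).conj_tile,
    piece0_tile_eq hh] at hz3
  rw [piece0_tile_eq hh, (realizes_piece1 hl hh ν _).tile, (realizes_piece2 hl hh ν _).tile,
    (realizes_piece3 hl hh ν _).tile, (realizes_piece4 hl hh ν _).tile,
    (realizes_trapezium hl hh ν _).tile]
  change _ = ind (Step.shorter.set s t) z at hz3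
  simp only [Step.P1, Step.P2, Step.P3, Step.P4, Step.P5, Step.kite0, Step.triangle0, Step.Y1,
    Step.Y2, Step.Y3] at hz1 hz2 hz3 ⊢
  -- The pentagon is the shortened pentagon plus `kite4`, `triangle3` and `P_1, …, P_4`. In the
  -- tiling of the shortened pentagon, `Y_1`, `kite0` and `triangle0` are exchanged, together with
  -- `kite4` and `triangle3`, for the trapezium `P_5`.
  omega

end step

theorem β_pow_le {l : ℝ} (hl : 0 < l) {m n : ℕ} (h : m ≤ n) : β ^ n * l ≤ β ^ m * l :=
  mul_le_mul_of_nonneg_right (pow_le_pow_of_le_one β_pos.le β_lt_one.le h) hl.le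

/-- Induction on the number of atoms: the bounds on `h` are unchanged when `l` is replaced by `β *
l` and the exponent drops by one. The nine-atom case is a certificate. -/
theorem pencil_tiling {M : ℕ} {l h : ℝ} (ν : ℤˣ) (hl : 0 < l) (hlo : β ^ (M + 3) * l ≤ h)
    (hhi : h ≤ β ^ (M + 2) * l) :
    ∀ᵐ z, ∑ i ∈ Finset.range (2 * (M + 4) + 1), ind (piece ν (M + 4) l h i).tile z =
      ind (pentagon l h) z := by
  induction M generalizing l ν with
  | zero =>
    obtain ⟨s, t, hs, ht, el, eh⟩ := exists_minimal_parameters hlo hhi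
    exact sum_minimal hs ht el eh ν
  | succ M ih =>
    have hh : 0 ≤ h := le_trans (by have := β_pos; positivity) hlo
    obtain ⟨s, t, hs, ht, el, eh⟩ :=
      exists_step_parameters hh (hhi.trans (β_pow_le hl (by omega : 3 ≤ M + 1 + 2)))
    refine sum_step hs ht el eh ν ν M (ih ν (mul_pos β_pos hl) ?_ ?_)
    · rw [← mul_assoc, ← pow_succ]; exact hlo
    · rw [← mul_assoc, ← pow_succ]; exact hhi

/-! ### Nonempty shapes -/

theorem nonempty_Q1 {x : ℝ} : (Q1 x).Nonempty ↔ 0 < x := by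
  constructor
  · rintro ⟨z, hz⟩
    obtain ⟨e4, e5, e6, e7, r1, r2, r3, r0⟩ := coord_relations z
    simp only [Q1, mem_octPolygon, List.forall_mem_cons, e6] at hz
    obtain ⟨h6, h1, h3, -⟩ := hz
    have : coord 2 z < 0 := lt_of_α_mul_lt (by linarith)
    linarith
  · intro hx
    refine ⟨⟨0, -(x / 2)⟩, ?_⟩
    obtain ⟨c0, c2, c1, c3⟩ := coord_mk 0 (-(x / 2))
    obtain ⟨-, -, e6, -⟩ := coord_relations ⟨0, -(x / 2)⟩
    simp only [Q1, mem_octPolygon, List.forall_mem_cons, List.not_mem_nil, e6, c2]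
    refine ⟨?_, ?_, ?_, fun _ h => h.elim⟩ <;>
      first | linarith | exact lt_of_α_mul_lt (by linarith)

theorem nonempty_Q2 {x : ℝ} (hx : 0 < x) : (Q2 x).Nonempty := by
  refine ⟨0, ?_⟩
  simp [Q2, mem_octPolygon, coord, hx]

theorem nonempty_Q3 {x : ℝ} (hx : 0 < x) : (Q3 x).Nonempty := by
  refine ⟨0, ?_⟩
  simp [Q3, mem_octPolygon, coord, hx]

theorem nonempty_Q4 {x y : ℝ} (hxy : y < x) (h : 0 < x + y) : (Q4 x y).Nonempty := by
  refine ⟨⟨0, -((x + y) / 2)⟩, ?_⟩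
  obtain ⟨c0, c2, c1, c3⟩ := coord_mk 0 (-((x + y) / 2))
  obtain ⟨-, -, e6, -⟩ := coord_relations ⟨0, -((x + y) / 2)⟩
  simp only [Q4, mem_octPolygon, List.forall_mem_cons, List.not_mem_nil, e6, c2]
  refine ⟨?_, ?_, ?_, ?_, fun _ h => h.elim⟩ <;>
    first | linarith | exact lt_of_α_mul_lt (by linarith)

theorem nonempty_Q7 {x : ℝ} : (Q7 x).Nonempty ↔ 0 < x := by
  have hα : α * (α * x) = 2 * x := by rw [← mul_assoc, α_sq]
  constructor
  · rintro ⟨z, hz⟩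
    obtain ⟨e4, e5, e6, e7, r1, r2, r3, r0⟩ := coord_relations z
    simp only [Q7, mem_octPolygon, List.forall_mem_cons, e5] at hz
    obtain ⟨h5, h7, h0, h2, -⟩ := hz
    have := mul_pos α_pos (neg_lt_zero.1 h5)
    linarith
  · intro hx
    refine ⟨⟨x / 2, -(x / 4)⟩, ?_⟩
    obtain ⟨c0, c2, c1, c3⟩ := coord_mk (x / 2) (-(x / 4))
    obtain ⟨-, e5, -, e7, -⟩ := coord_relations ⟨x / 2, -(x / 4)⟩
    simp only [Q7, mem_octPolygon, List.forall_mem_cons, List.not_mem_nil, e5, e7, c0, c2]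
    have : 1 * x < α * x := mul_lt_mul_of_pos_right one_lt_α hx
    refine ⟨?_, ?_, ?_, ?_, fun _ h => h.elim⟩ <;>
      first | linarith | exact lt_of_α_mul_lt (by linarith)

theorem nonempty_Q8 {x y : ℝ} (hx : 0 < x) (hy : 0 < y) : (Q8 x y).Nonempty := by
  have h1 : 0 < min x y / 2 := by positivity
  have h2 : min x y / 2 < x := by linarith [min_le_left x y]
  have h3 : min x y / 2 < y := by linarith [min_le_right x y]
  generalize min x y / 2 = a at h1 h2 h3
  refine ⟨⟨a, 0⟩, ?_⟩
  obtain ⟨c0, c2, c1, c3⟩ := coord_mk a 0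
  obtain ⟨e4, e5, e6, e7, -⟩ := coord_relations ⟨a, 0⟩
  simp only [Q8, mem_octPolygon, List.forall_mem_cons, List.not_mem_nil, e4, e5, e7, c0, c2]
  have := one_lt_α
  refine ⟨?_, ?_, ?_, ?_, ?_, ?_, fun _ h => h.elim⟩ <;>
    first | linarith | exact lt_of_α_mul_lt (by nlinarith)

theorem nonempty_Q9 {x y : ℝ} (hx : 0 < x) (hy : 0 < y) : (Q9 x y).Nonempty := by
  refine ⟨0, ?_⟩
  simp [Q9, mem_octPolygon, coord, hx, hy]

theorem Piece.tile_nonempty {p : Piece} : p.tile.Nonempty ↔ p.shape.Nonempty :=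
  Set.image_nonempty

theorem β_lt_half : β < 1 / 2 := by
  have := α_sq; have := α_pos; rw [β_eq]; nlinarith

theorem pos_of_le_pow {l h : ℝ} {n : ℕ} (hl : 0 < l) (hlo : β ^ n * l ≤ h) : 0 < h :=
  lt_of_lt_of_le (mul_pos (pow_pos β_pos _) hl) hlo

section nonempty

variable {l h : ℝ} (ν : ℤˣ) (hl : 0 < l) (hh : 0 < h)
include hl hh

theorem piece_nonempty {L i : ℕ} (hhi : h ≤ β ^ 2 * l) (hi : i < 5) :
    (piece ν L l h i).tile.Nonempty := by
  rw [Piece.tile_nonempty]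
  have hβ := β_pos
  have hα := α_pos
  interval_cases i
  · exact nonempty_Q2 hh
  · refine nonempty_Q9 ?_ hh
    rw [sub_pos, lt_div_iff₀ hα]
    -- With `h ≤ β² l` this gives `√2 h < β l`, which makes the first parameter of the hexagon
    -- positive.
    have : β * α < 1 := by rw [β_eq]; have := α_sq; have := β_lt_half; rw [β_eq] at this; nlinarith
    have h2 : β ^ 2 * l * α = β * α * (β * l) := by ring
    calc h * α ≤ β ^ 2 * l * α := by gcongr
      _ < 1 * (β * l) := by rw [h2]; gcongr
      _ = β * l := one_mul _
  · exact nonempty_Q7.2 (by positivity)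
  · exact nonempty_Q1.2 (by positivity)
  · exact nonempty_Q3 hh

/-- The parameters of the last two shapes are `β (β² l - h)` and `√2 (β² l - h)`, so both vanish
precisely in the limiting case. -/
theorem minimal_nonempty_iff (hhi : h ≤ β ^ 2 * l) {i : ℕ} (hi : i < 9) :
    (piece ν 4 l h i).tile.Nonempty ↔ h < β ^ 2 * l ∨ i < 7 := by
  have hβ := β_pos
  have hα := α_pos
  have hβ1 := β_lt_half
  rcases lt_or_ge i 5 with h5 | h5
  · exact iff_of_true (piece_nonempty ν hl hh hhi h5) (.inr (by omega))
  rw [Piece.tile_nonempty]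
  interval_cases i
  · refine iff_of_true ?_ (.inr (by omega))
    have : (piece ν 4 l h 5).shape = Q1 (β ^ 1 * (β * l) - β * h) := by
      simp [piece, strip, stripOdd]
    rw [this]
    refine nonempty_Q1.2 ?_
    have : β * h < 1 * h := by gcongr; linarith
    linarith [show β ^ 1 * (β * l) = β ^ 2 * l by ring]
  · refine iff_of_true ?_ (.inr (by omega))
    have : (piece ν 4 l h 6).shape = Q8 (α * β ^ 1 * (β * l) - α * β * h) (2 * h) := by
      have h3 : ¬ Odd 2 := by decide
      simp [piece, strip, stripEven, h3]
    rw [this]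
    refine nonempty_Q8 ?_ (by positivity)
    have : β * h < 1 * h := by gcongr; linarith
    have : 0 < α * (β ^ 2 * l - β * h) := mul_pos hα (by linarith)
    linarith [show α * (β ^ 2 * l - β * h) = α * β ^ 1 * (β * l) - α * β * h by ring]
  · have : (piece ν 4 l h 7).shape = Q1 (β ^ 2 * (β * l) - β * h) := by
      have h3 : Odd 3 := by decide
      simp [piece, strip, stripOdd, h3]
    rw [this, nonempty_Q1, show β ^ 2 * (β * l) - β * h = β * (β ^ 2 * l - h) by ring,
      mul_pos_iff_of_pos_left hβ, sub_pos]
    simp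
  · have : (piece ν 4 l h 8).shape = Q7 (α * β ^ 1 * (β * l) - α * h) := by
      have h3 : ¬ Odd 4 := by decide
      simp [piece, strip, stripEven, h3]
    rw [this, nonempty_Q7, show α * β ^ 1 * (β * l) - α * h = α * (β ^ 2 * l - h) by ring,
      mul_pos_iff_of_pos_left hα, sub_pos]
    simp

omit hl in
theorem trapezium_nonempty (M : ℕ) (hhi : h ≤ β ^ 3 * l) :
    (piece ν (M + 5) l h 5).tile.Nonempty := by
  have : (piece ν (M + 5) l h 5).shape =
      Q4 (β ^ 1 * (β * l) - β * h) (β ^ 1 * (β * l) - ω * h) := by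
    simp [piece, strip, stripOdd]
  rw [Piece.tile_nonempty, this]
  have hβ := β_pos
  have hβ1 := β_lt_half
  have hω : 1 < ω := by rw [ω_eq]; linarith [α_pos]
  have h1 : β * h < ω * h := by gcongr; linarith
  have h2 : ω * h ≤ ω * (β ^ 3 * l) := by gcongr
  have h3 : ω * (β ^ 3 * l) = β ^ 1 * (β * l) := by linear_combination β ^ 2 * l * β_mul_ω
  exact nonempty_Q4 (by linarith) (by linarith)

end nonempty

theorem tile_nonempty_iff {M : ℕ} {l h : ℝ} (ν : ℤˣ) (hl : 0 < l) (hlo : β ^ (M + 3) * l ≤ h)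
    (hhi : h ≤ β ^ (M + 2) * l) {i : ℕ} (hi : i < 2 * (M + 4) + 1) :
    (piece ν (M + 4) l h i).tile.Nonempty ↔ h < β ^ (M + 2) * l ∨ i < 2 * (M + 4) - 1 := by
  induction M generalizing l i with
  | zero => exact minimal_nonempty_iff ν hl (pos_of_le_pow hl hlo) hhi hi
  | succ M ih =>
    have hh := pos_of_le_pow hl hlo
    rcases lt_or_ge i 5 with h5 | h5
    · exact iff_of_true (piece_nonempty ν hl hh (hhi.trans (β_pow_le hl (by omega))) h5)
        (.inr (by omega))
    rcases h5.eq_or_lt with rfl | h6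
    · exact iff_of_true (trapezium_nonempty ν hh M (hhi.trans (β_pow_le hl (by omega))))
        (.inr (by omega))
    obtain ⟨j, rfl⟩ := Nat.exists_eq_add_of_le' (by omega : 2 ≤ i)
    rw [show M + 1 + 4 = M + 5 by ring, (piece_shift ν ν M l h (by omega : 4 ≤ j)).tile,
      Set.image_nonempty, ih (mul_pos β_pos hl) (by rwa [← mul_assoc, ← pow_succ])
        (by rwa [← mul_assoc, ← pow_succ]) (by omega), ← mul_assoc, ← pow_succ,
      show M + 1 + 2 = M + 2 + 1 by ring]
    exact or_congr Iff.rfl (by omega)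

/-! ### The pencil is a dressed domain -/

theorem isOpen_tile (ν : ℤˣ) (L : ℕ) (l h : ℝ) (i : ℕ) : IsOpen (piece ν L l h i).tile := by
  obtain ⟨es, hes⟩ := (piece_regular ν L l h i).tile_eq
  rw [hes]
  exact isOpen_octPolygon es

section dressed

variable {M : ℕ} {l h : ℝ} (ν : ℤˣ) (hl : 0 < l) (hlo : β ^ (M + 3) * l ≤ h)
  (hhi : h ≤ β ^ (M + 2) * l)
include hl hlo hhi

theorem tile_subset_pentagon {i : ℕ} (hi : i < 2 * (M + 4) + 1) :
    (piece ν (M + 4) l h i).tile ⊆ pentagon l h := by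
  obtain ⟨es, hes⟩ := pentagon_eq_octPolygon l h
  rw [hes]
  refine subset_octPolygon_of_ae (isOpen_tile _ _ _ _ _) ?_
  filter_upwards [pencil_tiling ν hl hlo hhi] with z hz hzi
  rw [← hes, ← ind_pos, ← hz]
  exact Finset.sum_pos' (fun _ _ => Nat.zero_le _)
    ⟨i, Finset.mem_range.2 hi, ind_pos.2 hzi⟩

theorem tile_disjoint {i j : ℕ} (hi : i < 2 * (M + 4) + 1) (hj : j < 2 * (M + 4) + 1)
    (hij : i ≠ j) : Disjoint (piece ν (M + 4) l h i).tile (piece ν (M + 4) l h j).tile := by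
  refine disjoint_of_ae (isOpen_tile _ _ _ _ _) (isOpen_tile _ _ _ _ _) ?_
  filter_upwards [pencil_tiling ν hl hlo hhi] with z hz
  have h1 := ind_le_one (pentagon l h) z
  rw [← hz] at h1
  refine le_trans ?_ h1
  rw [← Finset.sum_pair hij (f := fun i => ind (piece ν (M + 4) l h i).tile z)]
  refine Finset.sum_le_sum_of_subset fun k hk => ?_
  simp only [Finset.mem_insert, Finset.mem_singleton] at hk
  rcases hk with rfl | rfl
  exacts [Finset.mem_range.2 hi, Finset.mem_range.2 hj]

omit hlo in
theorem le_of_parameters : h ≤ l := by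
  have := β_pow_le hl (Nat.zero_le (M + 2))
  simp at this
  linarith

/-- The union of the atoms lies in the pentagon and is dense in it, so both have the same closure,
whose interior is the pentagon by convexity. -/
theorem domain_pencil : (pencil ν (M + 4) l h).domain = pentagon l h := by
  have hne := nonempty_pentagon (pos_of_le_pow hl hlo) (le_of_parameters hl hhi)
  obtain ⟨es, hes⟩ := pentagon_eq_octPolygon l h
  rw [hes] at hne
  have h1 : (⋃ i, (pencil ν (M + 4) l h).atom i) ⊆ pentagon l h :=
    Set.iUnion_subset fun i => tile_subset_pentagon ν hl hlo hhi i.2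
  have h2 : pentagon l h ⊆ closure (⋃ i, (pencil ν (M + 4) l h).atom i) := by
    refine subset_closure_of_ae (hes ▸ isOpen_octPolygon es) ?_
    filter_upwards [pencil_tiling ν hl hlo hhi] with z hz hzP
    by_contra hcon
    rw [ind_of_mem hzP, Finset.sum_eq_zero] at hz
    · exact absurd hz (by norm_num)
    · intro i hi
      exact ind_of_notMem fun hzi => hcon (Set.mem_iUnion.2 ⟨⟨i, Finset.mem_range.1 hi⟩, hzi⟩)
  rw [DressedDomain.domain, (closure_mono h1).antisymm (closure_minimal h2 isClosed_closure), hes,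
    interior_closure_octPolygon hne]

theorem isDressed_pencil : (pencil ν (M + 4) l h).IsDressed where
  tile i := by
    rcases Set.eq_empty_or_nonempty ((pencil ν (M + 4) l h).atom i) with he | hne
    · exact .inl he
    · exact .inr ⟨hne, (isBounded_pentagon l h).subset (tile_subset_pentagon ν hl hlo hhi i.2),
        (piece_regular ν (M + 4) l h i).tile_eq⟩
  disjoint i j hij := tile_disjoint ν hl hlo hhi i.2 j.2 (Fin.val_injective.ne hij)
  inGroup i := (inGroup_U2 0).mul (piece_regular ν (M + 4) l h i).place.refl
  orientation i := by
    change parity (U0 * _) = 1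
    rw [parity_mul, parity_U0, parity_refl]; norm_num
  maps i := by
    -- Each atom is preserved by its own reflection, and the pentagon by `U_0`; hence the image of
    -- an atom stays in the pentagon.
    rw [domain_pencil ν hl hlo hhi, ← U0_image_pentagon]
    change (U0 * (piece ν (M + 4) l h i).refl) '' (piece ν (M + 4) l h i).tile ⊆ _
    rw [AffineIsometryEquiv.coe_mul, Set.image_comp,
      Piece.refl_image_tile (piece_regular ν (M + 4) l h i).symm]
    exact Set.image_mono (tile_subset_pentagon ν hl hlo hhi i.2)

end dressed

theorem IsTile.isOpen {A : Set ℂ} (hA : IsTile A) : IsOpen A := by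
  obtain ⟨-, -, es, rfl⟩ := hA
  exact isOpen_octPolygon es

theorem IsTile.image {A : Set ℂ} (hA : IsTile A) {g : Isom} (hg : InGroup g) :
    IsTile (g '' A) := by
  obtain ⟨h1, h2, es, rfl⟩ := hA
  exact ⟨h1.image _, isBounded_image g h2, image_octPolygon hg es⟩

namespace DressedDomain

/-! ### Orbits under the map of a dressed domain -/

variable {n m k : ℕ} {X : DressedDomain n} {Y : DressedDomain m} {Z : DressedDomain k}

theorem IsDressed.isOpen_atom (hX : X.IsDressed) (i : Fin n) : IsOpen (X.atom i) := by
  rcases hX.tile i with h | h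
  · rw [h]; exact isOpen_empty
  · exact h.isOpen

theorem IsDressed.atom_subset_domain (hX : X.IsDressed) (i : Fin n) : X.atom i ⊆ X.domain :=
  interior_maximal ((Set.subset_iUnion _ i).trans subset_closure) (hX.isOpen_atom i)

theorem IsDressed.eq_of_mem (hX : X.IsDressed) {i j : Fin n} {z : ℂ} (hi : z ∈ X.atom i)
    (hj : z ∈ X.atom j) : i = j := by
  by_contra h
  exact Set.disjoint_left.1 (hX.disjoint h) hi hj

theorem IsDressed.map_eq (hX : X.IsDressed) {i : Fin n} {z : ℂ} (hz : z ∈ X.atom i) :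
    X.map z = X.iso i z := by
  have h : ∃ i, z ∈ X.atom i := ⟨i, hz⟩
  rw [map, dif_pos h, hX.eq_of_mem h.choose_spec hz]

theorem map_eq_self {z : ℂ} (hz : ¬∃ i, z ∈ X.atom i) : X.map z = z := dif_neg hz

theorem volume_map_image (X : DressedDomain n) {N : Set ℂ} (hN : volume N = 0) :
    volume (X.map '' N) = 0 := by
  refine measure_mono_null (t := N ∪ ⋃ i, X.iso i '' N) ?_ ?_
  · rintro _ ⟨z, hz, rfl⟩
    rw [map]
    split_ifs with h
    · exact .inr (Set.mem_iUnion.2 ⟨h.choose, z, hz, rfl⟩)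
    · exact .inl hz
  · exact measure_union_null hN (measure_iUnion_null fun i => volume_image_eq_zero _ hN)

theorem volume_iterate_map_image (X : DressedDomain n) {N : Set ℂ} (hN : volume N = 0) (t : ℕ) :
    volume (X.map^[t] '' N) = 0 := by
  induction t with
  | zero => simpa using hN
  | succ t ih =>
    rw [Function.iterate_succ', Set.image_comp]
    exact X.volume_map_image ih

/-- The orbit of `x` visits the atoms listed in the given word. -/
def Follow (X : DressedDomain n) : List (Fin n) → ℂ → Prop
  | [], _ => True
  | i :: w, x => x ∈ X.atom i ∧ X.Follow w (X.map x)

theorem follow_cons {i : Fin n} {w : List (Fin n)} {x : ℂ} :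
    X.Follow (i :: w) x ↔ x ∈ X.atom i ∧ X.Follow w (X.map x) := Iff.rfl

theorem follow_append {v w : List (Fin n)} {x : ℂ} :
    X.Follow (v ++ w) x ↔ X.Follow v x ∧ X.Follow w (X.map^[v.length] x) := by
  induction v generalizing x with
  | nil => simp [Follow]
  | cons i v ih =>
    rw [List.cons_append, follow_cons, ih, follow_cons, and_assoc, List.length_cons,
      Function.iterate_succ_apply]

theorem Follow.mem_atom {w : List (Fin n)} {x : ℂ} (h : X.Follow w x) {t : ℕ}
    (ht : t < w.length) : X.map^[t] x ∈ X.atom w[t] := by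
  induction w generalizing x t with
  | nil => simp at ht
  | cons i w ih =>
    rcases t with _ | t
    · exact h.1
    · exact ih h.2 (by simpa using ht)

/-- The domain map need not be treated as globally injective: on points sharing a word it is a
composition of isometries. -/
theorem Follow.eq_of_iterate_eq (hX : X.IsDressed) {w : List (Fin n)} {x y : ℂ}
    (hx : X.Follow w x) (hy : X.Follow w y) {t : ℕ} (ht : t < w.length)
    (h : X.map^[t] x = X.map^[t] y) : x = y := by
  induction w generalizing x y t with
  | nil => simp at ht
  | cons i w ih =>
    rcases t with _ | t
    · exact h
    · have := ih hx.2 hy.2 (t := t) (by simpa using ht) h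
      rw [hX.map_eq hx.1, hX.map_eq hy.1] at this
      exact (X.iso i).injective this

theorem Follow.ncard_visits (hX : X.IsDressed) {w : List (Fin n)} {x : ℂ} (h : X.Follow w x)
    (i : Fin n) : {t : ℕ | t < w.length ∧ X.map^[t] x ∈ X.atom i}.ncard = w.count i := by
  induction w generalizing x with
  | nil => simp
  | cons j w ih =>
    have e : {t : ℕ | t < (j :: w).length ∧ X.map^[t] x ∈ X.atom i} =
        {t | t = 0 ∧ j = i} ∪
          Nat.succ '' {t : ℕ | t < w.length ∧ X.map^[t] (X.map x) ∈ X.atom i} := by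
      ext t
      rcases t with _ | t
      · have : x ∈ X.atom i ↔ j = i :=
          ⟨fun hi => hX.eq_of_mem h.1 hi, fun hi => hi ▸ h.1⟩
        simp [this]
      · simp
    have hf : {t : ℕ | t < w.length ∧ X.map^[t] (X.map x) ∈ X.atom i}.Finite :=
      (Set.finite_lt_nat w.length).subset fun t ht => ht.1
    rw [e, Set.ncard_union_eq ?_ ((Set.finite_singleton 0).subset fun t ht => ht.1) (hf.image _),
      Set.ncard_image_of_injective _ Nat.succ_injective, ih h.2, List.count_cons, add_comm]
    · congr 1
      by_cases hji : j = i
      · simp [hji]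
      · simp [hji]
    · rw [Set.disjoint_left]
      rintro _ ⟨rfl, -⟩ ⟨t, -, ht⟩
      exact Nat.succ_ne_zero t ht

/-! ### Subdomains with given return words -/

/-- The return orbit of the atom `j` of `Y` visits the atoms of `X` listed in `w j`. -/
structure Induces (X : DressedDomain n) (Y : DressedDomain m) (w : Fin m → List (Fin n)) :
    Prop where
  subset : Y.domain ⊆ X.domain
  ne_nil : ∀ j, w j ≠ []
  follow : ∀ j, ∀ x ∈ Y.atom j, X.Follow (w j) x
  return_eq : ∀ j, ∀ x ∈ Y.atom j, X.map^[(w j).length] x = Y.iso j x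
  avoid : ∀ j, ∀ x ∈ Y.atom j, ∀ t, 0 < t → t < (w j).length → X.map^[t] x ∉ Y.domain

variable {w : Fin m → List (Fin n)}

theorem Induces.isSubdomain (h : X.Induces Y w) (hY : Y.IsDressed) :
    X.IsSubdomain Y fun j => (w j).length where
  dressed := hY
  subset := h.subset
  induced j x hx := ⟨List.length_pos_iff.2 (h.ne_nil j),
    fun _ ht => ⟨_, (h.follow j x hx).mem_atom ht⟩, fun t h0 ht => h.avoid j x hx t h0 ht,
    h.return_eq j x hx, hY.maps j ⟨x, hx, rfl⟩⟩

theorem Induces.hasIncidence (h : X.Induces Y w) (hX : X.IsDressed) :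
    X.HasIncidence Y (fun j => (w j).length) fun i j => (w j).count i :=
  fun i j x hx => (h.follow j x hx).ncard_visits hX i

theorem Induces.iterate_eq (h : X.Induces Y w) (hY : Y.IsDressed) {j : Fin m} {x : ℂ}
    (hx : x ∈ Y.atom j) : X.map^[(w j).length] x = Y.map x := by
  rw [h.return_eq j x hx, hY.map_eq hx]

theorem Induces.follow_flatMap (h : X.Induces Y w) (hY : Y.IsDressed) {v : List (Fin m)} {x : ℂ}
    (hv : Y.Follow v x) : X.Follow (v.flatMap w) x := by
  induction v generalizing x with
  | nil => trivial
  | cons j v ih =>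
    rw [List.flatMap_cons, follow_append, h.iterate_eq hY hv.1]
    exact ⟨h.follow j x hv.1, ih hv.2⟩

theorem Induces.iterate_flatMap (h : X.Induces Y w) (hY : Y.IsDressed) {v : List (Fin m)} {x : ℂ}
    (hv : Y.Follow v x) : X.map^[(v.flatMap w).length] x = Y.map^[v.length] x := by
  induction v generalizing x with
  | nil => rfl
  | cons j v ih =>
    rw [List.flatMap_cons, List.length_append, add_comm, Function.iterate_add_apply,
      h.iterate_eq hY hv.1, ih hv.2]; rfl

/-- Every point of the orbit of a point of `Y` under the map of `X` lies on a return orbit. -/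
theorem Induces.exists_return (h : X.Induces Y w) (hY : Y.IsDressed) {v : List (Fin m)} {x : ℂ}
    (hv : Y.Follow v x) {s : ℕ} (hs : s < (v.flatMap w).length) : ∃ t j q, t < v.length ∧
      Y.map^[t] x ∈ Y.atom j ∧ q < (w j).length ∧ X.map^[s] x = X.map^[q] (Y.map^[t] x) ∧
      s = ((v.take t).flatMap w).length + q := by
  induction v generalizing x s with
  | nil => simp at hs
  | cons j v ih =>
    rw [List.flatMap_cons, List.length_append] at hs
    rcases lt_or_ge s (w j).length with hsj | hsj
    · exact ⟨0, j, s, by simp, hv.1, hsj, rfl, by simp⟩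
    · obtain ⟨r, rfl⟩ := Nat.exists_eq_add_of_le' hsj
      obtain ⟨t, i, q, ht, hi, hq, e1, e2⟩ := ih hv.2 (s := r) (by omega)
      refine ⟨t + 1, i, q, by simpa using ht, hi, hq, ?_, ?_⟩
      · rw [Function.iterate_add_apply, h.iterate_eq hY hv.1, e1]; rfl
      · rw [List.take_succ_cons, List.flatMap_cons, List.length_append, e2]; omega

theorem Induces.exists_iterate (h : X.Induces Y w) (hY : Y.IsDressed) {v : List (Fin m)} {x : ℂ}
    (hv : Y.Follow v x) {t q : ℕ} {j : Fin m} (ht : t < v.length) (hj : Y.map^[t] x ∈ Y.atom j)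
    (hq : q < (w j).length) :
    ∃ s < (v.flatMap w).length, X.map^[s] x = X.map^[q] (Y.map^[t] x) := by
  induction v generalizing x t with
  | nil => simp at ht
  | cons i v ih =>
    rw [List.flatMap_cons, List.length_append]
    rcases t with _ | t
    · obtain rfl := hY.eq_of_mem hv.1 hj
      exact ⟨q, by omega, rfl⟩
    · obtain ⟨s, hs, e⟩ := ih hv.2 (by simpa using ht) hj
      refine ⟨s + (w i).length, by omega, ?_⟩
      rw [Function.iterate_add_apply, h.iterate_eq hY hv.1, e]; rfl

/-- Substitute each letter by its return word. A time strictly inside a block avoids the domain of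
`Y`, hence that of `Z`; at a block boundary the point lies on the `Y`-orbit, which avoids the domain
of `Z` before its return. -/
theorem Induces.trans {u : Fin k → List (Fin m)} (h : X.Induces Y w) (h' : Y.Induces Z u)
    (hY : Y.IsDressed) : X.Induces Z fun j => (u j).flatMap w where
  subset := h'.subset.trans h.subset
  ne_nil j hj := by
    rw [List.flatMap_eq_nil_iff] at hj
    obtain ⟨i, hi⟩ := List.exists_mem_of_ne_nil _ (h'.ne_nil j)
    exact h.ne_nil i (hj i hi)
  follow j x hx := h.follow_flatMap hY (h'.follow j x hx)
  return_eq j x hx := by rw [h.iterate_flatMap hY (h'.follow j x hx), h'.return_eq j x hx]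
  avoid j x hx s h0 hs hmem := by
    obtain ⟨t, i, q, ht, hi, hq, e1, e2⟩ := h.exists_return hY (h'.follow j x hx) hs
    rw [e1] at hmem
    rcases Nat.eq_zero_or_pos q with rfl | hq0
    · rcases Nat.eq_zero_or_pos t with rfl | ht0
      · simp at e2; omega
      · exact h'.avoid j x hx t ht0 ht hmem
    · exact h.avoid i _ hi q hq0 hq (h'.subset hmem)

/-! ### Towers -/

/-- The sets `B a`, moving through the atoms listed in `w a`, tile the domain of `X`. -/
structure Towers (X : DressedDomain n) {κ : Type} (B : κ → Set ℂ) (w : κ → List (Fin n)) :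
    Prop where
  follow : ∀ a, ∀ x ∈ B a, X.Follow (w a) x
  disjoint : ∀ a b s t, s < (w a).length → t < (w b).length → ∀ x ∈ B a, ∀ y ∈ B b,
    X.map^[s] x = X.map^[t] y → a = b ∧ s = t
  cover : ∀ᵐ z, z ∈ X.domain → ∃ a s x, s < (w a).length ∧ x ∈ B a ∧ X.map^[s] x = z

theorem Towers.reindex {κ κ' : Type} {B : κ → Set ℂ} {v : κ → List (Fin n)} (e : κ' ≃ κ)
    (h : X.Towers B v) : X.Towers (B ∘ e) (v ∘ e) where
  follow a := h.follow (e a)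
  disjoint a b s t hs ht x hx y hy hxy := by
    obtain ⟨h1, h2⟩ := h.disjoint (e a) (e b) s t hs ht x hx y hy hxy
    exact ⟨e.injective h1, h2⟩
  cover := h.cover.mono fun z hz hzX => by
    obtain ⟨a, s, x, h⟩ := hz hzX
    refine ⟨e.symm a, s, x, ?_⟩
    simpa using h

/-- A tower over `Y` is cut into blocks, each a piece of a tower of `X` over an atom of `Y`.
Disjointness first identifies the height within the block, then, by injectivity along the common
word, the base point in `Y`. -/
theorem Towers.trans (hX : X.IsDressed) (hY : Y.IsDressed) (h : X.Induces Y w) {ι κ : Type}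
    {P : ι → Set ℂ} {v : ι → List (Fin n)} {B : κ → Set ℂ} {b : κ → List (Fin m)}
    (hXY : X.Towers (Sum.elim Y.atom P) (Sum.elim w v)) (hB : Y.Towers B b) :
    X.Towers (Sum.elim B P) (Sum.elim (fun a => (b a).flatMap w) v) where
  follow
    | .inl a => fun x hx => h.follow_flatMap hY (hB.follow a x hx)
    | .inr r => hXY.follow (.inr r)
  disjoint
    | .inl a, .inl a', s, s', hs, hs', x, hx, y, hy, hxy => by
      have fx := hB.follow a x hx
      have fy := hB.follow a' y hy
      obtain ⟨t, j, q, ht, hj, hq, e1, e2⟩ := h.exists_return hY fx hs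
      obtain ⟨t', j', q', ht', hj', hq', e1', e2'⟩ := h.exists_return hY fy hs'
      rw [e1, e1'] at hxy
      obtain ⟨h1, rfl⟩ := hXY.disjoint (.inl j) (.inl j') q q' hq hq' _ hj _ hj' hxy
      cases h1
      have := (h.follow j _ hj).eq_of_iterate_eq hX (h.follow j _ hj') hq hxy
      obtain ⟨rfl, rfl⟩ := hB.disjoint a a' t t' ht ht' x hx y hy this
      exact ⟨rfl, e2.trans e2'.symm⟩
    | .inl a, .inr r, s, s', hs, hs', x, hx, y, hy, hxy => by
      obtain ⟨t, j, q, ht, hj, hq, e1, -⟩ := h.exists_return hY (hB.follow a x hx) hs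
      rw [e1] at hxy
      exact absurd (hXY.disjoint (.inl j) (.inr r) q s' hq hs' _ hj y hy hxy).1 (by simp)
    | .inr r, .inl a, s', s, hs', hs, y, hy, x, hx, hxy => by
      obtain ⟨t, j, q, ht, hj, hq, e1, -⟩ := h.exists_return hY (hB.follow a x hx) hs
      rw [e1] at hxy
      exact absurd (hXY.disjoint (.inr r) (.inl j) s' q hs' hq y hy _ hj hxy).1 (by simp)
    | .inr r, .inr r', s, s', hs, hs', x, hx, y, hy, hxy => by
      obtain ⟨h1, h2⟩ := hXY.disjoint (.inr r) (.inr r') s s' hs hs' x hx y hy hxy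
      exact ⟨by rw [Sum.inr.inj h1], h2⟩
  cover := by
    set N := {y | ¬(y ∈ Y.domain → ∃ a s x, s < (b a).length ∧ x ∈ B a ∧ Y.map^[s] x = y)}
    have hN : volume N = 0 := ae_iff.1 hB.cover
    -- The points of `Y` missed by its towers form a null set; its countably many images under
    -- iterates of a piecewise isometry are null as well.
    have : ∀ᵐ z, ∀ q, z ∉ X.map^[q] '' N := ae_all_iff.2 fun q => by
      rw [ae_iff]
      simp only [not_not]
      exact X.volume_iterate_map_image hN q
    filter_upwards [hXY.cover, this] with z hz hzN hzX
    obtain ⟨j | r, q, y, hq, hy, rfl⟩ := hz hzX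
    · have hyN : y ∉ N := fun hy => hzN q ⟨y, hy, rfl⟩
      obtain ⟨a, t, x, ht, hx, rfl⟩ := not_not.1 hyN (hY.atom_subset_domain j hy)
      obtain ⟨s, hs, e⟩ := h.exists_iterate hY (hB.follow a x hx) ht hy hq
      exact ⟨.inl a, s, x, hs, hx, e⟩
    · exact ⟨.inr r, q, y, hq, hy, rfl⟩

/-- `Y` is a subdomain of `X` with return words `w`, and the domain of `X` is tiled by the return
orbits of the atoms of `Y` and finitely many periodic tiles. -/
structure Renormalizes (X : DressedDomain n) (Y : DressedDomain m) (w : Fin m → List (Fin n)) :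
    Prop where
  induces : X.Induces Y w
  towers : ∃ (ι : Type) (_ : Fintype ι) (P : ι → Set ℂ) (v : ι → List (Fin n)),
    (∀ r, IsTile (P r) ∧ v r ≠ [] ∧ X.map^[(v r).length] '' P r = P r) ∧
    X.Towers (Sum.elim Y.atom P) (Sum.elim w v)

/-- Periodic tiles of the intermediate domain remain periodic for `X`, with substituted words, and
are added to those of the first step. -/
theorem Renormalizes.trans {u : Fin k → List (Fin m)} (h : X.Renormalizes Y w)
    (h' : Y.Renormalizes Z u) (hX : X.IsDressed) (hY : Y.IsDressed) :
    X.Renormalizes Z fun j => (u j).flatMap w where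
  induces := h.induces.trans h'.induces hY
  towers := by
    obtain ⟨ι, _, P, v, hP, hT⟩ := h.towers
    obtain ⟨ι', _, P', v', hP', hT'⟩ := h'.towers
    refine ⟨ι' ⊕ ι, inferInstance, Sum.elim P' P, Sum.elim (fun r => (v' r).flatMap w) v, ?_, ?_⟩
    · rintro (r | r)
      · obtain ⟨h1, h2, h3⟩ := hP' r
        refine ⟨h1, fun hnil => ?_, ?_⟩
        · rw [Sum.elim_inl, List.flatMap_eq_nil_iff] at hnil
          obtain ⟨i, hi⟩ := List.exists_mem_of_ne_nil _ h2
          exact h.induces.ne_nil i (hnil i hi)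
        · refine Eq.trans (Set.image_congr fun x hx => ?_) h3
          exact h.induces.iterate_flatMap hY (hT'.follow (.inr r) x hx)
      · exact hP r
    · have := (Towers.trans hX hY h.induces hT hT').reindex (Equiv.sumAssoc _ _ _).symm
      convert this using 1
      · ext (_ | _ | _) : 1 <;> rfl
      · ext (_ | _ | _) : 1 <;> rfl

/-- The case of no shortening, without periodic tiles: the atoms miss only their frontiers, which
are null by convexity. -/
theorem Renormalizes.refl (hX : X.IsDressed) : X.Renormalizes X fun j => [j] where
  induces :=
    { subset := subset_rfl
      ne_nil := by simp
      follow := fun j x hx => ⟨hx, trivial⟩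
      return_eq := fun j x hx => hX.map_eq hx
      avoid := fun j x hx t h0 ht => by simp at ht; omega }
  towers := by
    refine ⟨Empty, inferInstance, Empty.elim, Empty.elim, fun r => r.elim, ?_⟩
    have hnull : ∀ᵐ z, z ∈ X.domain → ∃ j, z ∈ X.atom j := by
      have hfr (j : Fin n) : volume (frontier (X.atom j)) = 0 := by
        rcases hX.tile j with h | ⟨-, -, es, h⟩
        · simp [h]
        · rw [h]; exact (convex_octPolygon es).addHaar_frontier volume
      rw [ae_iff]
      refine measure_mono_null ?_ (measure_iUnion_null hfr)
      intro z hz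
      simp only [Set.mem_ofPred_eq, Classical.not_imp, not_exists] at hz
      have h1 : z ∈ closure (⋃ j, X.atom j) := interior_subset hz.1
      rw [closure_iUnion_of_finite] at h1
      obtain ⟨j, hj⟩ := Set.mem_iUnion.1 h1
      exact Set.mem_iUnion.2 ⟨j, hj, fun h => hz.2 j (interior_subset h)⟩
    refine ⟨?_, ?_, ?_⟩
    · rintro (j | r) x hx
      · exact ⟨hx, trivial⟩
      · exact r.elim
    · rintro (j | r) (j' | r') s s' hs hs' x hx y hy hxy
      · simp at hs hs'
        subst hs hs'
        obtain rfl : x = y := hxy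
        exact ⟨by rw [hX.eq_of_mem hx hy], rfl⟩
      all_goals first | exact r.elim | exact r'.elim
    · filter_upwards [hnull] with z hz hzX
      obtain ⟨j, hj⟩ := hz hzX
      exact ⟨.inl j, 0, z, by simp, hj, rfl⟩

end DressedDomain

namespace DressedDomain

variable {n m : ℕ} {X : DressedDomain n} {Y : DressedDomain m} {w : Fin m → List (Fin n)}

/-! ### Recursive tilings -/

theorem Towers.mem_domain (hX : X.IsDressed) {κ : Type} {B : κ → Set ℂ} {v : κ → List (Fin n)}
    (h : X.Towers B v) {a : κ} {x : ℂ} (hx : x ∈ B a) {s : ℕ} (hs : s < (v a).length) :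
    X.map^[s] x ∈ X.domain :=
  hX.atom_subset_domain _ ((h.follow a x hx).mem_atom hs)

theorem Renormalizes.recursivelyTiled (h : X.Renormalizes Y w) (hX : X.IsDressed) :
    X.RecursivelyTiled Y fun j => (w j).length := by
  obtain ⟨ι, _, P, v, hP, hT⟩ := h.towers
  -- The towers use an arbitrary finite index type and natural-number heights; the conclusion asks
  -- for `Fin`-indexed families.
  let e := Fintype.equivFin ι
  let idx : (Σ j, Fin (w j).length) ⊕ (Σ r, Fin (v (e.symm r)).length) → (Fin m ⊕ ι) × ℕ
    | .inl a => (.inl a.1, a.2)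
    | .inr a => (.inr (e.symm a.1), a.2)
  have hidx : Function.Injective idx := by
    rintro (⟨j, s⟩ | ⟨r, s⟩) (⟨j', s'⟩ | ⟨r', s'⟩) h
    · simp only [idx, Prod.mk.injEq, Sum.inl.injEq] at h
      obtain ⟨rfl, h⟩ := h
      rw [Fin.ext h]
    · simp [idx] at h
    · simp [idx] at h
    · simp only [idx, Prod.mk.injEq, Sum.inr.injEq, e.symm.injective.eq_iff] at h
      obtain ⟨rfl, h⟩ := h
      rw [Fin.ext h]
  have hlt : ∀ a, (idx a).2 < (Sum.elim w v (idx a).1).length := by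
    rintro (⟨j, s⟩ | ⟨r, s⟩)
    exacts [s.2, s.2]
  have htile : ∀ a, X.orbitTile Y (fun j => (w j).length) (P ∘ e.symm)
      (fun r => (v (e.symm r)).length) a = X.map^[(idx a).2] '' Sum.elim Y.atom P (idx a).1 := by
    rintro (⟨j, s⟩ | ⟨r, s⟩) <;> rfl
  refine ⟨_, P ∘ e.symm, fun r => (v (e.symm r)).length, fun r => ?_, ?_, ?_, ?_⟩
  · obtain ⟨h1, h2, h3⟩ := hP (e.symm r)
    refine ⟨h1, List.length_pos_iff.2 h2, fun t ht => ⟨(v (e.symm r))[t], ?_⟩, h3⟩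
    rintro _ ⟨x, hx, rfl⟩
    exact (hT.follow (.inr (e.symm r)) x hx).mem_atom ht
  · intro a b hab
    rw [htile, htile, Set.disjoint_left]
    rintro _ ⟨x, hx, rfl⟩ ⟨y, hy, hxy⟩
    obtain ⟨h1, h2⟩ := hT.disjoint _ _ _ _ (hlt a) (hlt b) x hx y hy hxy.symm
    exact hab (hidx (Prod.ext h1 h2))
  · intro a
    rw [htile]
    rintro _ ⟨x, hx, rfl⟩
    exact hT.mem_domain hX hx (hlt a)
  · have := ae_iff.1 hT.cover
    refine measure_mono_null ?_ this
    rintro z ⟨hz, hzn⟩ hcon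
    obtain ⟨a, s, x, hs, hx, rfl⟩ := hcon hz
    refine hzn (Set.mem_iUnion.2 ?_)
    rcases a with j | r
    · exact ⟨.inl ⟨j, s, hs⟩, x, hx, rfl⟩
    · refine ⟨.inr ⟨e r, s, by simpa using hs⟩, x, ?_, rfl⟩
      simpa using hx

/-! ### Invariance under isometries -/

theorem domain_transform (g : Isom) (X : DressedDomain n) :
    (X.transform g).domain = g '' X.domain := by
  have : (⋃ i, (X.transform g).atom i) = g.toHomeomorph '' ⋃ i, X.atom i := by
    rw [Set.image_iUnion]; rfl
  rw [domain, this, ← Homeomorph.image_closure, ← Homeomorph.image_interior]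
  rfl

theorem transform_transform (g k : Isom) (X : DressedDomain n) :
    (X.transform g).transform k = X.transform (k * g) := by
  simp only [transform, AffineIsometryEquiv.coe_mul, Set.image_comp, mul_inv_rev, mul_assoc]

variable {g : Isom}

theorem IsDressed.transform (hX : X.IsDressed) (hg : InGroup g) :
    (X.transform g).IsDressed where
  tile i := by
    rcases hX.tile i with h | h
    · left
      change g '' X.atom i = ∅
      rw [h, Set.image_empty]
    · exact .inr (h.image hg)
  disjoint i j hij := (Set.disjoint_image_iff g.injective).2 (hX.disjoint hij)
  inGroup i := (hg.mul (hX.inGroup i)).mul hg.inv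
  orientation i := (parity_conj g (X.iso i)).trans (hX.orientation i)
  maps i := by
    rw [domain_transform]
    change (g * X.iso i * g⁻¹) '' (g '' X.atom i) ⊆ _
    rw [← Set.image_comp, ← AffineIsometryEquiv.coe_mul, inv_mul_cancel_right,
      AffineIsometryEquiv.coe_mul, Set.image_comp]
    exact Set.image_mono (hX.maps i)

theorem mem_transform_atom {i : Fin n} {x : ℂ} :
    g x ∈ (X.transform g).atom i ↔ x ∈ X.atom i := g.injective.mem_set_image

theorem IsDressed.transform_map (hX : X.IsDressed) (hg : InGroup g) (x : ℂ) :
    (X.transform g).map (g x) = g (X.map x) := by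
  by_cases h : ∃ i, x ∈ X.atom i
  · obtain ⟨i, hi⟩ := h
    rw [hX.map_eq hi, (hX.transform hg).map_eq (mem_transform_atom.2 hi)]
    change g (X.iso i (g⁻¹ (g x))) = _
    rw [show g⁻¹ (g x) = x from g.symm_apply_apply x]
  -- Off the atoms both maps take their default value, the point itself, so equivariance holds
  -- everywhere.
  · rw [map_eq_self h, map_eq_self]
    simpa only [mem_transform_atom] using h

theorem IsDressed.transform_iterate (hX : X.IsDressed) (hg : InGroup g) (x : ℂ) (t : ℕ) :
    (X.transform g).map^[t] (g x) = g (X.map^[t] x) := by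
  induction t generalizing x with
  | zero => rfl
  | succ t ih => rw [Function.iterate_succ_apply, hX.transform_map hg, ih]; rfl

theorem IsDressed.transform_follow (hX : X.IsDressed) (hg : InGroup g) {v : List (Fin n)} {x : ℂ}
    (h : X.Follow v x) : (X.transform g).Follow v (g x) := by
  induction v generalizing x with
  | nil => trivial
  | cons i v ih =>
    refine ⟨mem_transform_atom.2 h.1, ?_⟩
    rw [hX.transform_map hg]
    exact ih h.2

theorem Towers.transform (hX : X.IsDressed) (hg : InGroup g) {κ : Type} {B : κ → Set ℂ}
    {v : κ → List (Fin n)} (h : X.Towers B v) :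
    (X.transform g).Towers (fun a => g '' B a) v where
  follow := by
    rintro a _ ⟨x, hx, rfl⟩
    exact hX.transform_follow hg (h.follow a x hx)
  disjoint := by
    rintro a b s t hs ht _ ⟨x, hx, rfl⟩ _ ⟨y, hy, rfl⟩ hxy
    rw [hX.transform_iterate hg, hX.transform_iterate hg] at hxy
    exact h.disjoint a b s t hs ht x hx y hy (g.injective hxy)
  cover := by
    filter_upwards [ae_comp_isom g⁻¹ h.cover] with z hz hzX
    rw [domain_transform] at hzX
    obtain ⟨y, hy, rfl⟩ := hzX
    rw [show g⁻¹ (g y) = y from g.symm_apply_apply y] at hz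
    obtain ⟨a, s, x, hs, hx, rfl⟩ := hz hy
    exact ⟨a, s, g x, hs, ⟨x, hx, rfl⟩, hX.transform_iterate hg x s⟩

theorem Induces.transform (h : X.Induces Y w) (hX : X.IsDressed) (hg : InGroup g) :
    (X.transform g).Induces (Y.transform g) w where
  subset := by
    rw [domain_transform, domain_transform]
    exact Set.image_mono h.subset
  ne_nil := h.ne_nil
  follow := by
    rintro j _ ⟨x, hx, rfl⟩
    exact hX.transform_follow hg (h.follow j x hx)
  return_eq := by
    rintro j _ ⟨x, hx, rfl⟩
    rw [hX.transform_iterate hg, h.return_eq j x hx]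
    change _ = g (Y.iso j (g⁻¹ (g x)))
    rw [show g⁻¹ (g x) = x from g.symm_apply_apply x]
  avoid := by
    rintro j _ ⟨x, hx, rfl⟩ t h0 ht hmem
    rw [hX.transform_iterate hg, domain_transform, g.injective.mem_set_image] at hmem
    exact h.avoid j x hx t h0 ht hmem

theorem Renormalizes.transform (h : X.Renormalizes Y w) (hX : X.IsDressed) (hg : InGroup g) :
    (X.transform g).Renormalizes (Y.transform g) w where
  induces := h.induces.transform hX hg
  towers := by
    obtain ⟨ι, hι, P, v, hP, hT⟩ := h.towers
    refine ⟨ι, hι, fun r => g '' P r, v, fun r => ?_, ?_⟩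
    · obtain ⟨h1, h2, h3⟩ := hP r
      refine ⟨h1.image hg, h2, ?_⟩
      change _ = g '' P r
      conv_rhs => rw [← h3]
      rw [← Set.image_comp, ← Set.image_comp]
      exact Set.image_congr fun x _ => hX.transform_iterate hg x _
    · convert hT.transform hX hg using 1
      ext (_ | _) : 1 <;> rfl

end DressedDomain

/-! ### The return words of the shortened pencil -/

/-- The return word of the atom `j` of the shortened pencil. -/
def stepWord : ℕ → List ℕ
  | 0 => [0]
  | 1 => [5]
  | 2 => [5, 4, 2, 4, 5]
  | 3 => [5, 4, 4, 5]
  | k + 4 => [k + 6]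

theorem stepWord_lt {M j : ℕ} (hj : j < 2 * (M + 4) + 1) :
    ∀ i ∈ stepWord j, i < 2 * (M + 5) + 1 := by
  rcases j with _ | _ | _ | _ | k <;> simp [stepWord] <;> omega

/-- The return word of the atom `j` of the shortened pencil, as a list of indices of atoms. -/
def stepReturn (M : ℕ) (j : Fin (2 * (M + 4) + 1)) : List (Fin (2 * (M + 5) + 1)) :=
  (stepWord j).pmap Fin.mk (stepWord_lt j.2)

theorem stepReturn_map_val (M : ℕ) (j : Fin (2 * (M + 4) + 1)) :
    (stepReturn M j).map Fin.val = stepWord j := by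
  rw [stepReturn, List.map_pmap, List.pmap_eq_map, List.map_id']

theorem sum_fin_four {N n : ℕ} (h : N = n + 4) (f : Fin N → ℕ) : ∑ j, f j =
    f ⟨0, by omega⟩ + f ⟨1, by omega⟩ + f ⟨2, by omega⟩ + f ⟨3, by omega⟩ +
      ∑ k : Fin n, f ⟨k + 4, by omega⟩ := by
  subst h
  rw [Fin.sum_univ_succ, Fin.sum_univ_succ, Fin.sum_univ_succ, Fin.sum_univ_succ]
  simp only [← add_assoc]
  rfl

namespace DressedDomain

variable {n m : ℕ} {X : DressedDomain n} {s t : ℝ}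

/-- Towers from the values of indicator functions. -/
theorem Towers.of_sum {κ : Type} [Fintype κ] {B : κ → Set ℂ} {w : κ → List (Fin n)}
    (hf : ∀ a, ∀ x ∈ B a, X.Follow (w a) x)
    (ho : ∀ a, ∀ r < (w a).length, IsOpen (X.map^[r] '' B a))
    (hsum : ∀ᵐ z, ∑ a, ∑ r ∈ Finset.range (w a).length, ind (X.map^[r] '' B a) z =
      ind X.domain z) : X.Towers B w where
  follow := hf
  disjoint a b r q hr hq x hx y hy hxy := by
    classical
    by_contra hne
    have hd : Disjoint (X.map^[r] '' B a) (X.map^[q] '' B b) := by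
      refine disjoint_of_ae (ho a r hr) (ho b q hq) (hsum.mono fun z hz => ?_)
      refine le_trans ?_ (ind_le_one X.domain z)
      rw [← hz, Finset.sum_sigma']
      have hne' : (⟨a, r⟩ : Σ _ : κ, ℕ) ≠ ⟨b, q⟩ := by
        intro h
        cases h
        exact hne ⟨rfl, rfl⟩
      rw [← Finset.sum_pair hne' (f := fun p : Σ _ : κ, ℕ => ind (X.map^[p.2] '' B p.1) z)]
      refine Finset.sum_le_sum_of_subset fun p hp => ?_
      simp only [Finset.mem_insert, Finset.mem_singleton] at hp
      rcases hp with rfl | rfl <;> simpa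
    exact Set.disjoint_left.1 hd ⟨x, hx, rfl⟩ ⟨y, hy, hxy.symm⟩
  cover := hsum.mono fun z hz hzX => by
    rw [ind_of_mem hzX] at hz
    obtain ⟨a, -, ha⟩ := Finset.exists_ne_zero_of_sum_ne_zero (hz.trans_ne one_ne_zero)
    obtain ⟨r, hr, hr'⟩ := Finset.exists_ne_zero_of_sum_ne_zero ha
    obtain ⟨x, hx, e⟩ := ind_pos.1 (Nat.pos_of_ne_zero hr')
    exact ⟨a, r, x, Finset.mem_range.1 hr, hx, e⟩

/-- The atom `i` of `X` is the given formal piece. -/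
structure HasPiece (X : DressedDomain n) (s t : ℝ) (i : Fin n) (p : FormalPiece) : Prop where
  atom : X.atom i = p.tile.set s t
  iso : X.iso i = p.iso.toIsom s t

namespace HasPiece

variable {i : Fin n} {p : FormalPiece} (h : X.HasPiece s t i p) (hX : X.IsDressed)
include h hX

theorem map_eq {x : ℂ} (hx : x ∈ p.tile.set s t) : X.map x = p.iso.toIsom s t x := by
  rw [hX.map_eq (h.atom ▸ hx), h.iso]

theorem map_image {Q : Poly} (hQ : Q.set s t ⊆ p.tile.set s t) :
    X.map '' Q.set s t = (p.iso.image Q).set s t := by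
  rw [← Motion.image_set]
  exact Set.image_congr fun x hx => h.map_eq hX (hQ hx)

end HasPiece

end DressedDomain

/-! ### The step from a pencil to the shortened pencil -/

theorem pencil_hasPiece {s t l h : ℝ} {ν : ℤˣ} {L i : ℕ} (hi : i < 2 * L + 1) {p : FormalPiece}
    (hp : p.Realizes s t (piece ν L l h i)) : (pencil ν L l h).HasPiece s t ⟨i, hi⟩ p :=
  ⟨hp.tile, hp.iso⟩

theorem pencil_transform_hasPiece {s t l h : ℝ} {ν : ℤˣ} {L i : ℕ} (hi : i < 2 * L + 1)
    {p : FormalPiece} (hp : p.Realizes s t (piece ν L l h i)) :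
    ((pencil ν L l h).transform U0).HasPiece s t ⟨i, hi⟩ p.conj := by
  refine ⟨hp.conj_tile, ?_⟩
  rw [← hp.conj.iso]
  change U0 * (U0 * (piece ν L l h i).refl) * U0⁻¹ = _
  simp only [Piece.refl, mul_inv_rev, mul_assoc]

/-! ### Inclusions and compositions along the orbits of one shortening -/

namespace Step

theorem kite0_sub : kite0.sub P5.tile = true := by decide +kernel
theorem kite1_sub : kite1.sub P4.tile = true := by decide +kernel
theorem kite3_sub : kite3.sub P4.tile = true := by decide +kernel
theorem kite4_sub : kite4.sub P5.tile = true := by decide +kernel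
theorem triangle0_sub : triangle0.sub P5.tile = true := by decide +kernel
theorem triangle1_sub : triangle1.sub P4.tile = true := by decide +kernel
theorem triangle2_sub : triangle2.sub P4.tile = true := by decide +kernel
theorem triangle3_sub : triangle3.sub P5.tile = true := by decide +kernel
theorem periodic1_sub : periodic1.sub P4.tile = true := by decide +kernel
theorem periodic2_sub : periodic2.sub P4.tile = true := by decide +kernel
theorem octagon_sub : octagon.sub P4.tile = true := by decide +kernel
theorem Y1_sub : Y1.tile.sub P5.tile = true := by decide +kernel

variable {s t : ℝ} (hs : 0 ≤ s) (ht : 0 ≤ t)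
include hs ht

/-- The tiles outside the shortened pentagon. -/
theorem disjoint_shorter {Q : Poly}
    (hQ : Q = kite4 ∨ Q = triangle3 ∨ Q = P2.tile ∨ Q = P4.tile) :
    Disjoint (Q.set s t) (shorter.set s t) := by
  refine disjoint_of_ae Q.isOpen shorter.isOpen ((pentagon_tiling hs ht).mono fun z hz => ?_)
  have := ind_le_one ((formalPentagon l h).set s t) z
  rcases hQ with rfl | rfl | rfl | rfl <;> omega

theorem shorter_subset : shorter.set s t ⊆ (formalPentagon l h).set s t := by
  rw [(formalPentagon l h).set_eq_octPolygon]
  refine subset_octPolygon_of_ae shorter.isOpen ((pentagon_tiling hs ht).mono fun z hz hzs => ?_)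
  rw [← Poly.set_eq_octPolygon, ← ind_pos, hz, ind_of_mem hzs]
  omega

end Step

/-- The images of a polygon that moves through the given pieces. -/
def Poly.orbit : Poly → List FormalPiece → ℕ → Poly
  | Q, [], _ => Q
  | Q, _ :: _, 0 => Q
  | Q, p :: ps, r + 1 => (p.iso.image Q).orbit ps r

/-- The isometry by which a polygon moves through the given pieces. -/
def passage : List FormalPiece → Motion
  | [] => Motion.ofCoords 0 0 0
  | p :: ps => (passage ps).mul p.iso

namespace Step

theorem passage_Y1 : passage [P5] = Y1.iso := by decide +kernel

theorem passage_Y2 : passage [P5, P4, P2, P4, P5] = Y2.iso := by decide +kernel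

theorem passage_Y3 : passage [P5, P4, P4, P5] = Y3.iso := by decide +kernel

end Step

namespace DressedDomain

variable {n : ℕ} {X : DressedDomain n} {s t : ℝ}

/-- The polygon `Q` moves through the given atoms of `X`, which are the given pieces. -/
inductive Passes (X : DressedDomain n) (s t : ℝ) :
    List (Fin n) → List FormalPiece → Poly → Prop
  | nil {Q : Poly} : Passes X s t [] [] Q
  | cons {i : Fin n} {w : List (Fin n)} {p : FormalPiece} {ps : List FormalPiece} {Q : Poly} :
      X.HasPiece s t i p → Q.set s t ⊆ p.tile.set s t → Passes X s t w ps (p.iso.image Q) →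
      Passes X s t (i :: w) (p :: ps) Q

namespace Passes

variable {w : List (Fin n)} {ps : List FormalPiece} {Q : Poly} (h : X.Passes s t w ps Q)
  (hX : X.IsDressed)
include h hX

theorem map_image {r : ℕ} (hr : r ≤ w.length) :
    X.map^[r] '' Q.set s t = (Q.orbit ps r).set s t := by
  induction h generalizing r with
  | nil =>
    obtain rfl : r = 0 := by simpa using hr
    simp [Poly.orbit]
  | cons hp hQ _ ih =>
    rcases r with _ | r
    · simp [Poly.orbit]
    · rw [Function.iterate_succ, Set.image_comp, hp.map_image hX hQ, ih (by simpa using hr)]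
      rfl

theorem isOpen {r : ℕ} (hr : r < w.length) : IsOpen (X.map^[r] '' Q.set s t) := by
  rw [h.map_image hX hr.le]
  exact Poly.isOpen _

theorem ind_map_image {r : ℕ} (hr : r ≤ w.length) (z : ℂ) :
    ind (X.map^[r] '' Q.set s t) z = ind ((Q.orbit ps r).set s t) z := by
  rw [h.map_image hX hr]

theorem follow : ∀ x ∈ Q.set s t, X.Follow w x := by
  induction h with
  | nil => exact fun _ _ => trivial
  | cons hp hQ _ ih =>
    refine fun x hx => ⟨hp.atom ▸ hQ hx, ih _ ?_⟩
    rw [← hp.map_image hX hQ]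
    exact ⟨x, hx, rfl⟩

theorem iterate_eq {x : ℂ} (hx : x ∈ Q.set s t) :
    X.map^[w.length] x = (passage ps).toIsom s t x := by
  induction h generalizing x with
  | nil => simp [passage, ofCoords_toIsom, T_apply, R_apply, u_zero, Complex.ext_iff]
  | cons hp hQ _ ih =>
    rw [passage, Motion.toIsom_mul, AffineIsometryEquiv.coe_mul, Function.comp_apply,
      ← hp.map_eq hX (hQ hx)]
    exact ih (hp.map_image hX hQ ▸ ⟨x, hx, rfl⟩)

end Passes

end DressedDomain

/-! ### Symbolic orbits in the pencil and the atoms of its shortening -/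

section step

open DressedDomain

variable {s t l h : ℝ}

theorem Step.octagon_isTile (hs : 0 ≤ s) (ht : 0 ≤ t) (hh : 0 < h) (eh : h = Step.h.eval s t)
    (hb : Bornology.IsBounded (Step.P4.tile.set s t)) : IsTile (Step.octagon.set s t) := by
  refine ⟨?_, hb.subset (Poly.sub_sound hs ht octagon_sub), _, Poly.set_eq_octPolygon _⟩
  rw [Step.octagon, ← Motion.image_set, Set.image_nonempty]
  refine ⟨0, fun k => ?_⟩
  rw [RealForm.eval_dbl, ← eh]
  simp [coord, hh]

variable (hs : 0 ≤ s) (ht : 0 ≤ t) (el : l = Step.l.eval s t) (eh : h = Step.h.eval s t)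
  (ν : ℤˣ) (M : ℕ)

section passes

include el eh

theorem passes_P1 : (pencil ν (M + 5) l h).Passes s t [⟨1, by omega⟩] [Step.P1] Step.P1.tile :=
  .cons (pencil_hasPiece _ (realizes_piece1 el eh ν _)) subset_rfl .nil

include hs ht

theorem passes_octagon :
    (pencil ν (M + 5) l h).Passes s t [⟨4, by omega⟩] [Step.P4] Step.octagon :=
  .cons (pencil_hasPiece _ (realizes_piece4 el eh ν _))
    (Poly.sub_sound hs ht Step.octagon_sub) .nil

theorem passes_P3 : (pencil ν (M + 5) l h).Passes s t
    [⟨3, by omega⟩, ⟨4, by omega⟩, ⟨4, by omega⟩] [Step.P3, Step.P4, Step.P4] Step.periodic0 :=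
  .cons (pencil_hasPiece _ (realizes_piece3 el eh ν _)) subset_rfl
    (.cons (pencil_hasPiece _ (realizes_piece4 el eh ν _))
      (Poly.sub_sound hs ht Step.periodic1_sub)
      (.cons (pencil_hasPiece _ (realizes_piece4 el eh ν _))
        (Poly.sub_sound hs ht Step.periodic2_sub) .nil))

theorem passes_Y1 : (pencil ν (M + 5) l h).Passes s t [⟨5, by omega⟩] [Step.P5] Step.Y1.tile :=
  .cons (pencil_hasPiece _ (realizes_trapezium el eh ν _))
    (Poly.sub_sound hs ht Step.Y1_sub) .nil

theorem passes_Y2 : (pencil ν (M + 5) l h).Passes s t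
    [⟨5, by omega⟩, ⟨4, by omega⟩, ⟨2, by omega⟩, ⟨4, by omega⟩, ⟨5, by omega⟩]
    [Step.P5, Step.P4, Step.P2, Step.P4, Step.P5] Step.Y2.tile := by
  have h2 := pencil_hasPiece (by omega) (realizes_piece2 el eh ν (M + 5))
  have h4 := pencil_hasPiece (by omega) (realizes_piece4 el eh ν (M + 5))
  have h5 := pencil_hasPiece (by omega) (realizes_trapezium el eh ν M)
  refine .cons h5 (Poly.sub_sound hs ht Step.kite0_sub) (.cons h4
    (Poly.sub_sound hs ht Step.kite1_sub) (.cons h2 ?_ (.cons h4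
      (Poly.sub_sound hs ht Step.kite3_sub) (.cons h5 (Poly.sub_sound hs ht Step.kite4_sub) .nil))))
  -- At its middle stop the kite fills the whole atom `P_2`.
  exact (congrArg (Poly.set s t) Step.kite2_eq).subset

theorem passes_Y3 : (pencil ν (M + 5) l h).Passes s t
    [⟨5, by omega⟩, ⟨4, by omega⟩, ⟨4, by omega⟩, ⟨5, by omega⟩]
    [Step.P5, Step.P4, Step.P4, Step.P5] Step.Y3.tile := by
  have h4 := pencil_hasPiece (by omega) (realizes_piece4 el eh ν (M + 5))
  have h5 := pencil_hasPiece (by omega) (realizes_trapezium el eh ν M)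
  exact .cons h5 (Poly.sub_sound hs ht Step.triangle0_sub) (.cons h4
    (Poly.sub_sound hs ht Step.triangle1_sub) (.cons h4 (Poly.sub_sound hs ht Step.triangle2_sub)
      (.cons h5 (Poly.sub_sound hs ht Step.triangle3_sub) .nil)))

end passes

/-- The pencil with two atoms less, reflected. -/
abbrev shortening (ν : ℤˣ) (M : ℕ) (l h : ℝ) : DressedDomain (2 * (M + 4) + 1) :=
  (pencil (-ν) (M + 4) (β * l) h).transform U0

theorem shortening_atom_zero : (shortening ν M l h).atom ⟨0, by omega⟩ =
    (pencil ν (M + 5) l h).atom ⟨0, by omega⟩ :=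
  U0_image_piece0 (-ν) (M + 4) (β * l) h

/-- Conjugation by `U_0` exchanges the axes `u_7` and `u_1` and reverses the order of the two
reflections; with `-ν` in place of `ν` the resulting rotation is the same. -/
theorem shortening_iso_zero : (shortening ν M l h).iso ⟨0, by omega⟩ =
    (pencil ν (M + 5) l h).iso ⟨0, by omega⟩ := by
  change U0 * (U0 * (1 * U2 (-2 * ((-ν : ℤˣ) : ℤ)) * 1⁻¹)) * U0⁻¹ =
    U0 * (1 * U2 (-2 * (ν : ℤ)) * 1⁻¹)
  rw [U0_inv]
  ext z
  simp [U0_apply, U2_apply, ← u_neg_conj]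

theorem shortening_atom (k : ℕ) (hk : k + 4 < 2 * (M + 4) + 1) :
    (shortening ν M l h).atom ⟨k + 4, hk⟩ = (pencil ν (M + 5) l h).atom ⟨k + 6, by omega⟩ :=
  (piece_shift ν (-ν) M l h (by omega : 4 ≤ k + 4)).tile.symm

theorem shortening_iso (k : ℕ) (hk : k + 4 < 2 * (M + 4) + 1) :
    (shortening ν M l h).iso ⟨k + 4, hk⟩ = (pencil ν (M + 5) l h).iso ⟨k + 6, by omega⟩ := by
  have := (piece_shift ν (-ν) M l h (by omega : 4 ≤ k + 4)).refl
  change U0 * (U0 * (piece (-ν) (M + 4) (β * l) h (k + 4)).refl) * U0⁻¹ =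
    U0 * (piece ν (M + 5) l h (k + 6)).refl
  simp only [this, U0_inv, mul_assoc]

section pieces

include el eh

theorem shortening_one : (shortening ν M l h).HasPiece s t ⟨1, by omega⟩ Step.Y1 :=
  pencil_transform_hasPiece _ (realizes_piece1 (shorter_parameter el) eh (-ν) _)

theorem shortening_two : (shortening ν M l h).HasPiece s t ⟨2, by omega⟩ Step.Y2 :=
  pencil_transform_hasPiece _ (realizes_piece2 (shorter_parameter el) eh (-ν) _)

theorem shortening_three : (shortening ν M l h).HasPiece s t ⟨3, by omega⟩ Step.Y3 :=
  pencil_transform_hasPiece _ (realizes_piece3 (shorter_parameter el) eh (-ν) _)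

end pieces

end step

/-! ### First returns to the shortened pentagon -/

section step

open DressedDomain

variable {s t l h : ℝ} (hs : 0 ≤ s) (ht : 0 ≤ t) (el : l = Step.l.eval s t)
  (eh : h = Step.h.eval s t) (ν : ℤˣ) {M : ℕ} (hl : 0 < l) (hlo : β ^ (M + 4) * l ≤ h)
  (hhi : h ≤ β ^ (M + 3) * l)
include hl hlo hhi

theorem shortening_bounds : 0 < β * l ∧ β ^ (M + 3) * (β * l) ≤ h ∧ h ≤ β ^ (M + 2) * (β * l) :=
  ⟨mul_pos β_pos hl, by rwa [← mul_assoc, ← pow_succ], by rwa [← mul_assoc, ← pow_succ]⟩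

theorem isDressed_longer : (pencil ν (M + 5) l h).IsDressed :=
  isDressed_pencil (M := M + 1) ν hl hlo hhi

theorem domain_shortening : (shortening ν M l h).domain = pentagon (β * l) h := by
  obtain ⟨h1, h2, h3⟩ := shortening_bounds hl hlo hhi
  rw [domain_transform, domain_pencil _ h1 h2 h3, U0_image_pentagon]

theorem isDressed_shortening : (shortening ν M l h).IsDressed := by
  obtain ⟨h1, h2, h3⟩ := shortening_bounds hl hlo hhi
  exact (isDressed_pencil (-ν) h1 h2 h3).transform (inGroup_U2 0)

theorem shortening_tiling : ∀ᵐ z, ∑ j, ind ((shortening ν M l h).atom j) z =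
    ind (pentagon (β * l) h) z := by
  obtain ⟨h1, h2, h3⟩ := shortening_bounds hl hlo hhi
  filter_upwards [ae_comp_isom U0⁻¹ (pencil_tiling (-ν) h1 h2 h3)] with z hz
  simp only [← ind_image] at hz
  rw [U0_image_pentagon, Finset.sum_range] at hz
  exact hz

include hs ht el eh

/-- Atoms `0` and `k + 4` are atoms of the longer pencil with the same map. For `Y_1, Y_2, Y_3` the
composed motion is compared with the required isometry. Intermediate positions miss the shortened
pentagon because they lie in `P_2` or `P_4`, or are `kite4` or `triangle3`. -/
theorem pencil_induces_shortening :
    (pencil ν (M + 5) l h).Induces (shortening ν M l h) (stepReturn M) := by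
  have hX := isDressed_longer ν hl hlo hhi
  have hD : (shortening ν M l h).domain = Step.shorter.set s t := by
    rw [domain_shortening ν hl hlo hhi]
    exact pentagon_eq (shorter_parameter el) eh
  have hd : ∀ {Q : Poly} {x : ℂ}, (Q = Step.kite4 ∨ Q = Step.triangle3 ∨ Q = Step.P2.tile ∨
      Q = Step.P4.tile) → x ∈ Q.set s t → x ∉ (shortening ν M l h).domain := fun hQ hx hmem =>
    Set.disjoint_left.1 (Step.disjoint_shorter hs ht hQ) hx (hD ▸ hmem)
  have h1 := shortening_one el eh ν M
  have h2 := shortening_two el eh ν M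
  have h3 := shortening_three el eh ν M
  have p1 := passes_Y1 hs ht el eh ν M
  have p2 := passes_Y2 hs ht el eh ν M
  have p3 := passes_Y3 hs ht el eh ν M
  refine ⟨?_, ?_, ?_, ?_, ?_⟩
  · rw [hD, domain_pencil (M := M + 1) ν hl hlo hhi, pentagon_eq el eh]
    exact Step.shorter_subset hs ht
  · rintro ⟨_ | _ | _ | _ | k, hk⟩ <;> exact List.cons_ne_nil _ _
  · rintro ⟨_ | _ | _ | _ | k, hk⟩ x hx
    · exact ⟨(shortening_atom_zero ν M).subset hx, trivial⟩
    · exact p1.follow hX x (h1.atom ▸ hx)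
    · exact p2.follow hX x (h2.atom ▸ hx)
    · exact p3.follow hX x (h3.atom ▸ hx)
    · exact ⟨(shortening_atom ν M k hk).subset hx, trivial⟩
  · rintro ⟨_ | _ | _ | _ | k, hk⟩ x hx
    · refine (hX.map_eq ((shortening_atom_zero ν M).subset hx)).trans ?_
      rw [← shortening_iso_zero]
    · rw [h1.iso, ← Step.passage_Y1]
      exact p1.iterate_eq hX (h1.atom ▸ hx)
    · rw [h2.iso, ← Step.passage_Y2]
      exact p2.iterate_eq hX (h2.atom ▸ hx)
    · rw [h3.iso, ← Step.passage_Y3]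
      exact p3.iterate_eq hX (h3.atom ▸ hx)
    · refine (hX.map_eq ((shortening_atom ν M k hk).subset hx)).trans ?_
      rw [← shortening_iso]
  · rintro ⟨_ | _ | _ | _ | k, hk⟩ x hx r h0 hr
    · change r < 1 at hr
      omega
    · change r < 1 at hr
      omega
    · change r < 5 at hr
      have hx' := (p2.map_image hX hr.le).subset ⟨x, h2.atom ▸ hx, rfl⟩
      interval_cases r
      · exact hd (.inr (.inr (.inr rfl))) (Poly.sub_sound hs ht Step.kite1_sub hx')
      · exact hd (.inr (.inr (.inl Step.kite2_eq))) hx'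
      · exact hd (.inr (.inr (.inr rfl))) (Poly.sub_sound hs ht Step.kite3_sub hx')
      · exact hd (.inl rfl) hx'
    · change r < 4 at hr
      have hx' := (p3.map_image hX hr.le).subset ⟨x, h3.atom ▸ hx, rfl⟩
      interval_cases r
      · exact hd (.inr (.inr (.inr rfl))) (Poly.sub_sound hs ht Step.triangle1_sub hx')
      · exact hd (.inr (.inr (.inr rfl))) (Poly.sub_sound hs ht Step.triangle2_sub hx')
      · exact hd (.inr (.inl rfl)) hx'
    · change r < 1 at hr
      omega

end step

/-! ### Periodic tiles and the tiling by towers -/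

section step

open DressedDomain

/-- The periodic tiles outside the return orbits of the shortened pencil. -/
def periodicTile : Fin 3 → Poly := ![Step.P1.tile, Step.octagon, Step.periodic0]

/-- The words of the orbits of the periodic tiles. -/
def periodicWord (M : ℕ) : Fin 3 → List (Fin (2 * (M + 5) + 1)) :=
  ![[⟨1, by omega⟩], [⟨4, by omega⟩], [⟨3, by omega⟩, ⟨4, by omega⟩, ⟨4, by omega⟩]]

variable {s t l h : ℝ} (hs : 0 ≤ s) (ht : 0 ≤ t) (el : l = Step.l.eval s t)
  (eh : h = Step.h.eval s t) (ν : ℤˣ) {M : ℕ} (hl : 0 < l) (hlo : β ^ (M + 4) * l ≤ h)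
  (hhi : h ≤ β ^ (M + 3) * l)
include hs ht el eh hl hlo hhi

theorem isTile_periodicTile (r : Fin 3) : IsTile ((periodicTile r).set s t) := by
  -- The sign `1` is an arbitrary choice: the periodic tiles do not depend on `ν`.
  have hX := isDressed_longer 1 hl hlo hhi
  have hh := pos_of_le_pow hl hlo
  have htile : ∀ i (hi : i < 5), IsTile ((piece 1 (M + 5) l h i).tile) := fun i hi =>
    (hX.tile ⟨i, by omega⟩).resolve_left
      (piece_nonempty 1 hl hh (hhi.trans (β_pow_le hl (by omega))) hi).ne_empty
  fin_cases r
  · have := htile 1 (by omega)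
    rwa [(realizes_piece1 el eh 1 _).tile] at this
  · have := htile 4 (by omega)
    rw [(realizes_piece4 el eh 1 _).tile] at this
    exact Step.octagon_isTile hs ht hh eh this.2.1
  · have := htile 3 (by omega)
    rwa [(realizes_piece3 el eh 1 _).tile] at this

/-- A count of tiles: the shortened pentagon is tiled by the starting positions of the return
orbits, the rhombus by `rhombus_tiling`, and `P_1`, `P_2`, `P_3`, `kite4`, `triangle3` account for
the rest. -/
theorem pencil_towers_shortening : (pencil ν (M + 5) l h).Towers
    (Sum.elim (shortening ν M l h).atom fun r => (periodicTile r).set s t)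
    (Sum.elim (stepReturn M) (periodicWord M)) := by
  have hX := isDressed_longer ν hl hlo hhi
  have hY := isDressed_shortening ν hl hlo hhi
  have hI := pencil_induces_shortening hs ht el eh ν hl hlo hhi
  have h1 := (shortening_one el eh ν M).atom
  have h2 := (shortening_two el eh ν M).atom
  have h3 := (shortening_three el eh ν M).atom
  have p2 := passes_Y2 hs ht el eh ν M
  have p3 := passes_Y3 hs ht el eh ν M
  have q1 := passes_P1 el eh ν M
  have q2 := passes_octagon hs ht el eh ν M
  have q3 := passes_P3 hs ht el eh ν M
  refine .of_sum ?_ ?_ ?_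
  · rintro (j | r)
    · exact hI.follow j
    · fin_cases r
      exacts [q1.follow hX, q2.follow hX, q3.follow hX]
  · rintro (⟨_ | _ | _ | _ | k, hk⟩ | r') r hr
    · obtain rfl : r = 0 := Nat.lt_one_iff.1 hr
      simpa using hY.isOpen_atom _
    · obtain rfl : r = 0 := Nat.lt_one_iff.1 hr
      simpa using hY.isOpen_atom _
    · simp only [Sum.elim_inl, h2]
      exact p2.isOpen hX hr
    · simp only [Sum.elim_inl, h3]
      exact p3.isOpen hX hr
    · obtain rfl : r = 0 := Nat.lt_one_iff.1 hr
      simpa using hY.isOpen_atom _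
    · fin_cases r'
      exacts [q1.isOpen hX hr, q2.isOpen hX hr, q3.isOpen hX hr]
  · have hN : 2 * (M + 4) + 1 = (2 * M + 5) + 4 := by ring
    filter_upwards [pentagon_tiling hs ht, rhombus_tiling hs ht,
      shortening_tiling ν hl hlo hhi] with z hz1 hz2 hz3
    rw [domain_pencil (M := M + 1) ν hl hlo hhi, pentagon_eq el eh, hz1, Fintype.sum_sum_type,
      sum_fin_four hN, Fin.sum_univ_three]
    rw [pentagon_eq (shorter_parameter el) eh, sum_fin_four hN] at hz3
    have w1 : ∀ (i : Fin (2 * (M + 5) + 1)) (A : Set ℂ),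
        ∑ r ∈ Finset.range [i].length, ind ((pencil ν (M + 5) l h).map^[r] '' A) z = ind A z := by
      simp
    have w2 : ∑ r ∈ Finset.range 5, ind ((pencil ν (M + 5) l h).map^[r] '' Step.Y2.tile.set s t) z =
        ind (Step.kite0.set s t) z + ind (Step.kite1.set s t) z + ind (Step.kite2.set s t) z +
          ind (Step.kite3.set s t) z + ind (Step.kite4.set s t) z := by
      refine (Finset.sum_congr rfl fun r hr => p2.ind_map_image hX
        (Finset.mem_range.1 hr : r < 5).le z).trans ?_
      simp only [Finset.sum_range_succ, Finset.sum_range_zero, zero_add]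
      rfl
    have w3 : ∑ r ∈ Finset.range 4, ind ((pencil ν (M + 5) l h).map^[r] '' Step.Y3.tile.set s t) z =
        ind (Step.triangle0.set s t) z + ind (Step.triangle1.set s t) z +
          ind (Step.triangle2.set s t) z + ind (Step.triangle3.set s t) z := by
      refine (Finset.sum_congr rfl fun r hr => p3.ind_map_image hX
        (Finset.mem_range.1 hr : r < 4).le z).trans ?_
      simp only [Finset.sum_range_succ, Finset.sum_range_zero, zero_add]
      rfl
    have w4 : ∑ r ∈ Finset.range 3,
        ind ((pencil ν (M + 5) l h).map^[r] '' Step.periodic0.set s t) z =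
        ind (Step.P3.tile.set s t) z + ind (Step.periodic1.set s t) z +
          ind (Step.periodic2.set s t) z := by
      refine (Finset.sum_congr rfl fun r hr => q3.ind_map_image hX
        (Finset.mem_range.1 hr : r < 3).le z).trans ?_
      simp only [Finset.sum_range_succ, Finset.sum_range_zero, zero_add]
      rfl
    rw [h1, h2, h3] at hz3
    simp only [Sum.elim_inl, Sum.elim_inr, h1, h2, h3]
    -- The atoms from the fourth on have one-letter words, so each contributes only its own
    -- indicator.
    rw [Finset.sum_congr rfl fun k _ => w1 ⟨(k : Fin (2 * M + 5)) + 6, by omega⟩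
      ((shortening ν M l h).atom ⟨k + 4, by omega⟩)]
    rw [Step.kite2_eq] at w2
    have e0 := w1 ⟨0, by omega⟩ ((shortening ν M l h).atom ⟨0, by omega⟩)
    have e1 := w1 ⟨5, by omega⟩ (Step.Y1.tile.set s t)
    have f1 := w1 ⟨1, by omega⟩ (Step.P1.tile.set s t)
    have f2 := w1 ⟨4, by omega⟩ (Step.octagon.set s t)
    have key := congr($e0 + $e1 + $w2 + $w3 +
      (∑ k : Fin (2 * M + 5), ind ((shortening ν M l h).atom ⟨k + 4, by omega⟩) z) +
      ($f1 + $f2 + $w4))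
    refine Eq.trans key ?_
    simp only [Step.shorter, Step.kite0, Step.triangle0] at hz1 hz3 ⊢
    omega

omit hs ht el eh in
theorem pencil_renormalizes :
    (pencil ν (M + 5) l h).Renormalizes (shortening ν M l h) (stepReturn M) := by
  have hX := isDressed_longer ν hl hlo hhi
  obtain ⟨s, t, hs, ht, el, eh⟩ := exists_step_parameters (pos_of_le_pow hl hlo).le
    (hhi.trans (β_pow_le hl (by omega : 3 ≤ M + 3)))
  refine ⟨pencil_induces_shortening hs ht el eh ν hl hlo hhi, Fin 3, inferInstance,
    fun r => (periodicTile r).set s t, periodicWord M, fun r => ⟨?_, ?_, ?_⟩,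
    pencil_towers_shortening hs ht el eh ν hl hlo hhi⟩
  · exact isTile_periodicTile hs ht el eh hl hlo hhi r
  · fin_cases r <;> exact List.cons_ne_nil _ _
  · fin_cases r
    · exact ((passes_P1 el eh ν M).map_image hX le_rfl).trans
        (congrArg (Poly.set s t) Step.image_P1)
    · exact ((passes_octagon hs ht el eh ν M).map_image hX le_rfl).trans
        (congrArg (Poly.set s t) Step.image_octagon)
    · exact ((passes_P3 hs ht el eh ν M).map_image hX le_rfl).trans
        (congrArg (Poly.set s t) Step.image_periodic2)

end step

/-! ### Repeated shortening -/

/-- The return word of the atom `j` of the pencil shortened `k` times. -/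
def returnWord : ℕ → ℕ → List ℕ
  | 0, j => [j]
  | k + 1, j => (returnWord k j).flatMap stepWord

/-- Words are defined by substituting the first shortening last; peeling off the last shortening
instead leaves mostly letters `≥ 4`, whose words are single letters. -/
theorem returnWord_succ' (k j : ℕ) :
    returnWord (k + 1) j = (stepWord j).flatMap (returnWord k) := by
  induction k with
  | zero => simp [returnWord]
  | succ k ih =>
    rw [returnWord, ih, List.flatMap_assoc]
    rfl

theorem returnWord_zero (k : ℕ) : returnWord k 0 = [0] := by
  induction k with
  | zero => rfl
  | succ k ih => rw [returnWord, ih]; rfl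

theorem returnWord_add_four (k j : ℕ) : returnWord k (j + 4) = [j + 4 + 2 * k] := by
  induction k with
  | zero => rfl
  | succ k ih =>
    rw [returnWord, ih, show j + 4 + 2 * k = (j + 2 * k) + 4 by omega]
    simp [stepWord]
    omega

theorem returnWord_one (k : ℕ) : returnWord (k + 1) 1 = [2 * k + 5] := by
  simp [returnWord_succ', stepWord, returnWord_add_four k 1, add_comm]

theorem returnWord_three (k : ℕ) :
    returnWord (k + 1) 3 = [2 * k + 5, 2 * k + 4, 2 * k + 4, 2 * k + 5] := by
  simp [returnWord_succ', stepWord, returnWord_add_four k 1, returnWord_add_four k 0, add_comm]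

/-- The letter `2` in the middle of `5, 4, 2, 4, 5` makes the word grow symmetrically, by two
letters on each side; this yields the factor `2` and the sum in the matrix. -/
theorem returnWord_two (k : ℕ) : returnWord (k + 1) 2 =
    [2 * k + 5, 2 * k + 4] ++ returnWord k 2 ++ [2 * k + 4, 2 * k + 5] := by
  simp [returnWord_succ', stepWord, returnWord_add_four k 1, returnWord_add_four k 0, add_comm]

theorem count_cons_eq (a i : ℕ) (w : List ℕ) :
    (a :: w).count i = w.count i + if i = a then 1 else 0 := by
  simp only [List.count_cons, beq_iff_eq, eq_comm (a := a)]

theorem count_returnWord_two (k i : ℕ) : (returnWord k 2).count i =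
    (if i = 2 then 1 else 0) + 2 * ∑ m ∈ Finset.Icc 4 (2 * k + 3), if i = m then 1 else 0 := by
  induction k with
  | zero => simp [returnWord, count_cons_eq]
  | succ k ih =>
    rw [returnWord_two, List.count_append, List.count_append, ih,
      show 2 * (k + 1) + 3 = 2 * k + 3 + 1 + 1 by ring,
      Finset.sum_Icc_succ_top (b := 2 * k + 3 + 1) (by omega),
      Finset.sum_Icc_succ_top (b := 2 * k + 3) (by omega)]
    simp only [count_cons_eq, List.count_nil, add_assoc, Nat.reduceAdd]
    ring

theorem count_returnWord (k i : ℕ) : ∀ j,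
    (returnWord (k + 1) j).count i = shorteningMatrix (k + 5) i j
  | 0 => by simp [returnWord_zero, shorteningMatrix, count_cons_eq]
  | 1 => by
    simp only [returnWord_one, shorteningMatrix, count_cons_eq, List.count_nil, zero_add,
      show 2 * (k + 5) - 5 = 2 * k + 5 by omega]
  | 2 => count_returnWord_two (k + 1) i
  | 3 => by
    simp only [returnWord_three, shorteningMatrix, count_cons_eq, List.count_nil,
      show 2 * (k + 5) - 5 = 2 * k + 5 by omega, show 2 * (k + 5) - 6 = 2 * k + 4 by omega]
    ring
  | j + 4 => by
    simp only [returnWord_add_four, shorteningMatrix, count_cons_eq, List.count_nil, zero_add]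
    rw [show j + 4 + 2 * (k + 1) = j + 4 + 2 * (k + 5) - 8 by omega]

section chain

variable {h l : ℝ} {M k : ℕ} (ν : ℤˣ) {G : Isom} (hG : InGroup G) (hl : 0 < l)
include hG hl

theorem isDressed_pencilAt (hlo : β ^ (M + 3) * l ≤ h) (hhi : h ≤ β ^ (M + 2) * l) :
    (pencilAt G ν (M + 4) l h).IsDressed :=
  (isDressed_pencil ν hl hlo hhi).transform hG

/-- The repeatedly shortened pencil. -/
theorem pencilAt_renormalizes (hlo : β ^ (M + k + 3) * l ≤ h) (hhi : h ≤ β ^ (M + k + 2) * l) :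
    ∃ w : Fin (2 * (M + 4) + 1) → List (Fin (2 * (M + k + 4) + 1)),
      (∀ j, (w j).map Fin.val = returnWord k j) ∧
      (pencilAt G ν (M + k + 4) l h).Renormalizes
        (pencilAt (G * U0 ^ k) ((-1) ^ k * ν) (M + 4) (β ^ k * l) h) w := by
  induction k generalizing G ν l with
  | zero =>
    refine ⟨fun j => [j], fun j => rfl, ?_⟩
    simp only [pow_zero, mul_one, one_mul]
    exact .refl (isDressed_pencilAt ν hG hl hlo hhi)
  | succ k ih =>
    obtain ⟨h1, h2, h3⟩ := shortening_bounds (M := M + k) hl hlo hhi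
    have hG' : InGroup (G * U0) := hG.mul (inGroup_U2 0)
    -- The first shortening is split off, its reflection absorbed into the placement and its sign
    -- into `ν`; the remaining `k` shortenings start from `β * l`.
    obtain ⟨w, hw, hren⟩ := ih (-ν) hG' h1 h2 h3
    have hX := isDressed_longer (M := M + k) ν hl hlo hhi
    have hstep := (pencil_renormalizes (M := M + k) ν hl hlo hhi).transform hX hG
    rw [DressedDomain.transform_transform] at hstep
    refine ⟨fun j => (w j).flatMap (stepReturn (M + k)), fun j => ?_, ?_⟩
    · rw [returnWord, ← hw, List.map_flatMap, List.flatMap_map]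
      exact congrArg (List.flatMap · (w j)) (funext fun i => stepReturn_map_val (M + k) i)
    · have := hstep.trans hren (hX.transform hG) (isDressed_pencilAt (-ν) hG' h1 h2 h3)
      rw [pow_succ' U0, ← mul_assoc, pow_succ (-1 : ℤˣ), mul_assoc ((-1) ^ k), neg_one_mul,
        pow_succ β, mul_assoc (β ^ k)]
      exact this

end chain

end Pencil

end

/-! ### The Pencil Shortening Lemma -/

theorem mainTheorem5 (L : ℕ) (hL : 4 ≤ L) (l h : ℝ) (hl : 0 < l)
    (hlo : Pencil.β ^ (L - 1) * l ≤ h) (hhi : h ≤ Pencil.β ^ (L - 2) * l)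
    (ν : ℤˣ) (G : Pencil.Isom) (hG : Pencil.InGroup G) :
    -- the parent pencil is a dressed domain
    ((Pencil.pencilAt G ν L l h).IsDressed ∧
      (Pencil.pencilAt G ν L l h).domain = Pencil.pentagonAt G l h) ∧
    -- the shortened pencils (k = 0 is the parent)
    (∀ k ≤ L - 4,
      Pencil.InGroup (G * Pencil.U0 ^ k) ∧
      Pencil.parity (G * Pencil.U0 ^ k) = (-1) ^ k * Pencil.parity G ∧
      (Pencil.pencilAt (G * Pencil.U0 ^ k) ((-1) ^ k * ν) (L - k) (Pencil.β ^ k * l) h).domain =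
        Pencil.pentagonAt (G * Pencil.U0 ^ k) (Pencil.β ^ k * l) h ∧
      (∀ i, ((Pencil.pencilAt (G * Pencil.U0 ^ k) ((-1) ^ k * ν) (L - k)
          (Pencil.β ^ k * l) h).atom i).Nonempty ↔
        (h < Pencil.β ^ (L - 2) * l ∨ (i : ℕ) < 2 * (L - k) - 1)) ∧
      ∃ τ, (Pencil.pencilAt G ν L l h).IsSubdomain
        (Pencil.pencilAt (G * Pencil.U0 ^ k) ((-1) ^ k * ν) (L - k) (Pencil.β ^ k * l) h) τ) ∧
    -- the minimal pencil (k = L - 4), with atoms numbered 0, ..., 8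
    Pencil.parity (G * Pencil.U0 ^ (L - 4)) = (-1) ^ L * Pencil.parity G ∧
    ∃ τ : Fin 9 → ℕ,
      (Pencil.pencilAt G ν L l h).IsSubdomain
        (Pencil.pencilAt (G * Pencil.U0 ^ (L - 4)) ((-1) ^ L * ν) 4
          (Pencil.β ^ (L - 4) * l) h) τ ∧
      (5 ≤ L → (Pencil.pencilAt G ν L l h).HasIncidence
        (Pencil.pencilAt (G * Pencil.U0 ^ (L - 4)) ((-1) ^ L * ν) 4
          (Pencil.β ^ (L - 4) * l) h) τ
        (fun i j => Pencil.shorteningMatrix L i j)) ∧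
      (Pencil.pencilAt G ν L l h).RecursivelyTiled
        (Pencil.pencilAt (G * Pencil.U0 ^ (L - 4)) ((-1) ^ L * ν) 4
          (Pencil.β ^ (L - 4) * l) h) τ := by
  -- Writing `L = M + k + 4`, with `k` shortenings done and `M` still possible, removes the
  -- truncated subtractions.
  have hP {k M : ℕ} (e : L = M + k + 4) : Pencil.β ^ (M + k + 3) * l ≤ h ∧ h ≤ Pencil.β ^ (M + k + 2) * l := by
    subst e
    exact ⟨hlo, hhi⟩
  have hQ {k M : ℕ} (e : L = M + k + 4) : 0 < Pencil.β ^ k * l ∧ Pencil.β ^ (M + 3) * (Pencil.β ^ k * l) ≤ h ∧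
      h ≤ Pencil.β ^ (M + 2) * (Pencil.β ^ k * l) := by
    obtain ⟨h1, h2⟩ := hP e
    rw [← mul_assoc, ← mul_assoc, ← pow_add, ← pow_add, add_right_comm M 3 k, add_right_comm M 2 k]
    exact ⟨mul_pos (pow_pos Pencil.β_pos k) hl, h1, h2⟩
  have hGk (k : ℕ) : Pencil.InGroup (G * Pencil.U0 ^ k) := hG.mul ((Pencil.inGroup_U2 0).pow k)
  have hpar (k : ℕ) : Pencil.parity (G * Pencil.U0 ^ k) = (-1) ^ k * Pencil.parity G := by
    rw [Pencil.parity_mul, Pencil.parity_pow_U0, mul_comm]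
  refine ⟨?_, fun k hk => ?_, ?_⟩
  · obtain ⟨M, rfl⟩ : ∃ M, L = M + 0 + 4 := ⟨L - 4, by omega⟩
    obtain ⟨h1, h2⟩ := hP (k := 0) (M := M) rfl
    refine ⟨Pencil.isDressed_pencilAt ν hG hl h1 h2, ?_⟩
    rw [Pencil.pencilAt, Pencil.DressedDomain.domain_transform, Pencil.domain_pencil ν hl h1 h2, Pencil.pentagonAt]
  · obtain ⟨M, rfl⟩ : ∃ M, L = M + k + 4 := ⟨L - 4 - k, by omega⟩
    obtain ⟨h1, h2⟩ := hP rfl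
    obtain ⟨hl', h1', h2'⟩ := hQ rfl
    -- The number of atoms occurs in types, so `L - k` is replaced through a variable rather than
    -- rewritten.
    generalize hL' : M + k + 4 - k = L'
    obtain rfl : L' = M + 4 := by omega
    refine ⟨hGk k, hpar k, ?_, fun i => ?_, ?_⟩
    · rw [Pencil.pencilAt, Pencil.DressedDomain.domain_transform, Pencil.domain_pencil _ hl' h1' h2', Pencil.pentagonAt]
    · refine Set.image_nonempty.trans ((Pencil.tile_nonempty_iff _ hl' h1' h2' i.2).trans ?_)
      rw [← mul_assoc, ← pow_add, show M + k + 4 - 2 = M + 2 + k by omega]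
    · obtain ⟨w, -, hw⟩ := Pencil.pencilAt_renormalizes ν hG hl h1 h2
      exact ⟨_, hw.induces.isSubdomain (Pencil.isDressed_pencilAt _ (hGk k) hl' h1' h2')⟩
  · obtain ⟨k, rfl⟩ : ∃ k, L = 0 + k + 4 := ⟨L - 4, by omega⟩
    obtain ⟨h1, h2⟩ := hP rfl
    obtain ⟨hl', h1', h2'⟩ := hQ rfl
    obtain ⟨w, hwk, hw⟩ := Pencil.pencilAt_renormalizes ν hG hl h1 h2
    have hX := Pencil.isDressed_pencilAt ν hG hl h1 h2
    -- The exponents `L` and `L - 4` have the same parity.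
    have hu : (-1 : ℤˣ) ^ (0 + k + 4) = (-1) ^ k := by
      rw [zero_add, pow_add, show (-1 : ℤˣ) ^ 4 = 1 by decide, mul_one]
    have hr : (-1 : ℝ) ^ (0 + k + 4) = (-1) ^ k := by rw [zero_add, pow_add]; norm_num
    rw [hu, hr, show 0 + k + 4 - 4 = k by omega]
    refine ⟨hpar k, fun j => (w j).length,
      hw.induces.isSubdomain (Pencil.isDressed_pencilAt _ (hGk k) hl' h1' h2'), fun h5 i j x hx => ?_,
      hw.recursivelyTiled hX⟩
    -- `L ≥ 5` means at least one shortening. For `L = 4` the return words are single letters and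
    -- the matrix formula would be false.
    obtain ⟨k, rfl⟩ : ∃ n, k = n + 1 := ⟨k - 1, by omega⟩
    refine (hw.induces.hasIncidence hX i j x hx).trans ?_
    change (w j).count i = Pencil.shorteningMatrix (0 + (k + 1) + 4) i j
    rw [← List.count_map_of_injective _ _ Fin.val_injective, hwk, Pencil.count_returnWord]
    exact congrArg (Pencil.shorteningMatrix · i j) (by omega : k + 5 = 0 + (k + 1) + 4)
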